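/- **Setting.** Let $V$ be a finite-dimensional real vector space, $I$ a finite set, $(\alpha_i)_{i\in I}$ a free family in $V^*$ and $(\alpha_i^\vee)_{i\in I}$ a free family in $V$ such that $(\alpha_j(\alpha_i^\vee))_{i,j}$ is a generalized Cartan matrix. Let $r_i(v)=v-\alpha_i(v)\alpha_i^\vee$, let $W^v\subset GL(V)$ be the Weyl group generated by the $r_i$, with length $\ell$ and unit $e$, let $\Phi=\{w\alpha_i\mid w\in W^v,\ i\in I\}$ be the set of real roots, with coroots $(w\alpha_i)^\vee=w\alpha_i^\vee$, let $\Phi_+=\Phi\cap\bigoplus_i\mathbb Z_{\ge0}\alpha_i$, $Q^\vee_+=\bigoplus_i\mathbb Z_{\ge0}\alpha_i^\vee$, and let $Y\subset V$ be a discrete subgroup containing all $\alpha_i^\vee$ with $\alpha(Y)\subset\mathbb Z$ for all $\alpha\in\Phi$. Let $\mathbb Z_\sigma=\mathbb Z[(\sigma_i^{\pm1},\sigma_i'^{\pm1})_{i\in I}]$ be the Laurent polynomial ring in indeterminates $\sigma_i,\sigma_i'$, some of which may be identified with each other, where in any case $\sigma_i=\sigma_i'$ if $\alpha_i(Y)=\mathbb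 Z$, and $\sigma_i=\sigma_i'=\sigma_j=\sigma_j'$ if $\alpha_i(\alpha_j^\vee)=\alpha_j(\alpha_i^\vee)=-1$. Put $\sigma_\alpha=\sigma_i$, $\sigma'_\alpha=\sigma'_i$ for $\alpha\in W^v\alpha_i$, and $\sigma_w=\sigma_{i_1}\cdots\sigma_{i_n}$ for a reduced decomposition $w=r_{i_1}\cdots r_{i_n}$. Put $b(t,u;z)=\frac{(t-t^{-1})+(u-u^{-1})z}{1-z^2}$ and $c(t,u;z)=t-b(t,u;z)$, and for $\alpha\in\Phi$ put $b(\alpha^\vee)=b(\sigma_\alpha,\sigma'_\alpha;e^{\alpha^\vee})$, $c(\alpha^\vee)=c(\sigma_\alpha,\sigma'_\alpha;e^{\alpha^\vee})$, $c'(\alpha^\vee)=\sigma_\alpha c(\alpha^\vee)$. For $w\in W^v$ let $\mathbb Z_\sigma[[Y,-wQ^\vee_+]]$ be the algebra of formal sums $\sum_{y\in Y}a_ye^y$, $a_y\in\mathbb Z_\sigma$, with support in a finite union of sets $\lambda-wQ^\vee_+$, $\lambda\in Y$. Let $\mathbb Z_\sigma(Y)$ be the algebra of the fractions of elements of $\mathbb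 Z_\sigma[Y]$ that have an expansion in $\mathbb Z_\sigma[[Y,-wQ^\vee_+]]$ for every $w\in W^v$. Let $\mathbb Z_\sigma((Y))$ be its completion, formed by the limits of the sequences in $\mathbb Z_\sigma(Y)$ that converge in each $\mathbb Z_\sigma[[Y,-wQ^\vee_+]]$ (supports eventually in a fixed finite union of sets $\lambda-wQ_+^\vee$, each coefficient eventually constant). The group $W^v$ acts by ${}^w(e^y)=e^{wy}$. Let $\mathbb Z_\sigma((Y))[[W^v]]$ be the set of formal sums $\sum_{w\in W^v}a_w[w]$ with $a_w\in\mathbb Z_\sigma((Y))$, and let $\mathbb Z_\sigma(Y)[W^v]$ be the algebra of finite sums $\sum_w f_w[w]$, $f_w\in\mathbb Z_\sigma(Y)$, with $(f[w])(g[v])=f\,({}^wg)[wv]$. Let $^{BL}\mathcal H$ be the Bernstein-Lusztig-Hecke algebra, i.e. the $\mathbb Z_\sigma$-algebra generated by elements $H_w$ ($w\in W^v$) and $Z^\lambda$ ($\lambda\in Y$) with the relations $H_e=Z^0=1$, $Z^\lambda Z^\mu=Z^{\lambda+\mu}$, and, with $H_i=H_{r_i}$, $H_iH_w=H_{r_iw}$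 if $\ell(r_iw)>\ell(w)$, $H_iH_w=(\sigma_i-\sigma_i^{-1})H_w+H_{r_iw}$ if $\ell(r_iw)<\ell(w)$, and $H_iZ^\lambda-Z^{r_i\lambda}H_i=b(\sigma_i,\sigma_i';Z^{-\alpha_i^\vee})(Z^\lambda-Z^{r_i\lambda})$. **Proposition (Cherednik's identity).** All $b(\alpha^\vee),c(\alpha^\vee)$ ($\alpha\in\Phi$) are defined in $\mathbb Z_\sigma(Y)$ (the elements $1-e^{2\alpha^\vee}$ are invertible in every $\mathbb Z_\sigma[[Y,-wQ^\vee_+]]$), and there is an algebra homomorphism $\Psi:{}^{BL}\mathcal H\to\mathbb Z_\sigma(Y)[W^v]$ with $\Psi(H_i)=c(\alpha_i^\vee)[r_i]+b(\alpha_i^\vee)[e]$ and $\Psi(Z^\lambda)=e^{-\lambda}$, which is used to regard $H_w$ as an element of $\mathbb Z_\sigma(Y)[W^v]$. The sum $$P_\sigma=\sum_{w\in W^v}\sigma_wH_w=\sum_{v\in W^v}C_v[v]$$ is well defined in $\mathbb Z_\sigma((Y))[[W^v]]$: for each $v$, the coefficient of $[v]$ in $\sum_{\ell(w)\le N}\sigma_wH_w$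 converges to some $C_v\in\mathbb Z_\sigma((Y))$ as $N\to\infty$. The product $\Delta=\prod_{\alpha\in\Phi_+}c'(-\alpha^\vee)$ converges to an invertible element of $\mathbb Z_\sigma((Y))$, and $\mathscr J_\sigma=\sum_{w\in W^v}{}^w\!\Delta\,[w]$ lies in $\mathbb Z_\sigma((Y))[[W^v]]$. With $\Gamma=C_e$, the element $\mathfrak m_\sigma=\Gamma\Delta^{-1}$ of $\mathbb Z_\sigma((Y))$ is invertible in $\mathbb Z_\sigma((Y))$ and $W^v$-invariant, and $$P_\sigma=\mathfrak m_\sigma\,\mathscr J_\sigma=(\Gamma\Delta^{-1})\sum_{w\in W^v}{}^w\!\Delta\,[w]\quad\text{in }\mathbb Z_\sigma((Y))[[W^v]].$$ -/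

import Mathlib

open scoped nonZeroDivisors
open Filter

noncomputable section

/-- A Kac-Moody vectorial datum `(V, (α_i), (α_i^∨))` with its generalized Cartan matrix, a discrete
group `Y` of translations with `Q^∨ ⊆ Y ⊆ P^∨`, and the names of the indeterminates
`σ_i = X_{par i}`, `σ'_i = X_{par' i}` (some of them being identified). -/
structure HeckeDatum (I T V : Type*) [NormedAddCommGroup V] [NormedSpace ℝ V] where
  /-- the simple roots `α_i` -/
  root : I → Module.Dual ℝ V
  /-- the simple coroots `α_i^∨` -/
  coroot : I → V
  root_linearIndependent : LinearIndependent ℝ root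
  coroot_linearIndependent : LinearIndependent ℝ coroot
  /-- the generalized Cartan matrix `(α_j(α_i^∨))_{i,j}` -/
  cartan : Matrix I I ℤ
  root_coroot : ∀ i j, root j (coroot i) = (cartan i j : ℝ)
  cartan_diag : ∀ i, cartan i i = 2
  cartan_nonpos : ∀ i j, i ≠ j → cartan i j ≤ 0
  cartan_zero : ∀ i j, cartan i j = 0 → cartan j i = 0
  /-- the group `Y` -/
  Y : AddSubgroup V
  discrete_Y : DiscreteTopology Y
  coroot_mem : ∀ i, coroot i ∈ Y
  /-- simple roots are integral on `Y`; as every real root is an integral combination of the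
  simple ones, this says that `Y ⊆ P^∨` -/
  root_integral : ∀ i, ∀ y ∈ Y, ∃ n : ℤ, root i y = n
  /-- the name of `σ_i` -/
  par : I → T
  /-- the name of `σ'_i` -/
  par' : I → T
  par_cover : ∀ t, ∃ i, par i = t ∨ par' i = t
  /-- if `α_i(Y) = ℤ` then `σ_i = σ'_i` -/
  par_odd : ∀ i, (∀ n : ℤ, ∃ y ∈ Y, root i y = n) → par i = par' i
  /-- if `α_i(α_j^∨) = α_j(α_i^∨) = -1` then `σ_i = σ_j = σ'_i = σ'_j` -/
  par_bond : ∀ i j, cartan j i = -1 → cartan i j = -1 →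
    par i = par j ∧ par i = par' i ∧ par i = par' j

namespace HeckeDatum

/-- The ring `ℤ_σ`: Laurent polynomials with integer coefficients in indeterminates `X_t`,
`t ∈ T`. -/
abbrev Coef (T : Type*) : Type _ := AddMonoidAlgebra ℤ (T →₀ ℤ)

/-- The indeterminate `X_t`, as a unit of `ℤ_σ`. -/
def indet {T : Type*} (t : T) : (Coef T)ˣ where
  val := AddMonoidAlgebra.single (Finsupp.single t 1) 1
  inv := AddMonoidAlgebra.single (-Finsupp.single t 1) 1
  val_inv := by
    rw [AddMonoidAlgebra.single_mul_single, add_neg_cancel, mul_one]; rfl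
  inv_val := by
    rw [AddMonoidAlgebra.single_mul_single, neg_add_cancel, mul_one]; rfl

variable {I T V : Type*} [NormedAddCommGroup V] [NormedSpace ℝ V]
variable (D : HeckeDatum I T V)

/-! ### The Weyl group -/

theorem root_coroot_self (i : I) : D.root i (D.coroot i) = 2 := by
  rw [D.root_coroot, D.cartan_diag]; norm_num

/-- The simple reflection `r_i(v) = v - α_i(v) α_i^∨` of `V`. -/
def refl (i : I) : V ≃ₗ[ℝ] V := Module.reflection (D.root_coroot_self i)

theorem refl_apply (i : I) (v : V) : D.refl i v = v - D.root i v • D.coroot i :=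
  Module.reflection_apply v (D.root_coroot_self i)

theorem refl_mul_self (i : I) : D.refl i * D.refl i = 1 := by
  ext v
  exact Module.involutive_reflection (D.root_coroot_self i) v

/-- The Weyl group `W^v`. -/
def W : Subgroup (V ≃ₗ[ℝ] V) := Subgroup.closure (Set.range D.refl)

/-- The simple reflection `r_i` as an element of `W^v`. -/
def r (i : I) : D.W := ⟨D.refl i, Subgroup.subset_closure ⟨i, rfl⟩⟩

theorem r_mul_self (i : I) : D.r i * D.r i = 1 := Subtype.ext (D.refl_mul_self i)

/-- The product `r_{i_1} ⋯ r_{i_n}` of a word `(i_1, …, i_n)`. -/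
def wordProd (l : List I) : D.W := (l.map D.r).prod

theorem wordProd_append (l l' : List I) :
    D.wordProd (l ++ l') = D.wordProd l * D.wordProd l' := by
  simp [wordProd]

theorem exists_word (w : D.W) : ∃ l : List I, D.wordProd l = w := by
  obtain ⟨w, hw⟩ := w
  induction hw using Subgroup.closure_induction with
  | mem x hx =>
    obtain ⟨i, rfl⟩ := hx
    exact ⟨[i], by simp [wordProd, r]⟩
  | one => exact ⟨[], rfl⟩
  | mul x y hx hy ihx ihy =>
    obtain ⟨l, hl⟩ := ihx
    obtain ⟨l', hl'⟩ := ihy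
    exact ⟨l ++ l', by rw [wordProd_append, hl, hl']; rfl⟩
  | inv x hx ih =>
    obtain ⟨l, hl⟩ := ih
    refine ⟨l.reverse, ?_⟩
    have key : ∀ l : List I, D.wordProd l.reverse = (D.wordProd l)⁻¹ := by
      intro l
      induction l with
      | nil => simp [wordProd]
      | cons i l ih =>
        rw [List.reverse_cons, wordProd_append, ih]
        have h1 : D.wordProd (i :: l) = D.r i * D.wordProd l := by simp [wordProd]
        have h2 : D.wordProd [i] = D.r i := by simp [wordProd]
        rw [h1, h2, mul_inv_rev, inv_eq_of_mul_eq_one_right (D.r_mul_self i)]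
    rw [key, hl]; rfl

theorem exists_length (w : D.W) : ∃ n : ℕ, ∃ l : List I, l.length = n ∧ D.wordProd l = w := by
  obtain ⟨l, hl⟩ := D.exists_word w
  exact ⟨_, l, rfl, hl⟩

open Classical in
/-- The length `ℓ(w)` with respect to the simple reflections. -/
def length (w : D.W) : ℕ := Nat.find (D.exists_length w)

open Classical in
theorem exists_reduced (w : D.W) : ∃ l : List I, l.length = D.length w ∧ D.wordProd l = w :=
  Nat.find_spec (D.exists_length w)

/-- A reduced word of `w`. -/
def reducedWord (w : D.W) : List I := (D.exists_reduced w).choose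

/-- `W^v_N = {w | ℓ(w) ≤ N}` is finite. -/
theorem ball_finite [Finite I] (N : ℕ) : {w : D.W | D.length w ≤ N}.Finite := by
  refine ((List.finite_length_le I N).image D.wordProd).subset ?_
  intro w hw
  obtain ⟨l, hl, hlw⟩ := D.exists_reduced w
  exact ⟨l, by simpa [hl] using hw, hlw⟩

/-- `σ_i` -/
def sig (i : I) : (Coef T)ˣ := indet (D.par i)

/-- `σ'_i` -/
def sig' (i : I) : (Coef T)ˣ := indet (D.par' i)

/-- `σ_w = σ_{i_1} ⋯ σ_{i_n}` for a reduced decomposition `w = r_{i_1} ⋯ r_{i_n}` (the value does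
not depend on the decomposition). -/
def sigW (w : D.W) : (Coef T)ˣ := ((D.reducedWord w).map D.sig).prod

/-! ### The action on `Y`, roots and coroots -/

theorem W_mem_Y (w : D.W) : ∀ y : V, y ∈ D.Y → (w : V ≃ₗ[ℝ] V) y ∈ D.Y := by
  obtain ⟨l, rfl⟩ := D.exists_word w
  induction l with
  | nil => intro y hy; simpa [wordProd] using hy
  | cons i l ih =>
    intro y hy
    have h1 : D.wordProd (i :: l) = D.r i * D.wordProd l := by simp [wordProd]
    have h2 := ih y hy
    obtain ⟨n, hn⟩ := D.root_integral i _ h2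
    have h3 : ((D.wordProd (i :: l) : D.W) : V ≃ₗ[ℝ] V) y
        = D.refl i (((D.wordProd l : D.W) : V ≃ₗ[ℝ] V) y) := by rw [h1]; rfl
    rw [h3, refl_apply, hn]
    refine D.Y.sub_mem h2 ?_
    have h4 : ((n : ℝ) • D.coroot i) = n • D.coroot i := by
      rw [← Int.cast_smul_eq_zsmul ℝ]
    rw [h4]
    exact D.Y.zsmul_mem (D.coroot_mem i) n

instance : DistribMulAction D.W D.Y where
  smul w y := ⟨(w : V ≃ₗ[ℝ] V) (y : V), D.W_mem_Y w y y.2⟩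
  one_smul _ := rfl
  mul_smul _ _ _ := rfl
  smul_zero w := Subtype.ext (map_zero (w : V ≃ₗ[ℝ] V))
  smul_add w x y := Subtype.ext (map_add (w : V ≃ₗ[ℝ] V) (x : V) (y : V))

theorem coe_smul_Y (w : D.W) (y : D.Y) : ((w • y : D.Y) : V) = (w : V ≃ₗ[ℝ] V) y := rfl

/-- The simple coroot `α_i^∨` in `Y`. -/
def simpleCoroot (i : I) : D.Y := ⟨D.coroot i, D.coroot_mem i⟩

/-- The dual action of `W^v` on linear forms, `(w α)(v) = α(w⁻¹ v)`. -/
def dualAct (w : D.W) (a : Module.Dual ℝ V) : Module.Dual ℝ V :=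
  a ∘ₗ ((w⁻¹ : D.W) : V ≃ₗ[ℝ] V).toLinearMap

/-- The set `Φ` of real roots. -/
def roots : Set (Module.Dual ℝ V) := {a | ∃ (w : D.W) (i : I), D.dualAct w (D.root i) = a}

/-- The set `Φ_+ = Φ ∩ Q_+` of positive real roots. -/
def posRoots : Set (Module.Dual ℝ V) :=
  D.roots ∩ (AddSubmonoid.closure (Set.range D.root) : AddSubmonoid (Module.Dual ℝ V))

theorem exists_simple (a : D.roots) :
    ∃ p : D.W × I, D.dualAct p.1 (D.root p.2) = (a : Module.Dual ℝ V) :=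
  let ⟨w, i, h⟩ := a.2
  ⟨(w, i), h⟩

/-- Some `(w, i)` with `α = w α_i`; the three notions below do not depend on it. -/
def rootRep (a : D.roots) : D.W × I := (D.exists_simple a).choose

/-- The coroot `α^∨ = w α_i^∨` of a real root `α = w α_i`. -/
def corootOf (a : D.roots) : D.Y := (D.rootRep a).1 • D.simpleCoroot (D.rootRep a).2

/-- `σ_α = σ_i` for `α ∈ W^v α_i`. -/
def sigRoot (a : D.roots) : (Coef T)ˣ := D.sig (D.rootRep a).2

/-- `σ'_α = σ'_i` for `α ∈ W^v α_i`. -/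
def sigRoot' (a : D.roots) : (Coef T)ˣ := D.sig' (D.rootRep a).2

/-- A positive real root as a real root. -/
def posToRoot (a : D.posRoots) : D.roots := ⟨a.1, a.2.1⟩

/-! ### The completions `ℤ_σ[[Y, -wQ^∨_+]]` -/

/-- `Q^∨_+`, the monoid generated by the simple coroots. -/
def Qpos : AddSubmonoid V := AddSubmonoid.closure (Set.range D.coroot)

/-- `Y` with the order `x ≤ y ↔ x - y ∈ wQ^∨_+`, for which larger elements are further away in
the direction of `-wQ^∨_+`. -/
def Dir (_w : D.W) : Type _ := D.Y

instance (w : D.W) : AddCommGroup (D.Dir w) := inferInstanceAs (AddCommGroup D.Y)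

theorem Qpos_antisymm {v : V} (h : v ∈ D.Qpos) (h' : -v ∈ D.Qpos) : v = 0 := by
  obtain ⟨f, hf⟩ := (AddSubmonoid.mem_closure_range_iff (f := D.coroot)).1 h
  obtain ⟨g, hg⟩ := (AddSubmonoid.mem_closure_range_iff (f := D.coroot)).1 h'
  have hli : LinearIndependent ℕ D.coroot :=
    LinearIndependent.restrict_scalars' ℕ D.coroot_linearIndependent
  have h0 : Finsupp.linearCombination ℕ D.coroot (f + g) = 0 := by
    rw [map_add, Finsupp.linearCombination_apply, Finsupp.linearCombination_apply, ← hf, ← hg,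
      add_neg_cancel]
  have h1 : f + g = 0 := hli (by rw [h0, map_zero])
  have h2 : f = 0 := by
    ext i
    have := DFunLike.congr_fun h1 i
    simp only [Finsupp.add_apply, Finsupp.zero_apply] at this ⊢
    omega
  rw [hf, h2, Finsupp.sum_zero_index]

instance (w : D.W) : PartialOrder (D.Dir w) where
  le x y := ∃ q ∈ D.Qpos,
    ((show D.Y from x) : V) - ((show D.Y from y) : V) = (w : V ≃ₗ[ℝ] V) q
  le_refl x := ⟨0, D.Qpos.zero_mem, by simp⟩
  le_trans x y z := by
    rintro ⟨p, hp, h⟩ ⟨q, hq, h'⟩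
    exact ⟨p + q, D.Qpos.add_mem hp hq, by rw [map_add, ← h, ← h']; abel⟩
  le_antisymm x y := by
    rintro ⟨p, hp, h⟩ ⟨q, hq, h'⟩
    have hqp : q = -p := (w : V ≃ₗ[ℝ] V).injective (by rw [map_neg, ← h, ← h']; abel)
    have hp0 : p = 0 := D.Qpos_antisymm hp (hqp ▸ hq)
    rw [hp0, map_zero, sub_eq_zero] at h
    exact Subtype.ext h

theorem dir_le_iff (w : D.W) (x y : D.Dir w) : x ≤ y ↔ ∃ q ∈ D.Qpos,
    ((show D.Y from x) : V) - ((show D.Y from y) : V) = (w : V ≃ₗ[ℝ] V) q := Iff.rfl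

instance (w : D.W) : IsOrderedCancelAddMonoid (D.Dir w) :=
  haveI : IsOrderedAddMonoid (D.Dir w) :=
    { add_le_add_left := by
        rintro x y ⟨q, hq, h⟩ z
        exact ⟨q, hq, by rw [← h]; exact add_sub_add_right_eq_sub _ _ _⟩ }
  inferInstance

/-- `⋃_{λ ∈ S} (λ - wQ^∨_+)` -/
def cones (w : D.W) (S : Set (D.Dir w)) : Set (D.Dir w) := {y | ∃ x ∈ S, x ≤ y}

theorem cones_isPWO [Finite I] (w : D.W) {S : Set (D.Dir w)} (hS : S.Finite) :
    (D.cones w S).IsPWO := by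
  cases nonempty_fintype I
  let q : (I → ℕ) → D.Y := fun a => w • ∑ i, a i • D.simpleCoroot i
  have hq : ∀ a, ((q a : D.Y) : V) = (w : V ≃ₗ[ℝ] V) (∑ i, a i • D.coroot i) := by
    intro a
    rw [coe_smul_Y, AddSubgroup.val_finsetSum]
    rfl
  let g : D.Dir w → (I → ℕ) → D.Dir w := fun x a => ((show D.Y from x) - q a : D.Y)
  have hsub : D.cones w S ⊆ ⋃ x ∈ S, g x ''
      Set.univ := by
    rintro y ⟨x, hx, p, hp, h⟩
    obtain ⟨a, rfl⟩ := AddSubmonoid.mem_closure_range_iff_of_fintype.1 hp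
    refine Set.mem_biUnion hx ⟨a, trivial, ?_⟩
    have h' : (q a : D.Y) = (show D.Y from x) - (show D.Y from y) :=
      Subtype.ext (by rw [hq, ← h]; rfl)
    change (show D.Y from x) - q a = (show D.Y from y)
    rw [h', sub_sub_cancel]
  refine Set.IsPWO.mono ?_ hsub
  have hone : ∀ x : D.Dir w, (g x ''
      Set.univ).IsPWO := by
    intro x
    refine (Set.isPWO_of_wellQuasiOrderedLE _).image_of_monotone ?_
    intro a b hab
    refine ⟨∑ i, (b i - a i) • D.coroot i,
      sum_mem fun i _ => nsmul_mem (AddSubmonoid.subset_closure (Set.mem_range_self i)) _, ?_⟩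
    have e : ∑ i, b i • D.coroot i
        = ∑ i, a i • D.coroot i + ∑ i, (b i - a i) • D.coroot i := by
      rw [← Finset.sum_add_distrib]
      refine Finset.sum_congr rfl fun i _ => ?_
      rw [← add_smul, Nat.add_sub_cancel' (hab i)]
    change (((show D.Y from x) : V) - (q a : V)) - (((show D.Y from x) : V) - (q b : V)) = _
    rw [hq, hq, e, map_add]
    abel
  have := Finset.isPWO_bUnion hS.toFinset
    (f := fun x => g x '' Set.univ)
  simp only [Set.Finite.mem_toFinset] at this
  exact this.2 fun x _ => hone x

/-- A subset of `Y` is well-partially-ordered in the direction `-wQ^∨_+` if and only if it is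
contained in a finite union of cones `λ - wQ^∨_+`. -/
theorem isPWO_iff [Finite I] (w : D.W) (s : Set (D.Dir w)) :
    s.IsPWO ↔ ∃ S : Set (D.Dir w), S.Finite ∧ s ⊆ D.cones w S := by
  constructor
  · intro hs
    refine ⟨{x | Minimal (· ∈ s) x}, ?_, ?_⟩
    · have hanti : IsAntichain (· ≤ ·) {x | Minimal (· ∈ s) x} := setOfPred_minimal_antichain _
      exact hanti.finite_of_partiallyWellOrderedOn (hs.mono fun x hx => hx.1)
    · intro y hy
      obtain ⟨b, hb, hbm⟩ := hs.exists_le_minimal hy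
      exact ⟨b, hbm, hb⟩
  · rintro ⟨S, hS, hsS⟩
    exact (D.cones_isPWO w hS).mono hsS

/-- The algebra `ℤ_σ[[Y, -wQ^∨_+]]` of formal sums `∑ a_y e^y` whose support is contained in a
finite union of cones `λ - wQ^∨_+`: by `isPWO_iff` these are exactly the Hahn series for the above
order. -/
abbrev Series (w : D.W) : Type _ := HahnSeries (D.Dir w) (Coef T)

/-- The product over `w ∈ W^v` of the completions `ℤ_σ[[Y, -wQ^∨_+]]`. The algebras `ℤ_σ(Y)` and
`ℤ_σ((Y))` are embedded in it by expanding in every direction. -/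
def Ambient : Type _ := ∀ w : D.W, D.Series w

instance : CommRing D.Ambient := inferInstanceAs (CommRing (∀ w : D.W, D.Series w))

instance : Algebra (Coef T) D.Ambient :=
  inferInstanceAs (Algebra (Coef T) (∀ w : D.W, D.Series w))

/-- `v : Y → Y` as an isomorphism from the direction `-wQ^∨_+` to the direction `-(vw)Q^∨_+`. -/
def moveDir (v w : D.W) : D.Dir (v⁻¹ * w) →+ D.Dir w where
  toFun y := (v • (show D.Y from y) : D.Y)
  map_zero' := smul_zero (A := D.Y) v
  map_add' x y := smul_add (A := D.Y) v x y

theorem moveDir_injective (v w : D.W) : Function.Injective (D.moveDir v w) :=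
  fun _ _ h => MulAction.injective (α := D.W) (β := D.Y) v h

theorem moveDir_le (v w : D.W) (x y : D.Dir (v⁻¹ * w)) :
    D.moveDir v w x ≤ D.moveDir v w y ↔ x ≤ y := by
  have hco : ∀ z : D.Dir (v⁻¹ * w), ((show D.Y from D.moveDir v w z) : V)
      = (v : V ≃ₗ[ℝ] V) ((show D.Y from z) : V) := fun z => rfl
  have hw : ∀ q : V, (w : V ≃ₗ[ℝ] V) q
      = (v : V ≃ₗ[ℝ] V) (((v⁻¹ * w : D.W) : V ≃ₗ[ℝ] V) q) := by
    intro q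
    have : w = v * (v⁻¹ * w) := by group
    conv_lhs => rw [this]
    rfl
  rw [dir_le_iff, dir_le_iff]
  refine exists_congr fun q => and_congr_right fun _ => ?_
  rw [hco, hco, hw, ← map_sub]
  exact (v : V ≃ₗ[ℝ] V).injective.eq_iff

/-- The isomorphism `∑ a_y e^y ↦ ∑ a_y e^{vy}` from `ℤ_σ[[Y, -v⁻¹wQ^∨_+]]` to
`ℤ_σ[[Y, -wQ^∨_+]]`. -/
def moveSeries (v w : D.W) : D.Series (v⁻¹ * w) →+* D.Series w :=
  HahnSeries.embDomainRingHom (D.moveDir v w) (D.moveDir_injective v w) (D.moveDir_le v w)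

theorem moveSeries_coeff (v w : D.W) (f : D.Series (v⁻¹ * w)) (y : D.Y) :
    (D.moveSeries v w f).coeff y = f.coeff (v⁻¹ • y : D.Y) := by
  have h := HahnSeries.embDomain_mk_coeff (D.moveDir_injective v w)
    (D.moveDir_le v w) (x := f) (a := (v⁻¹ • y : D.Y))
  have hy : D.moveDir v w (v⁻¹ • y : D.Y) = y := smul_inv_smul (α := D.Y) v y
  rw [← h, hy]
  rfl

theorem coeff_dir_congr {w w' : D.W} (f : D.Ambient) (h : w = w') (y y' : D.Y) (h' : y = y') :
    (f w).coeff y = (f w').coeff y' := by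
  subst h; subst h'; rfl

/-- The action of `W^v`: the expansion of `^v f` in the direction `-wQ^∨_+` is obtained from that
of `f` in the direction `-v⁻¹wQ^∨_+` by `e^y ↦ e^{vy}`. -/
instance : SMul D.W D.Ambient where
  smul v f := fun w => D.moveSeries v w (f (v⁻¹ * w))

theorem smul_coeff (v w : D.W) (f : D.Ambient) (y : D.Y) :
    ((v • f) w).coeff y = (f (v⁻¹ * w)).coeff (v⁻¹ • y : D.Y) :=
  D.moveSeries_coeff v w _ y

theorem ambient_ext {f g : D.Ambient} (h : ∀ w (y : D.Y), (f w).coeff y = (g w).coeff y) :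
    f = g := by
  funext w
  exact HahnSeries.ext (funext fun y => h w y)

instance : MulSemiringAction D.W D.Ambient where
  one_smul f := by
    refine D.ambient_ext fun w y => ?_
    rw [smul_coeff]
    exact D.coeff_dir_congr f (by simp) _ _ (by simp)
  mul_smul u v f := by
    refine D.ambient_ext fun w y => ?_
    rw [smul_coeff, smul_coeff, smul_coeff]
    exact D.coeff_dir_congr f (by rw [mul_inv_rev, mul_assoc]) _ _
      (by rw [mul_inv_rev, mul_smul])
  smul_zero v := funext fun w => map_zero (D.moveSeries v w)
  smul_add v f g := funext fun w => map_add (D.moveSeries v w) _ _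
  smul_one v := funext fun w => map_one (D.moveSeries v w)
  smul_mul v f g := funext fun w => map_mul (D.moveSeries v w) _ _

/-- The monomial `e^y`. -/
def mono (y : D.Y) : D.Ambient := fun w => HahnSeries.single (show D.Dir w from y) 1

/-- The embedding of `ℤ_σ[Y]`. -/
def ofPoly : AddMonoidAlgebra (Coef T) D.Y →ₐ[Coef T] D.Ambient :=
  AddMonoidAlgebra.lift (Coef T) D.Ambient D.Y
    { toFun := fun y => D.mono y.toAdd
      map_one' := rfl
      map_mul' := fun x y => funext fun w =>
        (HahnSeries.single_mul_single.trans (by rw [mul_one]; rfl)).symm }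

/-- The algebra `ℤ_σ(Y)`: fractions `f / g` of elements of `ℤ_σ[Y]` which have an expansion in
`ℤ_σ[[Y, -wQ^∨_+]]` for every `w ∈ W^v`; such a fraction is identified with the family of its
expansions. -/
def fracAlg : Subalgebra (Coef T) D.Ambient where
  carrier := {F | ∃ f g : AddMonoidAlgebra (Coef T) D.Y,
    g ∈ (AddMonoidAlgebra (Coef T) D.Y)⁰ ∧ D.ofPoly g * F = D.ofPoly f}
  mul_mem' := by
    rintro F G ⟨f, g, hg, h⟩ ⟨f', g', hg', h'⟩
    refine ⟨f * f', g * g', mul_mem hg hg', ?_⟩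
    rw [map_mul, map_mul, ← h, ← h']; ring
  add_mem' := by
    rintro F G ⟨f, g, hg, h⟩ ⟨f', g', hg', h'⟩
    refine ⟨f * g' + f' * g, g * g', mul_mem hg hg', ?_⟩
    rw [map_add, map_mul, map_mul, map_mul, ← h, ← h']; ring
  algebraMap_mem' c := ⟨algebraMap _ _ c, 1, one_mem _, by rw [map_one, one_mul, AlgHom.commutes]⟩

/-- Convergence in `ℤ_σ[[Y, -wQ^∨_+]]` for every `w`: the supports stay in a fixed finite union of
cones `λ - wQ^∨_+` and every coefficient is eventually constant. -/
def Converges {ι : Type*} (l : Filter ι) (F : ι → D.Ambient) (G : D.Ambient) : Prop :=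
  ∀ w : D.W,
    (∃ S : Set (D.Dir w), S.Finite ∧ ∀ᶠ n in l, (F n w).support ⊆ D.cones w S) ∧
    ∀ y : D.Dir w, ∀ᶠ n in l, (F n w).coeff y = (G w).coeff y

theorem Converges.add {ι : Type*} {l : Filter ι} {F F' : ι → D.Ambient} {G G' : D.Ambient}
    (h : D.Converges l F G) (h' : D.Converges l F' G') :
    D.Converges l (fun n => F n + F' n) (G + G') := by
  intro w
  obtain ⟨⟨S, hS, hs⟩, hc⟩ := h w
  obtain ⟨⟨S', hS', hs'⟩, hc'⟩ := h' w
  refine ⟨⟨S ∪ S', hS.union hS', ?_⟩, fun y => ?_⟩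
  · filter_upwards [hs, hs'] with n hn hn'
    refine (HahnSeries.support_add_subset _ _).trans (Set.union_subset ?_ ?_)
    · exact fun y hy => let ⟨x, hx, hxy⟩ := hn hy; ⟨x, Or.inl hx, hxy⟩
    · exact fun y hy => let ⟨x, hx, hxy⟩ := hn' hy; ⟨x, Or.inr hx, hxy⟩
  · filter_upwards [hc y, hc' y] with n hn hn'
    exact congrArg₂ (· + ·) hn hn'

theorem Converges.support {ι : Type*} {l : Filter ι} [l.NeBot] {F : ι → D.Ambient}
    {G : D.Ambient} (h : D.Converges l F G) {w : D.W} {S : Set (D.Dir w)}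
    (hs : ∀ᶠ n in l, (F n w).support ⊆ D.cones w S) : (G w).support ⊆ D.cones w S := by
  intro y hy
  obtain ⟨n, hn, hn'⟩ := (((h w).2 y).and hs).exists
  exact hn' (by rw [HahnSeries.mem_support, hn]; exact hy)

open scoped Pointwise in
theorem Converges.mul [Finite I] {ι : Type*} {l : Filter ι} [l.NeBot] {F F' : ι → D.Ambient}
    {G G' : D.Ambient} (h : D.Converges l F G) (h' : D.Converges l F' G') :
    D.Converges l (fun n => F n * F' n) (G * G') := by
  intro w
  obtain ⟨⟨S, hS, hs⟩, hc⟩ := h w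
  obtain ⟨⟨S', hS', hs'⟩, hc'⟩ := h' w
  refine ⟨⟨S + S', hS.add hS', ?_⟩, fun y => ?_⟩
  · filter_upwards [hs, hs'] with n hn hn' y hy
    obtain ⟨a, ha, b, hb, rfl⟩ := HahnSeries.support_mul_subset hy
    obtain ⟨x, hx, hxa⟩ := hn ha
    obtain ⟨x', hx', hxb⟩ := hn' hb
    exact ⟨x + x', Set.add_mem_add hx hx', add_le_add hxa hxb⟩
  · have hp := D.cones_isPWO w hS
    have hp' := D.cones_isPWO w hS'
    have key : ∀ A B : D.Series w, A.support ⊆ D.cones w S → B.support ⊆ D.cones w S' →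
        (A * B).coeff y = ∑ ij ∈ Finset.antidiagonal hp hp' y,
          A.coeff ij.1 * B.coeff ij.2 := by
      intro A B hA hB
      rw [HahnSeries.coeff_mul_left' hp hA]
      refine Finset.sum_subset (fun ij hij => ?_) (fun ij hij hij' => ?_)
      · rw [Finset.mem_antidiagonal] at hij ⊢
        exact ⟨hij.1, hB hij.2.1, hij.2.2⟩
      · rw [Finset.mem_antidiagonal] at hij hij'
        have : B.coeff ij.2 = 0 := by
          by_contra hne
          exact hij' ⟨hij.1, hne, hij.2.2⟩
        rw [this, mul_zero]
    have hfin : ∀ᶠ n in l, ∀ ij ∈ Finset.antidiagonal hp hp' y,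
        (F n w).coeff ij.1 = (G w).coeff ij.1 ∧ (F' n w).coeff ij.2 = (G' w).coeff ij.2 :=
      (Filter.eventually_all_finset _).2 fun ij _ => (hc ij.1).and (hc' ij.2)
    filter_upwards [hs, hs', hfin] with n hn hn' hn''
    have e1 := key (F n w) (F' n w) hn hn'
    have e2 := key (G w) (G' w) (Converges.support D h hs) (Converges.support D h' hs')
    refine e1.trans (Eq.trans ?_ e2.symm)
    exact Finset.sum_congr rfl fun ij hij => by rw [(hn'' ij hij).1, (hn'' ij hij).2]

theorem converges_const [Finite I] {ι : Type*} (l : Filter ι) (G : D.Ambient) :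
    D.Converges l (fun _ => G) G := by
  intro w
  obtain ⟨S, hS, h⟩ := (D.isPWO_iff w _).1 (G w).isPWO_support
  exact ⟨⟨S, hS, Eventually.of_forall fun _ => h⟩, fun y => Eventually.of_forall fun _ => rfl⟩

/-- The completion `ℤ_σ((Y))` of `ℤ_σ(Y)`: limits of the sequences of elements of `ℤ_σ(Y)` which
converge in `ℤ_σ[[Y, -wQ^∨_+]]` for every `w ∈ W^v`. -/
def completion [Finite I] : Subalgebra (Coef T) D.Ambient where
  carrier := {G | ∃ F : ℕ → D.Ambient, (∀ n, F n ∈ D.fracAlg) ∧ D.Converges atTop F G}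
  mul_mem' := by
    rintro G G' ⟨F, hF, h⟩ ⟨F', hF', h'⟩
    exact ⟨_, fun n => mul_mem (hF n) (hF' n), Converges.mul D h h'⟩
  add_mem' := by
    rintro G G' ⟨F, hF, h⟩ ⟨F', hF', h'⟩
    exact ⟨_, fun n => add_mem (hF n) (hF' n), Converges.add D h h'⟩
  algebraMap_mem' c := ⟨_, fun _ => D.fracAlg.algebraMap_mem c, D.converges_const _ _⟩

/-! ### The Bernstein-Lusztig-Hecke algebra -/

/-- Generators `H_w`, `Z^λ` of the Bernstein-Lusztig-Hecke algebra. -/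
inductive BLGen : Type _
  | H (w : D.W) : BLGen
  | Z (y : D.Y) : BLGen

/-- The generator `H_w` in the free algebra. -/
def freeH (w : D.W) : FreeAlgebra (Coef T) D.BLGen := FreeAlgebra.ι _ (BLGen.H w)

/-- The generator `Z^λ` in the free algebra. -/
def freeZ (y : D.Y) : FreeAlgebra (Coef T) D.BLGen := FreeAlgebra.ι _ (BLGen.Z y)

/-- `∑ a_λ Z^λ` for `q = ∑ a_λ e^λ`. -/
def freeZPoly (q : AddMonoidAlgebra (Coef T) D.Y) : FreeAlgebra (Coef T) D.BLGen :=
  q.coeff.sum fun y a => a • D.freeZ y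

/-- The relations of the Bernstein-Lusztig-Hecke algebra. In the last one, `q` is the element
`b(σ_i, σ'_i; e^{-α_i^∨}) (e^λ - e^{r_i λ})` of `ℤ_σ[Y]`, where
`b(t, u; z) = ((t - t⁻¹) + (u - u⁻¹) z) / (1 - z²)`. -/
inductive BLRel : FreeAlgebra (Coef T) D.BLGen → FreeAlgebra (Coef T) D.BLGen → Prop
  | H_one : BLRel (D.freeH 1) 1
  | H_mul_of_lt (i : I) (w : D.W) (h : D.length w < D.length (D.r i * w)) :
      BLRel (D.freeH (D.r i) * D.freeH w) (D.freeH (D.r i * w))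
  | H_mul_of_gt (i : I) (w : D.W) (h : D.length (D.r i * w) < D.length w) :
      BLRel (D.freeH (D.r i) * D.freeH w)
        (((D.sig i : Coef T) - ((D.sig i)⁻¹ : (Coef T)ˣ)) • D.freeH w + D.freeH (D.r i * w))
  | Z_zero : BLRel (D.freeZ 0) 1
  | Z_mul (x y : D.Y) : BLRel (D.freeZ x * D.freeZ y) (D.freeZ (x + y))
  | bernstein (i : I) (y : D.Y) (q : AddMonoidAlgebra (Coef T) D.Y)
      (h : (1 - AddMonoidAlgebra.single (-(2 • D.simpleCoroot i)) 1) * q =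
        (AddMonoidAlgebra.single 0 ((D.sig i : Coef T) - ((D.sig i)⁻¹ : (Coef T)ˣ)) +
          AddMonoidAlgebra.single (-D.simpleCoroot i)
            ((D.sig' i : Coef T) - ((D.sig' i)⁻¹ : (Coef T)ˣ))) *
        (AddMonoidAlgebra.single y 1 - AddMonoidAlgebra.single (D.r i • y) 1)) :
      BLRel (D.freeH (D.r i) * D.freeZ y - D.freeZ (D.r i • y) * D.freeH (D.r i))
        (D.freeZPoly q)

/-- The Bernstein-Lusztig-Hecke algebra over `ℤ_σ`. -/
abbrev BLHecke : Type _ := RingQuot D.BLRel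

/-- The element `H_w`. -/
def H (w : D.W) : D.BLHecke := RingQuot.mkAlgHom (Coef T) D.BLRel (D.freeH w)

/-- The element `Z^λ`. -/
def Z (y : D.Y) : D.BLHecke := RingQuot.mkAlgHom (Coef T) D.BLRel (D.freeZ y)

/-! ### The symmetrizers -/

/-- `b(t, u; e^y)`, where `b(t, u; z) = ((t - t⁻¹) + (u - u⁻¹) z) / (1 - z²)`. -/
def bFun (t u : (Coef T)ˣ) (y : D.Y) : D.Ambient :=
  (algebraMap (Coef T) D.Ambient ((t : Coef T) - (t⁻¹ : (Coef T)ˣ)) +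
    algebraMap (Coef T) D.Ambient ((u : Coef T) - (u⁻¹ : (Coef T)ˣ)) * D.mono y) *
  Ring.inverse (1 - D.mono (2 • y))

/-- `c(t, u; e^y) = t - b(t, u; e^y)` -/
def cFun (t u : (Coef T)ˣ) (y : D.Y) : D.Ambient :=
  algebraMap (Coef T) D.Ambient t - D.bFun t u y

instance : SMulCommClass D.W (Coef T) D.Ambient where
  smul_comm v c f := by
    refine D.ambient_ext fun w y => ?_
    rw [smul_coeff]
    exact (congrArg (c * ·) (D.smul_coeff v w f y)).symm

/-- Finite sums `∑ f_w [w]` with the multiplication `(f [w]) (g [v]) = f (^w g) [wv]`. -/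
abbrev Twisted : Type _ := SkewMonoidAlgebra D.Ambient D.W

/-- `c(α^∨) = c(σ_α, σ'_α; e^{α^∨})`, with `σ_α = σ_i`, `σ'_α = σ'_i`, for `α = α_i`. -/
def cSimple (i : I) : D.Ambient := D.cFun (D.sig i) (D.sig' i) (D.simpleCoroot i)

/-- `b(α^∨) = b(σ_α, σ'_α; e^{α^∨})`, with `σ_α = σ_i`, `σ'_α = σ'_i`, for `α = α_i`. -/
def bSimple (i : I) : D.Ambient := D.bFun (D.sig i) (D.sig' i) (D.simpleCoroot i)

/-- `Ψ(H_i) = c(α_i^∨) [r_i] + b(α_i^∨) [e]`, `Ψ(Z^λ) = e^{-λ}`, and `Ψ` takes its values in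
`ℤ_σ(Y)[W^v]`. The first two properties determine `Ψ`, as the `H_i` and `Z^λ` generate the
algebra. -/
structure IsCherednikRep (Psi : D.BLHecke →ₐ[Coef T] D.Twisted) : Prop where
  map_H : ∀ i, Psi (D.H (D.r i)) =
    SkewMonoidAlgebra.single (D.r i) (D.cSimple i) + SkewMonoidAlgebra.single 1 (D.bSimple i)
  map_Z : ∀ y, Psi (D.Z y) = SkewMonoidAlgebra.single 1 (D.mono (-y))
  coeff_mem : ∀ h w, (Psi h).coeff w ∈ D.fracAlg

/-- `P_σ^N = ∑_{ℓ(w) ≤ N} σ_w H_w` -/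
def PN [Finite I] (N : ℕ) : D.BLHecke :=
  ∑ w ∈ (D.ball_finite N).toFinset, (D.sigW w : Coef T) • D.H w

/-- `P_σ = ∑_w σ_w H_w = ∑_v C_v [v]`: for every `v`, the coefficient `C_v` is the limit of the
coefficients of `[v]` in the `P_σ^N`. -/
def IsTSymmetrizer [Finite I] (Psi : D.BLHecke →ₐ[Coef T] D.Twisted) (C : D.W → D.Ambient) :
    Prop :=
  ∀ v, D.Converges atTop (fun N => (Psi (D.PN N)).coeff v) (C v)

/-- `Δ_α = c'(-α^∨) = σ_α c(σ_α, σ'_α; e^{-α^∨})` for a positive real root `α`. -/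
def deltaFactor (a : D.posRoots) : D.Ambient :=
  algebraMap (Coef T) D.Ambient (D.sigRoot (D.posToRoot a)) *
    D.cFun (D.sigRoot (D.posToRoot a)) (D.sigRoot' (D.posToRoot a)) (-D.corootOf (D.posToRoot a))

/-- `Δ = ∏_{α ∈ Φ_+} c'(-α^∨)` -/
def IsDelta (Delta : D.Ambient) : Prop :=
  D.Converges atTop (fun F : Finset D.posRoots => ∏ a ∈ F, D.deltaFactor a) Delta

end HeckeDatum

/-!
The coefficients of `P_σ` are determined by two eigenvalue equations. Grouping `w` with `r_i w`, or
with `w r_i`, the quadratic relation gives `T_i P_σ = σ_i P_σ = P_σ T_i` for `T_i = Ψ(H_i)`.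
Comparing the coefficients of `[v]` in the first equation gives `C_v = ^{r_i} C_{r_i v}`
(`r_smul_symCoeff`), hence `C_v = ^v Γ`; together with the second one it gives `^{r_i}Γ · c(-α_i^∨)
= Γ · c(α_i^∨)` (`r_smul_symCoeff_one`). The product `Δ` satisfies the same equation
(`r_smul_delta`), because `r_i` permutes the positive real roots other than `α_i`. So `m = Γ Δ⁻¹` is
invariant and `C_v = ^v Γ = m · ^v Δ`.

For this to make sense, everything has to converge in every direction `-uQ^∨_+`. Convergence is
measured by the filtrations `cone u n` of the series supported in `-uQ^∨_+` by height, for which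
these series are complete (`exists_coneLim`). In the direction `-uQ^∨_+` the coefficient of `[v]` in
`T_w` has no terms of height less than `n` as soon as `u⁻¹w` is much longer than `u⁻¹v`
(`expand_opTW_coeff_mem_of_lt`): multiplying by one more `T_i`, the summand `c(α_i^∨) [r_i]` does
not change the difference of the two lengths; the summand `b(α_i^∨)` either does not lengthen
`u⁻¹w`, by the strong exchange property `length_conj_r_mul_lt`, or contributes the height of the
positive coroot `u⁻¹α_i^∨`, and only finitely many coroots have a given height. The factors of `Δ`
tend to `1` since only finitely many positive coroots are made negative by `u⁻¹`, and so do their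
inverses.

In the direction `-Q^∨_+` the constant terms of `Γ` and `Δ` are `1`, hence so is that of `m`; by
invariance this holds in all directions, and `m` is inverted by a geometric series
(`exists_inverse_coneLim`).

The existence of `Ψ` amounts to the quadratic relations and the braid relations of the `T_i`. For
the latter, put `θ_i = T_i + σ_i⁻¹ = c(-α_i^∨) + c(α_i^∨) [r_i]`. In rank two, a polynomial in `θ_i`
and `θ_j` is equal to `∑ [w]`, over the dihedral group, multiplied by the product of the `c(-α^∨)`
over the positive real roots (`sym_three`, `sym_four`, `sym_six`). Exchanging `i` and `j` does not
change this element, and this symmetry is equivalent to the braid relation. The scalar identities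
needed are consequences of the addition formula `inv_one_sub_mul`. Matsumoto's theorem
(`map_prod_eq_of_reduced`) then defines `T_w`; it rests on the positivity of `w α_i` and `w α_i^∨`
for `ℓ(w) < ℓ(w r_i)`, which is proved by reduction to rank two.
-/

namespace HeckeDatum

/-! ### Braid relations for Demazure-Lusztig operators -/

section Braid
variable {R A : Type*} [CommRing R] [Ring A] [Module R A] [IsScalarTower R A A]
  (S T : R →+* R) (s t : A)

theorem demazure_mul_self (hs : ∀ (f : R) (x : A), s * (f • x) = S f • (s * x))
    (hss : ∀ x, s * (s * x) = x) {d d' τ : R}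
    (hd : d + d' = τ) (h1 : S d = d') (h2 : S d' = d) :
    (d • (1 : A) + d' • s) * (d • 1 + d' • s) = τ • (d • 1 + d' • s) := by
  subst hd
  have hss' : s * s = 1 := by simpa using hss 1
  simp only [add_mul, mul_add, smul_mul_assoc, one_mul, mul_one, hs, h1, h2, hss', smul_smul,
    smul_add]
  module

theorem braid_two (hs : ∀ (f : R) (x : A), s * (f • x) = S f • (s * x))
    (ht : ∀ (f : R) (x : A), t * (f • x) = T f • (t * x)) (hst : s * t = t * s)
    {d₁ d₁' d₂ d₂' : R} (h1 : S d₂ = d₂) (h2 : S d₂' = d₂') (h3 : T d₁ = d₁) (h4 : T d₁' = d₁') :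
    (d₁ • (1 : A) + d₁' • s) * (d₂ • 1 + d₂' • t) =
      (d₂ • 1 + d₂' • t) * (d₁ • (1 : A) + d₁' • s) := by
  simp only [add_mul, mul_add, smul_mul_assoc, one_mul, mul_one, hs, ht, h1, h2, h3, h4, hst]
  module

/-- `s` and `t` are reflections acting on the coefficients through `S` and `T`, and
`θ₁ = d₁ + d₁' s`, `θ₂ = d₂ + d₂' t`. The identity `F` says that `θ₁ θ₂ θ₁ - q θ₁` is the product of
`∑ w`, over the dihedral group of order `6`, and `d₁ d₂ e`, which is symmetric in `s` and `t`. -/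
theorem sym_three (hs : ∀ (f : R) (x : A), s * (f • x) = S f • (s * x))
    (ht : ∀ (f : R) (x : A), t * (f • x) = T f • (t * x))
    (hss : s * s = 1) {d₁ d₁' d₂ d₂' e e' q : R}
    (s1 : S d₁ = d₁') (s2 : S d₁' = d₁) (s3 : S d₂ = e) (s4 : S d₂' = e') (s5 : S e = d₂)
    (s6 : S e' = d₂')
    (t1 : T d₁ = e) (t2 : T d₁' = e') (sq : S q = q)
    (F : d₁ * d₂ + d₁' * e = d₂ * e + q) :
    (d₁ • (1 : A) + d₁' • s) * ((d₂ • 1 + d₂' • t) * (d₁ • 1 + d₁' • s)) -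
      q • (d₁ • 1 + d₁' • s) =
    (d₁ * d₂ * e) • (1 : A) + (d₁' * d₂ * e) • s + (d₁ * d₂' * e) • t + (d₁' * d₂ * e') • (s * t)
      + (d₁ * d₂' * e') • (t * s) + (d₁' * d₂' * e') • (s * (t * s)) := by
  have F' := congrArg S F
  simp only [map_add, map_mul, s1, s2, s3, s5, sq] at F'
  simp only [add_mul, mul_add, smul_mul_assoc, one_mul, mul_one, hs, ht, hss, s1, s2, s3,
    s4, s5, s6, t1, t2]
  match_scalars
  · linear_combination d₁ * F
  · linear_combination d₁' * F'
  all_goals ring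

/-- The analogue of `sym_three` for the dihedral group of order `8`. -/
theorem sym_four (hs : ∀ (f : R) (x : A), s * (f • x) = S f • (s * x))
    (ht : ∀ (f : R) (x : A), t * (f • x) = T f • (t * x))
    (hss : ∀ x, s * (s * x) = x) (htt : t * t = 1) {d₁ d₁' d₂ d₂' e₁ e₁' e₂ e₂' q τ₁ τ₂ : R}
    (a1 : d₁' = τ₁ - d₁) (a2 : e₁' = τ₁ - e₁) (a3 : d₂' = τ₂ - d₂) (a4 : e₂' = τ₂ - e₂)
    (s1 : S d₁ = d₁') (s2 : S d₂ = e₂) (s3 : S e₁ = e₁) (s4 : S e₂ = d₂)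
    (t1 : T d₂ = d₂') (t2 : T d₁ = e₁) (t3 : T e₂ = e₂)
    (sτ₁ : S τ₁ = τ₁) (sτ₂ : S τ₂ = τ₂) (tτ₁ : T τ₁ = τ₁) (tτ₂ : T τ₂ = τ₂)
    (F : d₁ * d₂ + d₁' * e₂ + d₂' * e₁ = e₂ * e₁ + q)
    {θ₁ θ₂ : A} (h1 : θ₁ = d₁ • (1 : A) + d₁' • s) (h2 : θ₂ = d₂ • (1 : A) + d₂' • t) :
    θ₁ * (θ₂ * (θ₁ * θ₂)) - q • (θ₁ * θ₂) =
    (d₁ * d₂ * e₁ * e₂) • (1 : A) + (d₁' * e₂ * e₁ * d₂) • s + (d₂' * e₁ * e₂ * d₁) • t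
      + (d₁' * e₂' * e₁ * d₂) • (s * t) + (d₂' * e₁' * e₂ * d₁) • (t * s)
      + (d₁' * e₂' * e₁' * d₂) • (s * (t * s)) + (d₂' * e₁' * e₂' * d₁) • (t * (s * t))
      + (d₁' * d₂' * e₁' * e₂') • (s * (t * (s * t))) := by
  have hss' : s * s = 1 := by simpa using hss 1
  subst a1 a2 a3 a4
  rw [h1, h2]
  simp only [add_mul, mul_add, smul_mul_assoc, one_mul, mul_one, hs, ht, hss', hss, htt, map_sub,
    s1, s2, s3, s4, t1, t2, t3, sτ₁, sτ₂, tτ₁, tτ₂]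
  match_scalars
  · linear_combination d₁ * d₂ * F
  · linear_combination (τ₁ - d₁) * e₂ * F
  · linear_combination d₁ * (τ₂ - d₂) * F
  · linear_combination (τ₁ - d₁) * (τ₂ - e₂) * F
  all_goals ring

set_option maxRecDepth 4000 in
/-- The analogue of `sym_three` for the dihedral group of order `12`. -/
theorem sym_six (hs : ∀ (f : R) (x : A), s * (f • x) = S f • (s * x))
    (ht : ∀ (f : R) (x : A), t * (f • x) = T f • (t * x))
    (hss : ∀ x, s * (s * x) = x) (htt : ∀ x, t * (t * x) = x)
    {d₁ d₁' d₂ d₂' f₁ f₁' f₂ f₂' g₁ g₁' g₂ g₂' q p τ₁ τ₂ : R}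
    (a1 : d₁' = τ₁ - d₁) (a2 : f₁' = τ₁ - f₁) (a3 : g₁' = τ₁ - g₁)
    (a4 : d₂' = τ₂ - d₂) (a5 : f₂' = τ₂ - f₂) (a6 : g₂' = τ₂ - g₂)
    (s1 : S d₁ = d₁') (s2 : S d₂ = f₂) (s3 : S f₂ = d₂) (s4 : S f₁ = g₁) (s5 : S g₁ = f₁)
    (s6 : S g₂ = g₂)
    (t1 : T d₂ = d₂') (t2 : T d₁ = f₁) (t3 : T f₁ = d₁) (t4 : T f₂ = g₂) (t5 : T g₂ = f₂)
    (t6 : T g₁ = g₁)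
    (sq : S q = q) (sp : S p = p) (sτ₁ : S τ₁ = τ₁) (sτ₂ : S τ₂ = τ₂)
    (tτ₁ : T τ₁ = τ₁) (tτ₂ : T τ₂ = τ₂)
    (F : d₁ * d₂ + d₂' * f₁ + f₁' * g₂ + g₁ * g₂' + d₁' * f₂ = f₂ * g₁ + 2 * q)
    (E : d₁ ^ 2 * d₂ ^ 2 + 2 * d₁ * d₂ * d₂' * f₁ + 2 * d₁ * d₁' * d₂ * f₂ + d₂' ^ 2 * f₁ ^ 2
      + d₁' ^ 2 * f₂ ^ 2 + d₁' * d₂' * f₁ * f₂ + d₂' * f₁ * f₁' * g₂ + d₁' * f₂ * f₂' * g₁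
      - 2 * q * (d₁ * d₂ + d₂' * f₁ + d₁' * f₂) + p = f₁ * f₂ * g₁ * g₂)
    {θ₁ θ₂ : A} (h1 : θ₁ = d₁ • (1 : A) + d₁' • s) (h2 : θ₂ = d₂ • (1 : A) + d₂' • t) :
    θ₁ * (θ₂ * (θ₁ * (θ₂ * (θ₁ * θ₂)))) - (2 * q) • (θ₁ * (θ₂ * (θ₁ * θ₂))) + p • (θ₁ * θ₂) =
    (d₁ * d₂ * f₁ * f₂ * g₁ * g₂) • (1 : A) + (d₁' * d₂ * f₁ * f₂ * g₁ * g₂) • s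
      + (d₂' * d₁ * f₁ * f₂ * g₁ * g₂) • t + (d₁' * f₂' * d₂ * f₁ * g₁ * g₂) • (s * t)
      + (d₂' * f₁' * d₁ * f₂ * g₁ * g₂) • (t * s) + (d₁' * f₂' * g₁' * d₂ * f₁ * g₂) • (s * (t * s))
      + (d₂' * f₁' * g₂' * d₁ * f₂ * g₁) • (t * (s * t))
      + (d₁' * f₂' * g₁' * g₂' * d₂ * f₁) • (s * (t * (s * t)))
      + (d₂' * f₁' * g₂' * g₁' * d₁ * f₂) • (t * (s * (t * s)))
      + (d₁' * f₂' * g₁' * g₂' * f₁' * d₂) • (s * (t * (s * (t * s))))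
      + (d₂' * f₁' * g₂' * g₁' * f₂' * d₁) • (t * (s * (t * (s * t))))
      + (d₁' * d₂' * f₁' * f₂' * g₁' * g₂') • (s * (t * (s * (t * (s * t))))) := by
  have ES := congrArg S E
  have hss' : s * s = 1 := by simpa using hss 1
  have htt' : t * t = 1 := by simpa using htt 1
  subst a1 a2 a3 a4 a5 a6
  have r1 : θ₁ * θ₂ = (d₁ * d₂) • (1 : A) + ((τ₁ - d₁) * f₂) • s + (d₁ * (τ₂ - d₂)) • t
      + ((τ₁ - d₁) * (τ₂ - f₂)) • (s * t) := by
    rw [h1, h2]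
    simp only [add_mul, mul_add, smul_mul_assoc, one_mul, mul_one, hs, map_sub, s2, sτ₂]
    module
  simp only [map_add, map_sub, map_mul, map_pow, map_ofNat, s1, s2, s3, s4, s5, s6, sq, sp, sτ₁,
    sτ₂] at ES
  rw [r1, h1, h2]
  simp only [add_mul, mul_add, smul_mul_assoc, one_mul, mul_one, hs, ht, hss', hss, htt', htt,
    map_mul,
    map_sub, s1, s2, s3, s4, s5, s6, t1, t2, t3, t4, t5, t6, sτ₁, sτ₂, tτ₁, tτ₂]
  match_scalars
  · linear_combination d₁ * d₂ * E
  · linear_combination (τ₁ - d₁) * f₂ * ES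
  · linear_combination d₁ * (τ₂ - d₂) * E
  · linear_combination (τ₁ - d₁) * (τ₂ - f₂) * ES
  · linear_combination d₁ * (τ₂ - d₂) * (τ₁ - f₁) * g₂ * F
  · linear_combination (τ₁ - d₁) * (τ₂ - f₂) * (τ₁ - g₁) * g₂ * F
  · linear_combination d₁ * (τ₂ - d₂) * (τ₁ - f₁) * (τ₂ - g₂) * F
  · linear_combination (τ₁ - d₁) * (τ₂ - f₂) * (τ₁ - g₁) * (τ₂ - g₂) * F
  all_goals ring

end Braid

section HeckeBraid
variable {K A : Type*} [CommRing K] [Ring A] [Algebra K A] {T₁ T₂ : A} {g₁ h₁ g₂ h₂ : K}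

/-- If `T₁`, `T₂` satisfy quadratic relations `(T - h)(T + g) = 0`, then the difference of the two
sides of the symmetry relation `h` is that of the two sides of the braid relation. -/
theorem hecke_braid_three (h1 : T₁ * T₁ = (g₁ * h₁) • (1 : A) + (h₁ - g₁) • T₁)
    (h2 : T₂ * T₂ = (g₁ * h₁) • (1 : A) + (h₁ - g₁) • T₂)
    (h : (T₁ + g₁ • 1) * ((T₂ + g₁ • 1) * (T₁ + g₁ • 1)) - (g₁ * h₁) • (T₁ + g₁ • 1) =
      (T₂ + g₁ • 1) * ((T₁ + g₁ • 1) * (T₂ + g₁ • 1)) - (g₁ * h₁) • (T₂ + g₁ • 1)) :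
    T₁ * (T₂ * T₁) = T₂ * (T₁ * T₂) := by
  simp only [add_mul, mul_add, smul_mul_assoc, mul_smul_comm, one_mul, mul_one, h1, h2, smul_smul,
    smul_add] at h
  rw [← sub_eq_zero] at h ⊢
  rw [← h]
  module

/-- The analogue of `hecke_braid_three` for the braid relation of length four. -/
theorem hecke_braid_four (h1 : T₁ * T₁ = (g₁ * h₁) • (1 : A) + (h₁ - g₁) • T₁)
    (h2 : T₂ * T₂ = (g₂ * h₂) • (1 : A) + (h₂ - g₂) • T₂)
    (h : (T₁ + g₁ • 1) * ((T₂ + g₂ • 1) * ((T₁ + g₁ • 1) * (T₂ + g₂ • 1))) -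
        (h₁ * g₂ + h₂ * g₁) • ((T₁ + g₁ • 1) * (T₂ + g₂ • 1)) =
      (T₂ + g₂ • 1) * ((T₁ + g₁ • 1) * ((T₂ + g₂ • 1) * (T₁ + g₁ • 1))) -
        (h₁ * g₂ + h₂ * g₁) • ((T₂ + g₂ • 1) * (T₁ + g₁ • 1))) :
    T₁ * (T₂ * (T₁ * T₂)) = T₂ * (T₁ * (T₂ * T₁)) := by
  have h1' : ∀ x, T₁ * (T₁ * x) = (g₁ * h₁) • x + (h₁ - g₁) • (T₁ * x) := fun x => by
    rw [← mul_assoc, h1, add_mul, smul_mul_assoc, one_mul, smul_mul_assoc]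
  have h2' : ∀ x, T₂ * (T₂ * x) = (g₂ * h₂) • x + (h₂ - g₂) • (T₂ * x) := fun x => by
    rw [← mul_assoc, h2, add_mul, smul_mul_assoc, one_mul, smul_mul_assoc]
  simp only [add_mul, mul_add, smul_mul_assoc, mul_smul_comm, one_mul, mul_one, h1, h2, h1', h2',
    smul_smul, smul_add] at h
  rw [← sub_eq_zero] at h ⊢
  rw [← h]
  module

set_option maxRecDepth 4000 in
/-- The analogue of `hecke_braid_three` for the braid relation of length six. -/
theorem hecke_braid_six (h1 : T₁ * T₁ = (g₁ * h₁) • (1 : A) + (h₁ - g₁) • T₁)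
    (h2 : T₂ * T₂ = (g₂ * h₂) • (1 : A) + (h₂ - g₂) • T₂) {q p : K}
    (hq : q = h₁ * g₂ + h₂ * g₁) (hp : p = q ^ 2 - g₁ * h₁ * g₂ * h₂)
    {θ₁ θ₂ : A} (e1 : θ₁ = T₁ + g₁ • 1) (e2 : θ₂ = T₂ + g₂ • 1)
    (h : θ₁ * (θ₂ * (θ₁ * (θ₂ * (θ₁ * θ₂)))) - (2 * q) • (θ₁ * (θ₂ * (θ₁ * θ₂)))
        + p • (θ₁ * θ₂) =
      θ₂ * (θ₁ * (θ₂ * (θ₁ * (θ₂ * θ₁)))) - (2 * q) • (θ₂ * (θ₁ * (θ₂ * θ₁)))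
        + p • (θ₂ * θ₁)) :
    T₁ * (T₂ * (T₁ * (T₂ * (T₁ * T₂)))) = T₂ * (T₁ * (T₂ * (T₁ * (T₂ * T₁)))) := by
  have h1' : ∀ x, T₁ * (T₁ * x) = (g₁ * h₁) • x + (h₁ - g₁) • (T₁ * x) := fun x => by
    rw [← mul_assoc, h1, add_mul, smul_mul_assoc, one_mul, smul_mul_assoc]
  have h2' : ∀ x, T₂ * (T₂ * x) = (g₂ * h₂) • x + (h₂ - g₂) • (T₂ * x) := fun x => by
    rw [← mul_assoc, h2, add_mul, smul_mul_assoc, one_mul, smul_mul_assoc]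
  subst hq hp e1 e2
  simp only [add_mul, mul_add, smul_mul_assoc, mul_smul_comm, one_mul, mul_one, h1, h2, h1', h2',
    smul_smul, smul_add] at h
  rw [← sub_eq_zero] at h ⊢
  rw [← h]
  module

end HeckeBraid

section RankTwoIdentities
variable {R : Type*} [CommRing R]

/-- Addition formula for `1 / (1 - z)`. -/
theorem inv_one_sub_mul {x y z u v w : R} (hu : u * (1 - x) = 1) (hv : v * (1 - y) = 1)
    (hw : w * (1 - z) = 1) (hz : z = x * y) : u * v = w * (u + v - 1) := by
  subst hz
  linear_combination (-(u * v)) * hw + w * (v * hu + u * hv - v * (1 - y) * hu - hv)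

/-- The hypothesis `F` of `sym_three` for `d = h - (h - g) / (1 - z)`, where `z = e^{-α^∨}` for the
positive coroots `α^∨` in type `A₂`. -/
theorem identity_three {g h u v w : R} (H : u * v = w * (u + v - 1)) :
    (h - (h - g) * u) * (h - (h - g) * v) + (h + g - (h - (h - g) * u)) * (h - (h - g) * w) =
      (h - (h - g) * v) * (h - (h - g) * w) + g * h := by
  linear_combination (h - g) ^ 2 * H

/-- The hypothesis `F` of `sym_four` in type `B₂`, where the parameters `σ_j`, `σ'_j` of one of the
two simple roots may be different. -/
theorem identity_four {g₁ h₁ g₂ h₂ k x y a b c e d₁ d₂ e₁ e₂ : R}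
    (ha : a * (1 - x) = 1) (hb : b * (1 - x * y ^ 2) = 1) (hc : c * (1 - y ^ 2) = 1)
    (he : e * (1 - x ^ 2 * y ^ 2) = 1)
    (hd₁ : d₁ = h₁ - (h₁ - g₁) * a) (he₁ : e₁ = h₁ - (h₁ - g₁) * b)
    (hd₂ : d₂ = h₂ - (h₂ - g₂ + k * y) * c) (he₂ : e₂ = h₂ - (h₂ - g₂ + k * (x * y)) * e) :
    d₁ * d₂ + (h₁ + g₁ - d₁) * e₂ + (h₂ + g₂ - d₂) * e₁ = e₂ * e₁ + (h₁ * g₂ + h₂ * g₁) := by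
  have H1 : a * c = b * (a + c - 1) := inv_one_sub_mul ha hc hb rfl
  have H2 : a * b = e * (a + b - 1) := inv_one_sub_mul ha hb he (by ring)
  have H3 : c * (a - b) = x * (a * b) := by
    linear_combination (x * a * b) * hc - c * a * hb + c * b * ha
  subst hd₁ hd₂ he₁ he₂
  linear_combination (h₁ - g₁) * (h₂ - g₂) * (H1 + H2) + (h₁ - g₁) * k * y * (H3 + x * H2)

/-- The hypotheses `F` and `E` of `sym_six` in type `G₂`. They follow from the addition formulas
`H1`, …, `H5` for the pairs of positive coroots whose sum is a coroot. -/
theorem identity_six {g₁ h₁ g₂ h₂ k₁ k₂ a₁ b₁ c₁ a₂ b₂ c₂ d₁ d₂ f₁ f₂ j₁ j₂ q p : R}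
    (H1 : a₂ * c₂ = b₁ * (a₂ + c₂ - 1)) (H2 : a₂ * b₂ = c₂ * (a₂ + b₂ - 1))
    (H3 : b₂ * c₂ = c₁ * (b₂ + c₂ - 1)) (H4 : a₁ * a₂ = b₂ * (a₁ + a₂ - 1))
    (H5 : a₁ * b₁ = c₁ * (a₁ + b₁ - 1))
    (hk₁ : h₁ = g₁ + k₁) (hk₂ : h₂ = g₂ + k₂)
    (hd₁ : d₁ = h₁ - k₁ * a₁) (hf₁ : f₁ = h₁ - k₁ * b₁) (hg₁ : j₁ = h₁ - k₁ * c₁)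
    (hd₂ : d₂ = h₂ - k₂ * a₂) (hf₂ : f₂ = h₂ - k₂ * b₂) (hg₂ : j₂ = h₂ - k₂ * c₂)
    (hq : q = h₁ * g₂ + h₂ * g₁) (hp : p = q ^ 2 - g₁ * h₁ * g₂ * h₂) {d₁' f₁' d₂' f₂' j₂' : R}
    (h1 : d₁' = h₁ + g₁ - d₁) (h2 : f₁' = h₁ + g₁ - f₁)
    (h3 : d₂' = h₂ + g₂ - d₂) (h4 : f₂' = h₂ + g₂ - f₂) (h5 : j₂' = h₂ + g₂ - j₂) :
    d₁ * d₂ + d₂' * f₁ + f₁' * j₂ + j₁ * j₂' + d₁' * f₂ = f₂ * j₁ + 2 * q ∧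
    d₁ ^ 2 * d₂ ^ 2 + 2 * d₁ * d₂ * d₂' * f₁ + 2 * d₁ * d₁' * d₂ * f₂ + d₂' ^ 2 * f₁ ^ 2
      + d₁' ^ 2 * f₂ ^ 2 + d₁' * d₂' * f₁ * f₂ + d₂' * f₁ * f₁' * j₂ + d₁' * f₂ * f₂' * j₁
      - 2 * q * (d₁ * d₂ + d₂' * f₁ + d₁' * f₂) + p = f₁ * f₂ * j₁ * j₂ := by
  subst hp hq
  subst h1 h2 h3 h4 h5 hd₁ hd₂ hf₁ hf₂ hg₁ hg₂ hk₁ hk₂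
  constructor
  · linear_combination k₁ * k₂ * (H1 + H2 + H3 + H4)
  linear_combination
    (g₁ * k₁ * g₂ * k₂ * (1) + g₁ * k₁ * k₂ ^ 2 * (1 - b₂) + k₁ ^ 2 * g₂ * k₂ * (-b₁ + 1 + b₂ - c₁)
      + k₁ ^ 2 * k₂ ^ 2 * (-b₁ * a₂ + 1 + a₂ * c₂ + b₂ * c₂ - c₂ - b₂ + c₁ * b₂ - c₁)) * H1
    + (g₁ * k₁ * g₂ * k₂ * (1) + g₁ * k₁ * k₂ ^ 2 * (2 - b₂) + k₁ ^ 2 * g₂ * k₂ * (-b₁ + 1) + k₁ ^ 2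
      * k₂ ^ 2 * (-2 * b₁ * a₂ + 1 + a₂ * b₂ - b₁ * c₂ + b₁ + a₂ * c₂ - c₁ * b₂ - c₁ * c₂ + b₂ * c₂
      - b₂ + c₁) + g₁ ^ 2 * k₂ ^ 2 * (1)) * H2
    + (g₁ * k₁ * g₂ * k₂ * (1) + g₁ * k₁ * k₂ ^ 2 * (-b₂ + 1) + k₁ ^ 2 * g₂ * k₂ * (-a₂ + 1) + k₁ ^
      2 * k₂ ^ 2 * (b₂ * c₂ - b₂ + a₂ * c₂ - c₂ - a₂ + 1)) * H3
    + (g₁ * k₁ * g₂ * k₂ * (1) + g₁ * k₁ * k₂ ^ 2 * (-b₂ + 1) + k₁ ^ 2 * g₂ * k₂ * (-2 * b₁ + 1 +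
      c₁) + k₁ ^ 2 * k₂ ^ 2 * (a₁ * a₂ - a₁ * b₂ - 2 * b₁ * a₂ + a₂ * b₂ - c₁ * b₂ + 1 + c₁)) * H4
    + (k₁ ^ 2 * g₂ * k₂ * (a₂ - b₂ + 1) + k₁ ^ 2 * k₂ ^ 2 * (-a₂ * b₂ + a₂) + k₁ ^ 2 * g₂ ^ 2 * (1))
      * H5

end RankTwoIdentities

section BraidOperators
variable {K R A : Type*} [CommRing K] [CommRing R] [Ring A] [Algebra K R] [Algebra K A] [Module R A]
  [IsScalarTower R A A] [IsScalarTower K R A] {S T : R →+* R} {s t : A}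

/-- The quadratic relation of an operator `X` with `X + g = d + d' s`, where `d' = s(d)` and
`d + d' = h + g`. For `X = T_i`, these are `d = c(-α_i^∨)`, `h = σ_i` and `g = σ_i⁻¹`. -/
theorem operator_mul_self (hs : ∀ (f : R) (x : A), s * (f • x) = S f • (s * x))
    (hss : ∀ x, s * (s * x) = x) (hS : ∀ k : K, S (algebraMap K R k) = algebraMap K R k)
    {g h : K} {d : R} (h1 : S d = algebraMap K R (h + g) - d) {X : A}
    (hX : X + g • (1 : A) = d • (1 : A) + (algebraMap K R (h + g) - d) • s) :
    X * X = (g * h) • (1 : A) + (h - g) • X := by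
  have h0 := demazure_mul_self S s hs hss (d := d) (d' := algebraMap K R (h + g) - d)
    (add_sub_cancel _ _) h1 (by rw [map_sub, hS, h1, sub_sub_cancel])
  rw [← hX, algebraMap_smul] at h0
  simp only [add_mul, mul_add, smul_mul_assoc, mul_smul_comm, one_mul, mul_one] at h0
  rw [← sub_eq_zero] at h0 ⊢
  rw [← h0]
  module

omit [IsScalarTower K R A] in
theorem operator_braid_two (hs : ∀ (f : R) (x : A), s * (f • x) = S f • (s * x))
    (ht : ∀ (f : R) (x : A), t * (f • x) = T f • (t * x)) (hst : s * t = t * s)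
    (hS : ∀ k : K, S (algebraMap K R k) = algebraMap K R k)
    (hT : ∀ k : K, T (algebraMap K R k) = algebraMap K R k)
    {g₁ h₁ g₂ h₂ : K} {d₁ d₂ : R} {X₁ X₂ : A} (s2 : S d₂ = d₂) (t1 : T d₁ = d₁)
    (hX₁ : X₁ + g₁ • (1 : A) = d₁ • (1 : A) + (algebraMap K R (h₁ + g₁) - d₁) • s)
    (hX₂ : X₂ + g₂ • (1 : A) = d₂ • (1 : A) + (algebraMap K R (h₂ + g₂) - d₂) • t) :
    X₁ * X₂ = X₂ * X₁ := by
  have h := braid_two S T s t hs ht hst (d₁ := d₁) (d₁' := algebraMap K R (h₁ + g₁) - d₁)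
    (d₂ := d₂) (d₂' := algebraMap K R (h₂ + g₂) - d₂) s2 (by rw [map_sub, hS, s2]) t1
    (by rw [map_sub, hT, t1])
  rw [← hX₁, ← hX₂] at h
  simp only [add_mul, mul_add, smul_mul_assoc, mul_smul_comm, one_mul, mul_one] at h
  rw [← sub_eq_zero] at h ⊢
  rw [← h]
  module

theorem operator_braid_three (hs : ∀ (f : R) (x : A), s * (f • x) = S f • (s * x))
    (ht : ∀ (f : R) (x : A), t * (f • x) = T f • (t * x))
    (hss : ∀ x, s * (s * x) = x) (htt : ∀ x, t * (t * x) = x) (hst : s * (t * s) = t * (s * t))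
    (hS : ∀ k : K, S (algebraMap K R k) = algebraMap K R k)
    (hT : ∀ k : K, T (algebraMap K R k) = algebraMap K R k)
    {g h : K} {d₁ d₂ e : R} {X₁ X₂ : A}
    (s1 : S d₁ = algebraMap K R (h + g) - d₁) (s2 : S d₂ = e) (s3 : S e = d₂)
    (t1 : T d₂ = algebraMap K R (h + g) - d₂) (t2 : T d₁ = e) (t3 : T e = d₁)
    (F : d₁ * d₂ + (algebraMap K R (h + g) - d₁) * e = d₂ * e + algebraMap K R (g * h))
    (hX₁ : X₁ + g • (1 : A) = d₁ • (1 : A) + (algebraMap K R (h + g) - d₁) • s)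
    (hX₂ : X₂ + g • (1 : A) = d₂ • (1 : A) + (algebraMap K R (h + g) - d₂) • t) :
    X₁ * (X₂ * X₁) = X₂ * (X₁ * X₂) := by
  have h1 := operator_mul_self hs hss hS s1 hX₁
  have h2 := operator_mul_self ht htt hT t1 hX₂
  refine hecke_braid_three h1 h2 ?_
  have e1 := sym_three S T s t hs ht (by simpa using hss 1) (q := algebraMap K R (g * h))
    (d₂' := algebraMap K R (h + g) - d₂) (e' := algebraMap K R (h + g) - e)
    s1 (by rw [map_sub, hS, s1, sub_sub_cancel]) s2 (by rw [map_sub, hS, s2]) s3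
    (by rw [map_sub, hS, s3]) t2 (by rw [map_sub, hT, t2]) (hS _) F
  have e2 := sym_three T S t s ht hs (by simpa using htt 1) (q := algebraMap K R (g * h))
    (d₂' := algebraMap K R (h + g) - d₁) (e' := algebraMap K R (h + g) - e)
    t1 (by rw [map_sub, hT, t1, sub_sub_cancel]) t2 (by rw [map_sub, hT, t2]) t3
    (by rw [map_sub, hT, t3]) s2 (by rw [map_sub, hS, s2]) (hT _)
    (by linear_combination F)
  rw [← hX₁, ← hX₂, algebraMap_smul] at e1 e2
  rw [e1, e2, hst]
  module

theorem operator_braid_four (hs : ∀ (f : R) (x : A), s * (f • x) = S f • (s * x))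
    (ht : ∀ (f : R) (x : A), t * (f • x) = T f • (t * x))
    (hss : ∀ x, s * (s * x) = x) (htt : ∀ x, t * (t * x) = x)
    (hst : s * (t * (s * t)) = t * (s * (t * s)))
    (hS : ∀ k : K, S (algebraMap K R k) = algebraMap K R k)
    (hT : ∀ k : K, T (algebraMap K R k) = algebraMap K R k)
    {g₁ h₁ g₂ h₂ : K} {d₁ d₂ e₁ e₂ : R} {X₁ X₂ : A}
    (s1 : S d₁ = algebraMap K R (h₁ + g₁) - d₁) (s2 : S d₂ = e₂) (s3 : S e₁ = e₁) (s4 : S e₂ = d₂)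
    (t1 : T d₂ = algebraMap K R (h₂ + g₂) - d₂) (t2 : T d₁ = e₁) (t3 : T e₂ = e₂) (t4 : T e₁ = d₁)
    (F : d₁ * d₂ + (algebraMap K R (h₁ + g₁) - d₁) * e₂ + (algebraMap K R (h₂ + g₂) - d₂) * e₁ =
      e₂ * e₁ + algebraMap K R (h₁ * g₂ + h₂ * g₁))
    (hX₁ : X₁ + g₁ • (1 : A) = d₁ • (1 : A) + (algebraMap K R (h₁ + g₁) - d₁) • s)
    (hX₂ : X₂ + g₂ • (1 : A) = d₂ • (1 : A) + (algebraMap K R (h₂ + g₂) - d₂) • t) :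
    X₁ * (X₂ * (X₁ * X₂)) = X₂ * (X₁ * (X₂ * X₁)) := by
  have h1 := operator_mul_self hs hss hS s1 hX₁
  have h2 := operator_mul_self ht htt hT t1 hX₂
  refine hecke_braid_four h1 h2 ?_
  have e1 := sym_four S T s t (q := algebraMap K R (h₁ * g₂ + h₂ * g₁)) hs ht hss
    (by simpa using htt 1) rfl rfl rfl rfl s1 s2 s3 s4 t1 t2 t3 (hS _) (hS _) (hT _) (hT _) F hX₁
      hX₂
  have e2 := sym_four T S t s (q := algebraMap K R (h₁ * g₂ + h₂ * g₁)) ht hs htt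
    (by simpa using hss 1) rfl rfl rfl rfl t1 t2 t3 t4 s1 s2 s3 (hT _) (hT _) (hS _) (hS _) (by
      linear_combination F) hX₂ hX₁
  rw [algebraMap_smul] at e1 e2
  rw [e1, e2, hst]
  module

theorem operator_braid_six (hs : ∀ (f : R) (x : A), s * (f • x) = S f • (s * x))
    (ht : ∀ (f : R) (x : A), t * (f • x) = T f • (t * x))
    (hss : ∀ x, s * (s * x) = x) (htt : ∀ x, t * (t * x) = x)
    (hst : s * (t * (s * (t * (s * t)))) = t * (s * (t * (s * (t * s)))))
    (hS : ∀ k : K, S (algebraMap K R k) = algebraMap K R k)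
    (hT : ∀ k : K, T (algebraMap K R k) = algebraMap K R k)
    {g₁ h₁ g₂ h₂ q p : K} {d₁ d₂ f₁ f₂ j₁ j₂ d₁' d₂' f₁' f₂' j₁' j₂' : R} {X₁ X₂ : A}
    (hq : q = h₁ * g₂ + h₂ * g₁) (hp : p = q ^ 2 - g₁ * h₁ * g₂ * h₂)
    (a1 : d₁' = algebraMap K R (h₁ + g₁) - d₁) (a2 : f₁' = algebraMap K R (h₁ + g₁) - f₁)
    (a3 : j₁' = algebraMap K R (h₁ + g₁) - j₁) (a4 : d₂' = algebraMap K R (h₂ + g₂) - d₂)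
    (a5 : f₂' = algebraMap K R (h₂ + g₂) - f₂) (a6 : j₂' = algebraMap K R (h₂ + g₂) - j₂)
    (s1 : S d₁ = d₁') (s2 : S d₂ = f₂) (s3 : S f₂ = d₂) (s4 : S f₁ = j₁) (s5 : S j₁ = f₁)
    (s6 : S j₂ = j₂)
    (t1 : T d₂ = d₂') (t2 : T d₁ = f₁) (t3 : T f₁ = d₁) (t4 : T f₂ = j₂) (t5 : T j₂ = f₂)
    (t6 : T j₁ = j₁)
    (FE : d₁ * d₂ + d₂' * f₁ + f₁' * j₂ + j₁ * j₂' + d₁' * f₂ = f₂ * j₁ + 2 * algebraMap K R q ∧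
      d₁ ^ 2 * d₂ ^ 2 + 2 * d₁ * d₂ * d₂' * f₁ + 2 * d₁ * d₁' * d₂ * f₂ + d₂' ^ 2 * f₁ ^ 2
      + d₁' ^ 2 * f₂ ^ 2 + d₁' * d₂' * f₁ * f₂ + d₂' * f₁ * f₁' * j₂ + d₁' * f₂ * f₂' * j₁
      - 2 * algebraMap K R q * (d₁ * d₂ + d₂' * f₁ + d₁' * f₂) + algebraMap K R p =
        f₁ * f₂ * j₁ * j₂)
    (hX₁ : X₁ + g₁ • (1 : A) = d₁ • (1 : A) + d₁' • s)
    (hX₂ : X₂ + g₂ • (1 : A) = d₂ • (1 : A) + d₂' • t) :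
    X₁ * (X₂ * (X₁ * (X₂ * (X₁ * X₂)))) = X₂ * (X₁ * (X₂ * (X₁ * (X₂ * X₁)))) := by
  obtain ⟨F, E⟩ := FE
  have h1 := operator_mul_self hs hss hS (s1.trans a1) (a1 ▸ hX₁)
  have h2 := operator_mul_self ht htt hT (t1.trans a4) (a4 ▸ hX₂)
  refine hecke_braid_six h1 h2 hq hp rfl rfl ?_
  have e1 := sym_six S T s t (q := algebraMap K R q) (p := algebraMap K R p) hs ht hss htt
    a1 a2 a3 a4 a5 a6 s1 s2 s3 s4 s5 s6 t1 t2 t3 t4 t5 t6 (hS _) (hS _) (hS _) (hS _) (hT _) (hT _)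
      F E hX₁ hX₂
  have e2 := sym_six T S t s (q := algebraMap K R q) (p := algebraMap K R p) ht hs htt hss
    a4 a5 a6 a1 a2 a3 t1 t2 t3 t4 t5 t6 s1 s2 s3 s4 s5 s6 (hT _) (hT _) (hT _) (hT _) (hS _) (hS _)
    (by subst a1 a2 a3 a4 a5 a6; linear_combination F) (by linear_combination E) hX₂ hX₁
  have e0 : ∀ x : A, (2 * algebraMap K R q) • x = (2 * q) • x := fun x => by
    rw [← algebraMap_smul R (2 * q) x, map_mul, map_ofNat]
  simp only [algebraMap_smul, e0] at e1 e2
  rw [e1, e2, hst]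
  module

end BraidOperators

variable {I T V : Type*} [NormedAddCommGroup V] [NormedSpace ℝ V]
variable (D : HeckeDatum I T V)

/-! ### Lengths -/

@[simp] theorem wordProd_nil : D.wordProd [] = 1 := rfl

@[simp] theorem wordProd_cons (i : I) (l : List I) :
    D.wordProd (i :: l) = D.r i * D.wordProd l := by simp [wordProd]

theorem wordProd_concat (l : List I) (i : I) :
    D.wordProd (l ++ [i]) = D.wordProd l * D.r i := by simp [wordProd_append]

@[simp] theorem r_mul_r_mul (i : I) (w : D.W) : D.r i * (D.r i * w) = w := by
  rw [← mul_assoc, D.r_mul_self, one_mul]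

@[simp] theorem mul_r_mul_r (i : I) (w : D.W) : w * D.r i * D.r i = w := by
  rw [mul_assoc, D.r_mul_self, mul_one]

@[simp] theorem r_inv (i : I) : (D.r i)⁻¹ = D.r i :=
  inv_eq_of_mul_eq_one_right (D.r_mul_self i)

theorem wordProd_reverse (l : List I) : D.wordProd l.reverse = (D.wordProd l)⁻¹ := by
  induction l with
  | nil => simp
  | cons i l ih => rw [List.reverse_cons, wordProd_concat, ih, wordProd_cons, mul_inv_rev, r_inv]

theorem length_wordProd_le (l : List I) : D.length (D.wordProd l) ≤ l.length := by
  classical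
  exact Nat.find_min' _ ⟨l, rfl, rfl⟩

theorem length_mul_le (w w' : D.W) : D.length (w * w') ≤ D.length w + D.length w' := by
  obtain ⟨l, hl, rfl⟩ := D.exists_reduced w
  obtain ⟨l', hl', rfl⟩ := D.exists_reduced w'
  rw [← wordProd_append, ← hl, ← hl', ← List.length_append]
  exact D.length_wordProd_le _

@[simp] theorem length_one : D.length (1 : D.W) = 0 :=
  Nat.le_zero.1 (D.length_wordProd_le [])

theorem length_inv (w : D.W) : D.length w⁻¹ = D.length w := by
  have key : ∀ w : D.W, D.length w⁻¹ ≤ D.length w := by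
    intro w
    obtain ⟨l, hl, rfl⟩ := D.exists_reduced w
    rw [← wordProd_reverse, ← hl, ← List.length_reverse]
    exact D.length_wordProd_le _
  exact le_antisymm (key w) (by simpa using key w⁻¹)

theorem length_r_le (i : I) : D.length (D.r i) ≤ 1 := by
  simpa using D.length_wordProd_le [i]

theorem eq_one_of_length_eq_zero {w : D.W} (h : D.length w = 0) : w = 1 := by
  obtain ⟨l, hl, rfl⟩ := D.exists_reduced w
  rw [h, List.length_eq_zero_iff] at hl
  simp [hl]

theorem det_wordProd [FiniteDimensional ℝ V] (l : List I) :
    LinearMap.det ((D.wordProd l : V ≃ₗ[ℝ] V) : V →ₗ[ℝ] V) = (-1) ^ l.length := by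
  induction l with
  | nil => simp
  | cons i l ih =>
    have h : ((D.r i : V ≃ₗ[ℝ] V) : V →ₗ[ℝ] V)
        = LinearMap.transvection (D.root i) (-D.coroot i) := by
      ext v
      simpa [r, LinearMap.transvection.apply, sub_eq_add_neg] using D.refl_apply i v
    have h' : ((D.wordProd (i :: l) : V ≃ₗ[ℝ] V) : V →ₗ[ℝ] V)
        = ((D.r i : V ≃ₗ[ℝ] V) : V →ₗ[ℝ] V) ∘ₗ ((D.wordProd l : V ≃ₗ[ℝ] V) : V →ₗ[ℝ] V) := by
      rw [wordProd_cons]; rfl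
    rw [h', LinearMap.det_comp, ih, h, LinearMap.transvection.det, map_neg, root_coroot_self,
      List.length_cons, pow_succ]
    norm_num

theorem length_parity [FiniteDimensional ℝ V] (l : List I) :
    D.length (D.wordProd l) % 2 = l.length % 2 := by
  obtain ⟨l', hl', h⟩ := D.exists_reduced (D.wordProd l)
  have h1 := D.det_wordProd l
  rw [← h, D.det_wordProd l'] at h1
  rw [← hl']
  rcases Nat.even_or_odd l.length with h2 | h2 <;> rcases Nat.even_or_odd l'.length with h3 | h3
  · rw [Nat.even_iff.1 h2, Nat.even_iff.1 h3]
  · rw [h2.neg_one_pow, h3.neg_one_pow] at h1; norm_num at h1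
  · rw [h2.neg_one_pow, h3.neg_one_pow] at h1; norm_num at h1
  · rw [Nat.odd_iff.1 h2, Nat.odd_iff.1 h3]

theorem length_mul_r [FiniteDimensional ℝ V] (w : D.W) (i : I) :
    D.length (w * D.r i) = D.length w + 1 ∨ D.length (w * D.r i) + 1 = D.length w := by
  have h1 := D.length_mul_le w (D.r i)
  have h2 := D.length_mul_le (w * D.r i) (D.r i)
  rw [mul_r_mul_r] at h2
  have h3 := D.length_r_le i
  obtain ⟨l, hl, rfl⟩ := D.exists_reduced w
  have h4 := D.length_parity (l ++ [i])
  rw [wordProd_concat, List.length_append, List.length_singleton] at h4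
  omega

theorem length_r_mul [FiniteDimensional ℝ V] (i : I) (w : D.W) :
    D.length (D.r i * w) = D.length w + 1 ∨ D.length (D.r i * w) + 1 = D.length w := by
  have h := D.length_mul_r w⁻¹ i
  have e : w⁻¹ * D.r i = (D.r i * w)⁻¹ := by rw [mul_inv_rev, r_inv]
  rwa [e, length_inv, length_inv] at h

/-! ### The dual action on linear forms -/

theorem dualAct_apply (w : D.W) (a : Module.Dual ℝ V) (v : V) :
    D.dualAct w a v = a (((w⁻¹ : D.W) : V ≃ₗ[ℝ] V) v) := rfl

theorem dualAct_one (a : Module.Dual ℝ V) : D.dualAct 1 a = a := by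
  ext v; simp [dualAct_apply]

theorem dualAct_mul (w w' : D.W) (a : Module.Dual ℝ V) :
    D.dualAct (w * w') a = D.dualAct w (D.dualAct w' a) := by
  ext v
  simp only [dualAct_apply, mul_inv_rev]
  rfl

/-- The dual action of the Weyl group, as a homomorphism to additive endomorphisms. -/
def dualHom : D.W →* AddMonoid.End (Module.Dual ℝ V) where
  toFun w := { toFun := D.dualAct w, map_zero' := rfl, map_add' := fun _ _ => rfl }
  map_one' := AddMonoidHom.ext fun a => D.dualAct_one a
  map_mul' w w' := AddMonoidHom.ext fun a => D.dualAct_mul w w' a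

/-- The action of the Weyl group on `V`, as a homomorphism to additive endomorphisms. -/
def vecHom : D.W →* AddMonoid.End V where
  toFun w := ((w : V ≃ₗ[ℝ] V) : V →ₗ[ℝ] V).toAddMonoidHom
  map_one' := rfl
  map_mul' _ _ := rfl

theorem vecHom_apply (w : D.W) (v : V) : D.vecHom w v = (w : V ≃ₗ[ℝ] V) v := rfl

theorem dualHom_apply (w : D.W) (a : Module.Dual ℝ V) : D.dualHom w a = D.dualAct w a := rfl

theorem vecHom_r (i j : I) :
    D.vecHom (D.r i) (D.coroot j) = D.coroot j - D.cartan j i • D.coroot i := by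
  rw [vecHom_apply, ← Int.cast_smul_eq_zsmul ℝ, ← D.root_coroot]
  exact D.refl_apply i _

theorem dualHom_r (i j : I) :
    D.dualHom (D.r i) (D.root j) = D.root j - D.cartan i j • D.root i := by
  ext v
  rw [dualHom_apply, dualAct_apply, r_inv, ← Int.cast_smul_eq_zsmul ℝ, ← D.root_coroot]
  have h : ((D.r i : D.W) : V ≃ₗ[ℝ] V) v = v - D.root i v • D.coroot i := D.refl_apply i v
  rw [h]
  simp [mul_comm]

/-! ### Rank two -/

/-- The alternating word of length `k` in the letters `i`, `j` whose last letter is `j`. -/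
def alt (i j : I) : ℕ → List I
  | 0 => []
  | k + 1 => alt j i k ++ [j]

/-- The order of `r_i r_j` (`0` standing for infinity), in terms of the product
`α_i(α_j^∨) α_j(α_i^∨)`. -/
def bondOrder (i j : I) : ℕ :=
  if D.cartan i j * D.cartan j i = 0 then 2
  else if D.cartan i j * D.cartan j i = 1 then 3
  else if D.cartan i j * D.cartan j i = 2 then 4
  else if D.cartan i j * D.cartan j i = 3 then 6 else 0

theorem bondOrder_comm (i j : I) : D.bondOrder i j = D.bondOrder j i := by
  simp only [bondOrder, mul_comm]

theorem alt_length (i j : I) (k : ℕ) : (alt i j k).length = k := by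
  induction k generalizing i j with
  | zero => rfl
  | succ k ih => simp [alt, ih]

theorem int_pairs {a b : ℤ} (ha : a ≤ 0) (hb : b ≤ 0) (h0 : a = 0 ↔ b = 0) :
    (a = 0 ∧ b = 0) ∨ (a = -1 ∧ b = -1) ∨ (a = -1 ∧ b = -2) ∨ (a = -2 ∧ b = -1) ∨
      (a = -1 ∧ b = -3) ∨ (a = -3 ∧ b = -1) ∨ (a ≤ -1 ∧ b ≤ -1 ∧ 4 ≤ a * b) := by
  by_cases ha0 : a = 0
  · exact Or.inl ⟨ha0, h0.1 ha0⟩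
  have hb0 : b ≠ 0 := fun h => ha0 (h0.2 h)
  have ha1 : a ≤ -1 := by omega
  have hb1 : b ≤ -1 := by omega
  by_cases h4 : 4 ≤ a * b
  · exact Or.inr (Or.inr (Or.inr (Or.inr (Or.inr (Or.inr ⟨ha1, hb1, h4⟩)))))
  · have h5 : -3 ≤ a := by nlinarith
    have h6 : -3 ≤ b := by nlinarith
    have h7 : a = -1 ∨ a = -2 ∨ a = -3 := by omega
    have h8 : b = -1 ∨ b = -2 ∨ b = -3 := by omega
    rcases h7 with rfl | rfl | rfl <;> rcases h8 with rfl | rfl | rfl <;> omega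

section RankTwo

variable {M : Type*} [AddCommGroup M] (act : D.W →* AddMonoid.End M) (e : I → M)
  (A : Matrix I I ℤ)

theorem act_alt_succ (hact : ∀ i j, act (D.r i) (e j) = e j - A i j • e i)
    (hd : ∀ i, A i i = 2) (i j : I) (k : ℕ) (x y : ℤ) :
    act (D.wordProd (alt i j (k + 1))) (x • e i + y • e j)
      = act (D.wordProd (alt j i k)) ((-A j i * x - y) • e j + x • e i) := by
  rw [alt, wordProd_concat, map_mul]
  change act _ (act (D.r j) _) = _
  congr 1
  rw [map_add, map_zsmul, map_zsmul, hact, hact, hd]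
  module

theorem act_alt_nonneg (hact : ∀ i j, act (D.r i) (e j) = e j - A i j • e i)
    (hd : ∀ i, A i i = 2) (k : ℕ) : ∀ (i j : I) (x y : ℤ), A i j ≤ -1 → A j i ≤ -1 →
    4 ≤ A i j * A j i → 1 ≤ x → 0 ≤ y → 2 * y ≤ -A j i * x →
    ∃ x' y' : ℤ, (1 ≤ x' ∧ 1 ≤ y' ∨ x' = x ∧ y' = y) ∧
      act (D.wordProd (alt i j k)) (x • e i + y • e j) = x' • e i + y' • e j := by
  induction k with
  | zero => intro i j x y _ _ _ hx hy _; exact ⟨x, y, Or.inr ⟨rfl, rfl⟩, by simp [alt]⟩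
  | succ k ih =>
    intro i j x y h1 h2 h3 hx hy hxy
    have h4 : 1 ≤ -A j i * x - y := by nlinarith
    have h5 : 2 * x ≤ -A i j * (-A j i * x - y) := by nlinarith
    obtain ⟨x', y', h', h⟩ := ih j i (-A j i * x - y) x h2 h1 (by linarith) h4 (by omega) h5
    refine ⟨y', x', Or.inl ?_, by rw [D.act_alt_succ act e A hact hd, h, add_comm]⟩
    rcases h' with h' | ⟨rfl, rfl⟩
    · exact h'.symm
    · exact ⟨hx, h4⟩

/-- Below the order of `r_i r_j`, an alternating word ending in `r_j` maps `e_i` to a nonnegative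
combination of `e_i` and `e_j`. It is a multiple of `e_i` or `e_j` only if it is equal to `e_i` or
`e_j`, and the latter occurs only for a simple bond. -/
theorem act_alt_pos (hact : ∀ i j, act (D.r i) (e j) = e j - A i j • e i)
    (hd : ∀ i, A i i = 2) (hn : ∀ i j, i ≠ j → A i j ≤ 0) (h0 : ∀ i j, A i j = 0 → A j i = 0)
    (hA : ∀ i j, A i j * A j i = D.cartan i j * D.cartan j i) {i j : I} (hij : i ≠ j) (k : ℕ)
    (hk : D.bondOrder i j = 0 ∨ k < D.bondOrder i j) :
    ∃ x y : ℕ, (y = 0 → x = 1) ∧ (x = 0 → y = 1 ∧ A i j = -1 ∧ A j i = -1) ∧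
      act (D.wordProd (alt i j k)) (e i) = x • e i + y • e j := by
  suffices h : ∃ x y : ℤ, 0 ≤ x ∧ 0 ≤ y ∧ (y = 0 → x = 1) ∧
      (x = 0 → y = 1 ∧ A i j = -1 ∧ A j i = -1) ∧
      act (D.wordProd (alt i j k)) ((1 : ℤ) • e i + (0 : ℤ) • e j) = x • e i + y • e j by
    obtain ⟨x, y, hx, hy, h1, h2, h⟩ := h
    lift x to ℕ using hx
    lift y to ℕ using hy
    refine ⟨x, y, by exact_mod_cast h1, by exact_mod_cast h2, ?_⟩
    simpa using h
  rw [bondOrder, ← hA] at hk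
  have aux := D.act_alt_succ act e A hact hd
  have aux0 : ∀ (i j : I) (x y : ℤ), act (D.wordProd (alt i j 0)) (x • e i + y • e j)
      = x • e i + y • e j := by intro i j x y; simp [alt]
  rcases int_pairs (hn i j hij) (hn j i hij.symm) ⟨h0 i j, h0 j i⟩ with
    ⟨ha, hb⟩ | ⟨ha, hb⟩ | ⟨ha, hb⟩ | ⟨ha, hb⟩ | ⟨ha, hb⟩ | ⟨ha, hb⟩ | ⟨ha, hb, hab⟩
  on_goal 7 =>
    obtain ⟨x, y, hxy, h⟩ := D.act_alt_nonneg act e A hact hd k i j 1 0 ha hb hab (by simp)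
      (by simp) (by omega)
    exact ⟨x, y, by omega, by omega, by omega, by omega, h⟩
  all_goals
    rw [ha, hb] at hk ⊢
    norm_num at hk
    interval_cases k <;> simp only [aux, aux0, ha, hb] <;>
    first
      | (refine ⟨_, _, ?_, ?_, ?_, ?_, rfl⟩ <;> norm_num)
      | (refine ⟨_, _, ?_, ?_, ?_, ?_, add_comm _ _⟩ <;> norm_num)

end RankTwo

/-! ### The braid relations of the Weyl group -/

theorem r_apply (i : I) (v : V) :
    ((D.r i : D.W) : V ≃ₗ[ℝ] V) v = v - D.root i v • D.coroot i := D.refl_apply i v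

theorem coe_mul_apply (w w' : D.W) (v : V) :
    ((w * w' : D.W) : V ≃ₗ[ℝ] V) v = (w : V ≃ₗ[ℝ] V) ((w' : V ≃ₗ[ℝ] V) v) := rfl

theorem cartan_pairs {i j : I} (hij : i ≠ j) :
    (D.cartan i j = 0 ∧ D.cartan j i = 0) ∨ (D.cartan i j = -1 ∧ D.cartan j i = -1) ∨
    (D.cartan i j = -1 ∧ D.cartan j i = -2) ∨ (D.cartan i j = -2 ∧ D.cartan j i = -1) ∨
    (D.cartan i j = -1 ∧ D.cartan j i = -3) ∨ (D.cartan i j = -3 ∧ D.cartan j i = -1) ∨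
    (D.cartan i j ≤ -1 ∧ D.cartan j i ≤ -1 ∧ 4 ≤ D.cartan i j * D.cartan j i) :=
  int_pairs (D.cartan_nonpos i j hij) (D.cartan_nonpos j i hij.symm)
    ⟨D.cartan_zero i j, D.cartan_zero j i⟩

/-- The braid relation in the Weyl group. -/
theorem wordProd_alt_bondOrder {i j : I} (hij : i ≠ j) :
    D.wordProd (alt i j (D.bondOrder i j)) = D.wordProd (alt j i (D.bondOrder i j)) := by
  have hii := D.root_coroot_self i
  have hjj := D.root_coroot_self j
  have h1 := D.root_coroot i j
  have h2 := D.root_coroot j i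
  refine Subtype.ext (LinearEquiv.ext fun v => ?_)
  rcases D.cartan_pairs hij with
    ⟨ha, hb⟩ | ⟨ha, hb⟩ | ⟨ha, hb⟩ | ⟨ha, hb⟩ | ⟨ha, hb⟩ | ⟨ha, hb⟩ | ⟨ha, hb, hab⟩
  on_goal 7 =>
    have h : D.bondOrder i j = 0 := by
      rw [bondOrder]; split_ifs <;> omega
    rw [h]; rfl
  all_goals
    rw [ha] at h1
    rw [hb] at h2
    simp only [bondOrder, ha, hb]
    norm_num [alt, wordProd_append, coe_mul_apply, r_apply, h1, h2, hii, hjj]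
    try module

/-! ### Minimal coset representatives, positive roots and lengths -/

section FiniteDim

variable [FiniteDimensional ℝ V]

theorem length_mul_r_of_not_lt {w : D.W} {i : I} (h : ¬ D.length w < D.length (w * D.r i)) :
    D.length (w * D.r i) + 1 = D.length w := by
  rcases D.length_mul_r w i with h' | h' <;> omega

/-- Every `w` is `v x` with `ℓ(w) = ℓ(v) + ℓ(x)`, where `x` is a product of `r_i`'s and `r_j`'s and
`v` is shorter than `v r_i` and `v r_j`. -/
theorem exists_coset_decomp (i j : I) (w : D.W) :
    ∃ (v : D.W) (x : List I), (∀ k ∈ x, k = i ∨ k = j) ∧ w = v * D.wordProd x ∧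
      D.length w = D.length v + x.length ∧ D.length v < D.length (v * D.r i) ∧
      D.length v < D.length (v * D.r j) := by
  induction hn : D.length w using Nat.strong_induction_on generalizing w with
  | _ n ih =>
    subst hn
    have step : ∀ k, (k = i ∨ k = j) → ¬ D.length w < D.length (w * D.r k) →
        ∃ (v : D.W) (x : List I), (∀ k ∈ x, k = i ∨ k = j) ∧ w = v * D.wordProd x ∧
          D.length w = D.length v + x.length ∧ D.length v < D.length (v * D.r i) ∧
          D.length v < D.length (v * D.r j) := by
      intro k hk h
      have h' := D.length_mul_r_of_not_lt h
      obtain ⟨v, x, hx, hw, hl, h1, h2⟩ := ih _ (by omega) (w * D.r k) rfl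
      refine ⟨v, x ++ [k], ?_, ?_, ?_, h1, h2⟩
      · intro k' hk'
        rcases List.mem_append.1 hk' with h | h
        · exact hx _ h
        · rw [List.mem_singleton.1 h]; exact hk
      · rw [wordProd_concat, ← mul_assoc, ← hw, mul_r_mul_r]
      · rw [List.length_append, List.length_singleton]; omega
    by_cases hi : D.length w < D.length (w * D.r i)
    · by_cases hj : D.length w < D.length (w * D.r j)
      · exact ⟨w, [], by simp, by simp, by simp, hi, hj⟩
      · exact step j (Or.inr rfl) hj
    · exact step i (Or.inl rfl) hi

omit [FiniteDimensional ℝ V] in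
/-- A reduced word in two letters is alternating. -/
theorem eq_alt_of_reduced {i j : I} (x : List I) (hx : ∀ k ∈ x, k = i ∨ k = j)
    (hred : D.length (D.wordProd x) = x.length) :
    x = alt i j x.length ∨ x = alt j i x.length := by
  induction x using List.reverseRecOn with
  | nil => exact Or.inl rfl
  | append_singleton x k ih =>
    have hred' : D.length (D.wordProd x) = x.length := by
      have h1 := D.length_mul_le (D.wordProd x) (D.r k)
      rw [wordProd_concat, List.length_append, List.length_singleton] at hred
      have := D.length_r_le k
      have := D.length_wordProd_le x
      omega
    have h := ih (fun k' hk' => hx _ (List.mem_append_left _ hk')) hred'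
    have hk := hx k (by simp)
    have hlast : ∀ x', x ≠ x' ++ [k] := by
      rintro x' rfl
      rw [wordProd_concat, wordProd_concat, mul_r_mul_r] at hred
      have := D.length_wordProd_le x'
      simp only [List.length_append, List.length_singleton] at hred
      omega
    rw [List.length_append, List.length_singleton]
    rcases Nat.eq_zero_or_pos x.length with h0 | h0
    · rw [List.length_eq_zero_iff] at h0
      subst h0
      rcases hk with rfl | rfl
      · exact Or.inr rfl
      · exact Or.inl rfl
    · obtain ⟨n, hn⟩ := Nat.exists_eq_succ_of_ne_zero h0.ne'
      rw [hn] at h ⊢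
      rcases h with h | h <;> rcases hk with rfl | rfl
      · right
        conv_lhs => rw [h]
        rfl
      · exact absurd h (hlast _)
      · exact absurd h (hlast _)
      · left
        conv_lhs => rw [h]
        rfl

omit [FiniteDimensional ℝ V] in
/-- A longer alternating word than `bondOrder` is not reduced, and at `bondOrder` one can exchange
the two alternating words. -/
theorem length_alt_mul_r {i j : I} (hij : i ≠ j) {k : ℕ} (h0 : D.bondOrder i j ≠ 0)
    (hk : D.bondOrder i j ≤ k) : D.length (D.wordProd (alt i j k) * D.r i) < k := by
  have key : ∀ n, ∃ y : List I, y.length = n ∧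
      D.wordProd (alt i j (n + D.bondOrder i j)) = D.wordProd (y ++ alt i j (D.bondOrder i j)) := by
    have aux : ∀ m n : ℕ, ∀ i j : I, ∃ y : List I, y.length = n ∧ alt i j (n + m) = y ++ alt i j m
      := by
      intro m
      induction m with
      | zero => intro n i j; exact ⟨alt i j n, alt_length _ _ _, by simp [alt]⟩
      | succ m ih =>
        intro n i j
        obtain ⟨y, hy, h⟩ := ih n j i
        exact ⟨y, hy, by rw [← add_assoc, alt, h, alt, List.append_assoc]⟩
    intro n
    obtain ⟨y, hy, h⟩ := aux (D.bondOrder i j) n i j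
    exact ⟨y, hy, by rw [h]⟩
  obtain ⟨y, hy, h⟩ := key (k - D.bondOrder i j)
  rw [Nat.sub_add_cancel hk] at h
  obtain ⟨m, hm⟩ := Nat.exists_eq_succ_of_ne_zero h0
  rw [h, wordProd_append, D.wordProd_alt_bondOrder hij, hm, alt, wordProd_concat, ← mul_assoc,
    mul_r_mul_r, ← wordProd_append]
  refine lt_of_le_of_lt (D.length_wordProd_le _) ?_
  rw [List.length_append, alt_length, hy]
  omega

/-- A nontrivial `w` shorter than `w r_i` is `v x`, where `v` is shorter than `v r_i` and `v r_k`
for some `k ≠ i`, and `x` is an alternating word in `r_i` and `r_k`, ending in `r_k`, which is not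
longest in its dihedral group. -/
theorem exists_eq_mul_alt_of_lt {w : D.W} {i : I} (h : D.length w < D.length (w * D.r i))
    (h1 : w ≠ 1) : ∃ (k : I) (v : D.W) (n : ℕ), i ≠ k ∧ w = v * D.wordProd (alt i k n) ∧
      D.length v < D.length w ∧ D.length v < D.length (v * D.r i) ∧
      D.length v < D.length (v * D.r k) ∧ (D.bondOrder i k = 0 ∨ n < D.bondOrder i k) := by
  obtain ⟨l, hl, hlw⟩ := D.exists_reduced w
  obtain ⟨j, hj⟩ : ∃ j, ¬ D.length w < D.length (w * D.r j) := by
    rcases List.eq_nil_or_concat l with rfl | ⟨l', j, rfl⟩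
    · exact absurd hlw.symm h1
    · refine ⟨j, ?_⟩
      rw [List.concat_eq_append] at hl hlw
      have h2 := D.length_wordProd_le l'
      rw [← hl, ← hlw, wordProd_concat, mul_r_mul_r, List.length_append]
      simp only [List.length_singleton]
      omega
  have hij : i ≠ j := by rintro rfl; exact hj h
  obtain ⟨v, x, hx, hw, hlen, hvi, hvj⟩ := D.exists_coset_decomp i j w
  have hx0 : x ≠ [] := by
    rintro rfl
    rw [wordProd_nil, mul_one] at hw
    subst hw; exact hj hvj
  have hxpos := List.length_pos_iff.2 hx0
  have hred : D.length (D.wordProd x) = x.length := by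
    have h2 := D.length_mul_le v (D.wordProd x)
    have h3 := D.length_wordProd_le x
    rw [← hw] at h2; omega
  obtain ⟨m, hm⟩ := Nat.exists_eq_succ_of_ne_zero hxpos.ne'
  have hxalt : x = alt i j x.length := by
    rcases D.eq_alt_of_reduced x hx hred with h' | h'
    · exact h'
    · exfalso
      rw [hm, alt] at h'
      have hw' : w * D.r i = v * D.wordProd (alt i j m) := by
        rw [hw, h', wordProd_concat, ← mul_assoc, mul_r_mul_r]
      rw [hw'] at h
      have h2 := D.length_mul_le v (D.wordProd (alt i j m))
      have h3 := D.length_wordProd_le (alt i j m)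
      rw [alt_length] at h3
      omega
  refine ⟨j, v, x.length, hij, by rw [← hxalt]; exact hw, by omega, hvi, hvj, ?_⟩
  by_contra hcon
  push Not at hcon
  have h2 := D.length_alt_mul_r hij hcon.1 hcon.2
  rw [← hxalt] at h2
  have h3 := D.length_mul_le v (D.wordProd x * D.r i)
  rw [← mul_assoc, ← hw] at h3
  omega

theorem act_mem_closure {M : Type*} [AddCommGroup M] (act : D.W →* AddMonoid.End M) (e : I → M)
    (A : Matrix I I ℤ)
    (hact : ∀ i j, act (D.r i) (e j) = e j - A i j • e i)
    (hd : ∀ i, A i i = 2) (hn : ∀ i j, i ≠ j → A i j ≤ 0) (h0 : ∀ i j, A i j = 0 → A j i = 0)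
    (hA : ∀ i j, A i j * A j i = D.cartan i j * D.cartan j i) (w : D.W) (i : I)
    (h : D.length w < D.length (w * D.r i)) :
    act w (e i) ∈ AddSubmonoid.closure (Set.range e) := by
  induction hn : D.length w using Nat.strong_induction_on generalizing w i with
  | _ n ih =>
    subst hn
    by_cases h1 : w = 1
    · subst h1; rw [map_one]; exact AddSubmonoid.subset_closure ⟨i, rfl⟩
    obtain ⟨j, v, n, hij, hw, hv, hvi, hvj, hk⟩ := D.exists_eq_mul_alt_of_lt h h1
    obtain ⟨p, q, -, -, hpq⟩ := D.act_alt_pos act e A hact hd hn h0 hA hij n hk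
    rw [hw, map_mul]
    change act v (act _ _) ∈ _
    rw [hpq, map_add, map_nsmul, map_nsmul]
    exact add_mem (nsmul_mem (ih _ hv v i hvi rfl) _) (nsmul_mem (ih _ hv v j hvj rfl) _)

/-- If `ℓ(w) < ℓ(w r_i)`, then `w α_i^∨` is a positive coroot. -/
theorem coroot_pos {w : D.W} {i : I} (h : D.length w < D.length (w * D.r i)) :
    (w : V ≃ₗ[ℝ] V) (D.coroot i) ∈ D.Qpos :=
  D.act_mem_closure D.vecHom D.coroot (fun i j => D.cartan j i) D.vecHom_r D.cartan_diag
    (fun i j hij => D.cartan_nonpos j i hij.symm) (fun i j => D.cartan_zero j i)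
    (fun _ _ => mul_comm _ _) w i h

/-- If `ℓ(w) < ℓ(w r_i)`, then `w α_i` is a positive root. -/
theorem root_pos {w : D.W} {i : I} (h : D.length w < D.length (w * D.r i)) :
    D.dualAct w (D.root i) ∈ AddSubmonoid.closure (Set.range D.root) :=
  D.act_mem_closure D.dualHom D.root D.cartan D.dualHom_r D.cartan_diag D.cartan_nonpos
    D.cartan_zero (fun _ _ => rfl) w i h

omit [FiniteDimensional ℝ V] in
theorem coroot_neg_of_mul_r (w : D.W) (i : I) :
    ((w * D.r i : D.W) : V ≃ₗ[ℝ] V) (D.coroot i) = -(w : V ≃ₗ[ℝ] V) (D.coroot i) := by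
  rw [coe_mul_apply, r_apply, root_coroot_self, ← map_neg]
  congr 1
  module

omit [FiniteDimensional ℝ V] in
theorem root_neg_of_mul_r (w : D.W) (i : I) :
    D.dualAct (w * D.r i) (D.root i) = -D.dualAct w (D.root i) := by
  have h := D.dualHom_r i i
  rw [D.cartan_diag] at h
  rw [dualAct_mul, ← dualHom_apply D (D.r i), h]
  have e : D.root i - (2 : ℤ) • D.root i = -D.root i := by module
  rw [e, ← dualHom_apply, map_neg, dualHom_apply]

theorem coroot_neg {w : D.W} {i : I} (h : D.length (w * D.r i) < D.length w) :
    -(w : V ≃ₗ[ℝ] V) (D.coroot i) ∈ D.Qpos := by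
  rw [← coroot_neg_of_mul_r]
  exact D.coroot_pos (by rwa [mul_r_mul_r])

theorem root_neg {w : D.W} {i : I} (h : D.length (w * D.r i) < D.length w) :
    -D.dualAct w (D.root i) ∈ AddSubmonoid.closure (Set.range D.root) := by
  rw [← root_neg_of_mul_r]
  exact D.root_pos (by rwa [mul_r_mul_r])

omit [FiniteDimensional ℝ V] in
theorem posCone_antisymm {a : Module.Dual ℝ V}
    (h : a ∈ AddSubmonoid.closure (Set.range D.root))
    (h' : -a ∈ AddSubmonoid.closure (Set.range D.root)) : a = 0 := by
  obtain ⟨f, hf⟩ := (AddSubmonoid.mem_closure_range_iff (f := D.root)).1 h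
  obtain ⟨g, hg⟩ := (AddSubmonoid.mem_closure_range_iff (f := D.root)).1 h'
  have hli : LinearIndependent ℕ D.root :=
    LinearIndependent.restrict_scalars' ℕ D.root_linearIndependent
  have h0 : Finsupp.linearCombination ℕ D.root (f + g) = 0 := by
    rw [map_add, Finsupp.linearCombination_apply, Finsupp.linearCombination_apply, ← hf, ← hg,
      add_neg_cancel]
  have h1 : f + g = 0 := hli (by rw [h0, map_zero])
  have h2 : f = 0 := by
    ext i
    have := DFunLike.congr_fun h1 i
    simp only [Finsupp.add_apply, Finsupp.zero_apply] at this ⊢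
    omega
  rw [hf, h2, Finsupp.sum_zero_index]

omit [FiniteDimensional ℝ V] in
theorem coroot_ne_zero (w : D.W) (i : I) : (w : V ≃ₗ[ℝ] V) (D.coroot i) ≠ 0 := fun h =>
  D.coroot_linearIndependent.ne_zero i ((w : V ≃ₗ[ℝ] V).map_eq_zero_iff.1 h)

omit [FiniteDimensional ℝ V] in
theorem root_ne_zero (w : D.W) (i : I) : D.dualAct w (D.root i) ≠ 0 := by
  intro h
  have h1 := congrArg (D.dualAct w⁻¹) h
  rw [← dualAct_mul, inv_mul_cancel, dualAct_one] at h1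
  exact D.root_linearIndependent.ne_zero i h1

theorem lt_of_coroot_pos {w : D.W} {i : I} (h : (w : V ≃ₗ[ℝ] V) (D.coroot i) ∈ D.Qpos) :
    D.length w < D.length (w * D.r i) := by
  by_contra hlt
  have h' := D.length_mul_r_of_not_lt hlt
  exact D.coroot_ne_zero w i (D.Qpos_antisymm h (D.coroot_neg (by omega)))

theorem lt_of_root_pos {w : D.W} {i : I}
    (h : D.dualAct w (D.root i) ∈ AddSubmonoid.closure (Set.range D.root)) :
    D.length w < D.length (w * D.r i) := by
  by_contra hlt
  have h' := D.length_mul_r_of_not_lt hlt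
  exact D.root_ne_zero w i (D.posCone_antisymm h (D.root_neg (by omega)))

/-! ### Matsumoto's theorem -/

/-- The value at `w` of the multiplicative extension of `f : I → M` along a reduced word. -/
def ext {M : Type*} [Monoid M] (f : I → M) (w : D.W) : M := ((D.reducedWord w).map f).prod

omit [FiniteDimensional ℝ V] in
theorem reducedWord_length (w : D.W) : (D.reducedWord w).length = D.length w :=
  (D.exists_reduced w).choose_spec.1

omit [FiniteDimensional ℝ V] in
theorem wordProd_reducedWord (w : D.W) : D.wordProd (D.reducedWord w) = w :=
  (D.exists_reduced w).choose_spec.2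

/-- If `w` has two descents, it ends in the longest element of the dihedral group. -/
theorem exists_eq_mul_alt {w : D.W} {i j : I} (hij : i ≠ j)
    (hi : D.length (w * D.r i) < D.length w) (hj : D.length (w * D.r j) < D.length w) :
    D.bondOrder i j ≠ 0 ∧ ∃ v : D.W, w = v * D.wordProd (alt i j (D.bondOrder i j)) ∧
      D.length w = D.length v + D.bondOrder i j := by
  have key : ∀ {i j : I} (v : D.W) (k : ℕ), i ≠ j → D.length (w * D.r i) < D.length w →
      D.length v < D.length (v * D.r i) → D.length v < D.length (v * D.r j) →
      w = v * D.wordProd (alt i j k) → D.length w = D.length v + k →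
      D.bondOrder i j ≠ 0 ∧ k = D.bondOrder i j := by
    intro i j v k hij hi hvi hvj hw hl
    have h1 : ¬ (D.bondOrder i j = 0 ∨ k < D.bondOrder i j) := by
      intro hk
      obtain ⟨p, q, -, -, hpq⟩ := D.act_alt_pos D.vecHom D.coroot (fun i j => D.cartan j i)
        D.vecHom_r D.cartan_diag (fun i j hij => D.cartan_nonpos j i hij.symm)
        (fun i j => D.cartan_zero j i) (fun _ _ => mul_comm _ _) hij k hk
      have h2 : (w : V ≃ₗ[ℝ] V) (D.coroot i) ∈ D.Qpos := by
        rw [hw, coe_mul_apply, ← vecHom_apply D (D.wordProd _), hpq, map_add, map_nsmul, map_nsmul]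
        exact add_mem (nsmul_mem (D.coroot_pos hvi) _) (nsmul_mem (D.coroot_pos hvj) _)
      have := D.lt_of_coroot_pos h2
      omega
    push Not at h1
    refine ⟨h1.1, le_antisymm ?_ h1.2⟩
    by_contra hcon
    push Not at hcon
    obtain ⟨n, rfl⟩ := Nat.exists_eq_succ_of_ne_zero (n := k) (by omega)
    have hb := D.bondOrder_comm i j
    have h3 := D.length_alt_mul_r hij.symm (k := n) (by omega) (by omega)
    rw [hw, alt, wordProd_concat] at hl
    have h4 := D.length_mul_le v (D.wordProd (alt j i n) * D.r j)
    omega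
  obtain ⟨v, x, hx, hw, hlen, hvi, hvj⟩ := D.exists_coset_decomp i j w
  have hred : D.length (D.wordProd x) = x.length := by
    have h2 := D.length_mul_le v (D.wordProd x)
    have h3 := D.length_wordProd_le x
    rw [← hw] at h2; omega
  rcases D.eq_alt_of_reduced x hx hred with h' | h'
  · rw [h'] at hw
    obtain ⟨h0, hk⟩ := key v _ hij hi hvi hvj hw hlen
    exact ⟨h0, v, by rw [← hk]; exact hw, by rw [← hk]; exact hlen⟩
  · rw [h'] at hw
    obtain ⟨h0, hk⟩ := key v _ hij.symm hj hvj hvi hw hlen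
    rw [bondOrder_comm] at h0 hk
    exact ⟨h0, v, by rw [D.wordProd_alt_bondOrder hij, ← hk]; exact hw, by rw [← hk]; exact hlen⟩

/-- Matsumoto's theorem: for a map to a monoid satisfying the braid relations, the product along a
reduced word depends only on the element of the Weyl group. -/
theorem map_prod_eq_of_reduced {M : Type*} [Monoid M] (f : I → M)
    (hf : ∀ i j, i ≠ j → ((alt i j (D.bondOrder i j)).map f).prod
      = ((alt j i (D.bondOrder i j)).map f).prod) (l l' : List I)
    (hl : D.length (D.wordProd l) = l.length) (hl' : D.length (D.wordProd l') = l'.length)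
    (h : D.wordProd l = D.wordProd l') : (l.map f).prod = (l'.map f).prod := by
  induction hn : l.length using Nat.strong_induction_on generalizing l l' with
  | _ n ih =>
    subst hn
    have hred : ∀ (x : List I) (k : I), D.length (D.wordProd (x ++ [k])) = (x ++ [k]).length →
        D.length (D.wordProd x) = x.length ∧
          D.length (D.wordProd (x ++ [k]) * D.r k) < D.length (D.wordProd (x ++ [k])) := by
      intro x k hx
      have h1 := D.length_mul_le (D.wordProd x) (D.r k)
      rw [wordProd_concat, mul_r_mul_r]
      rw [wordProd_concat, List.length_append, List.length_singleton] at hx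
      have := D.length_r_le k
      have := D.length_wordProd_le x
      omega
    rcases List.eq_nil_or_concat l with rfl | ⟨x, i, rfl⟩
    · have : l' = [] := by
        rw [← List.length_eq_zero_iff, ← hl', ← h]; simp
      rw [this]
    rcases List.eq_nil_or_concat l' with rfl | ⟨x', j, rfl⟩
    · exfalso
      rw [h] at hl
      simp at hl
    rw [List.concat_eq_append] at *
    rw [List.concat_eq_append] at *
    obtain ⟨hx, hxi⟩ := hred x i hl
    obtain ⟨hx', hxj⟩ := hred x' j hl'
    have hlen : x.length = x'.length := by
      have := hl.symm.trans ((congrArg D.length h).trans hl')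
      simpa using this
    by_cases hij : i = j
    · subst hij
      have h1 : D.wordProd x = D.wordProd x' := by
        rw [wordProd_concat, wordProd_concat] at h
        exact mul_right_cancel h
      rw [List.map_append, List.map_append, List.prod_append, List.prod_append,
        ih x.length (by simp) x x' hx hx' h1 rfl]
    · rw [← h] at hxj
      obtain ⟨h0, v, hv, hvl⟩ := D.exists_eq_mul_alt hij hxi hxj
      obtain ⟨m, hm⟩ := Nat.exists_eq_succ_of_ne_zero h0
      set lv := D.reducedWord v with hlv
      have hlvl : lv.length = D.length v := D.reducedWord_length v
      have hlvp : D.wordProd lv = v := D.wordProd_reducedWord v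
      -- both words are compared with a word ending in the longest element of the dihedral group
      have side : ∀ (y : List I) (i j : I), i ≠ j → D.bondOrder i j = m + 1 →
          D.length (D.wordProd y) = y.length → y.length = x.length →
          D.wordProd (y ++ [j]) = v * D.wordProd (alt i j (m + 1)) →
          D.length (D.wordProd (y ++ [j])) = D.length v + (m + 1) →
          ((y ++ [j]).map f).prod = (lv.map f).prod * ((alt i j (m + 1)).map f).prod := by
        intro y i j hij hb hy hyx he hel
        have e1 : D.wordProd y = D.wordProd (lv ++ alt j i m) := by
          rw [wordProd_concat, alt, wordProd_concat, ← mul_assoc] at he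
          rw [wordProd_append, hlvp]
          exact mul_right_cancel he
        have e2 : D.length (D.wordProd (lv ++ alt j i m)) = (lv ++ alt j i m).length := by
          have h5 := D.length_mul_le (D.wordProd y) (D.r j)
          have h6 := D.length_r_le j
          have h7 := D.length_wordProd_le (lv ++ alt j i m)
          rw [wordProd_concat] at hel
          rw [← e1] at h7 ⊢
          rw [List.length_append, hlvl, alt_length] at h7 ⊢
          omega
        have e3 := ih y.length (by rw [hyx]; simp) y _ hy e2 e1 rfl
        rw [alt, List.map_append, List.map_append, List.prod_append, List.prod_append, e3,
          List.map_append, List.prod_append, mul_assoc]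
      rw [hm] at hv hvl
      have hbr := D.wordProd_alt_bondOrder hij
      have hb := D.bondOrder_comm i j
      have hf' := hf i j hij
      rw [hm] at hbr hf'
      rw [side x' i j hij hm hx' hlen.symm (by rw [← h, hv]) (by rw [← h, hvl]),
        side x j i (Ne.symm hij) (by rw [← hb, hm]) hx rfl (by rw [hv, hbr]) hvl, hf']

end FiniteDim

/-! ### Real roots and their coroots -/

theorem eq_nsmul_of_add_eq_smul {M : Type*} [AddCommGroup M] [Module ℝ M] {e : I → M}
    (he : LinearIndependent ℝ e) {x y : M} (hx : x ∈ AddSubmonoid.closure (Set.range e))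
    (hy : y ∈ AddSubmonoid.closure (Set.range e)) {j : I} {c : ℝ} (h : x + y = c • e j) :
    ∃ n : ℕ, x = n • e j := by
  classical
  obtain ⟨f, rfl⟩ := (AddSubmonoid.mem_closure_range_iff (f := e)).1 hx
  obtain ⟨g, rfl⟩ := (AddSubmonoid.mem_closure_range_iff (f := e)).1 hy
  let toR : (I →₀ ℕ) → (I →₀ ℝ) := fun f => f.mapRange (Nat.cast) Nat.cast_zero
  have hR : ∀ f : I →₀ ℕ, (f.sum fun i n => n • e i) = Finsupp.linearCombination ℝ e (toR f) := by
    intro f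
    rw [Finsupp.linearCombination_apply, Finsupp.sum_mapRange_index (by simp)]
    exact Finsupp.sum_congr fun i _ => (Nat.cast_smul_eq_nsmul ℝ _ _).symm
  rw [hR, hR, ← map_add, ← Finsupp.linearCombination_single] at h
  have h1 := he h
  refine ⟨f j, ?_⟩
  have hf : f = Finsupp.single j (f j) := by
    ext k
    by_cases hk : k = j
    · subst hk; simp
    · have h2 := DFunLike.congr_fun h1 k
      have h3 : (f k : ℝ) + (g k : ℝ) = 0 := by
        simpa [toR, Finsupp.single_apply, Ne.symm hk] using h2
      have h4 : f k + g k = 0 := by exact_mod_cast h3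
      rw [Finsupp.single_apply, if_neg (Ne.symm hk)]
      omega
  conv_lhs => rw [hf]
  exact Finsupp.sum_single_index (zero_smul ℕ _)

theorem dualAct_coroot (w : D.W) (a : Module.Dual ℝ V) (v : V) :
    D.dualAct w a ((w : V ≃ₗ[ℝ] V) v) = a v := by
  rw [dualAct_apply, ← coe_mul_apply, inv_mul_cancel]
  rfl

theorem dualAct_r_apply (i : I) (a : Module.Dual ℝ V) :
    D.dualAct (D.r i) a = a - a (D.coroot i) • D.root i := by
  ext v
  rw [dualAct_apply, r_inv, r_apply, map_sub, map_smul]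
  simp [mul_comm]

section FiniteDim

variable [FiniteDimensional ℝ V]

/-- A simple reflection `r_i` maps only one positive real root to a negative one, namely `α_i`. -/
theorem eq_simple_of_r_neg {w : D.W} {i j : I} (h : D.length w < D.length (w * D.r j))
    (h' : D.length (D.r i * w * D.r j) < D.length (D.r i * w)) :
    (w : V ≃ₗ[ℝ] V) (D.coroot j) = D.coroot i ∧ D.dualAct w (D.root j) = D.root i := by
  have hc := D.coroot_neg h'
  have hr := D.root_neg h'
  rw [coe_mul_apply, r_apply] at hc
  rw [dualAct_mul, dualAct_r_apply] at hr
  obtain ⟨n, hn⟩ := eq_nsmul_of_add_eq_smul D.coroot_linearIndependent (D.coroot_pos h) hc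
    (j := i) (by rw [neg_sub, add_sub_cancel])
  obtain ⟨m, hm⟩ := eq_nsmul_of_add_eq_smul D.root_linearIndependent (D.root_pos h) hr
    (j := i) (by rw [neg_sub, add_sub_cancel])
  have h2 := D.dualAct_coroot w (D.root j) (D.coroot j)
  rw [hn, hm, root_coroot_self] at h2
  have h3 : m * (n * 2) = 2 := by
    have : (m : ℝ) * (n * 2) = 2 := by
      simpa [root_coroot_self] using h2
    exact_mod_cast this
  have h4 : m * n = 1 := by linarith
  rw [mul_eq_one] at h4
  rw [hn, hm, h4.1, h4.2, one_smul, one_smul]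
  exact ⟨rfl, rfl⟩

theorem coroot_eq_of_root_eq {u : D.W} {i j : I} (h : D.dualAct u (D.root i) = D.root j) :
    (u : V ≃ₗ[ℝ] V) (D.coroot i) = D.coroot j := by
  have h1 : D.length u < D.length (u * D.r i) :=
    D.lt_of_root_pos (by rw [h]; exact AddSubmonoid.subset_closure ⟨j, rfl⟩)
  refine (D.eq_simple_of_r_neg h1 ?_).1
  by_contra hcon
  rcases D.length_mul_r (D.r j * u) i with h2 | h2
  · have h3 := D.root_pos (w := D.r j * u) (i := i) (by omega)
    rw [dualAct_mul, h] at h3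
    have h4 := D.root_neg_of_mul_r 1 j
    rw [one_mul, dualAct_one] at h4
    rw [h4] at h3
    exact D.root_linearIndependent.ne_zero j
      (D.posCone_antisymm (AddSubmonoid.subset_closure ⟨j, rfl⟩) h3)
  · omega

theorem root_eq_of_coroot_eq {u : D.W} {i j : I}
    (h : (u : V ≃ₗ[ℝ] V) (D.coroot i) = D.coroot j) : D.dualAct u (D.root i) = D.root j := by
  have h1 : D.length u < D.length (u * D.r i) :=
    D.lt_of_coroot_pos (by rw [h]; exact AddSubmonoid.subset_closure ⟨j, rfl⟩)
  refine (D.eq_simple_of_r_neg h1 ?_).2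
  by_contra hcon
  rcases D.length_mul_r (D.r j * u) i with h2 | h2
  · have h3 := D.coroot_pos (w := D.r j * u) (i := i) (by omega)
    rw [coe_mul_apply, h] at h3
    have h4 := D.coroot_neg_of_mul_r 1 j
    rw [one_mul] at h4
    rw [h4] at h3
    exact D.coroot_linearIndependent.ne_zero j
      (D.Qpos_antisymm (AddSubmonoid.subset_closure ⟨j, rfl⟩) h3)
  · omega

/-- Simple roots in the same orbit of the Weyl group have the same parameters: by induction on the
length, such a conjugacy is a chain of simple bonds. -/
theorem par_eq_of_root_eq {u : D.W} {i j : I} (h : D.dualAct u (D.root i) = D.root j) :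
    D.par i = D.par j ∧ D.par' i = D.par' j := by
  induction hn : D.length u using Nat.strong_induction_on generalizing u i with
  | _ n ih =>
    subst hn
    by_cases h1 : u = 1
    · subst h1
      rw [dualAct_one] at h
      rw [D.root_linearIndependent.injective h]
      exact ⟨rfl, rfl⟩
    have hlt : D.length u < D.length (u * D.r i) :=
      D.lt_of_root_pos (by rw [h]; exact AddSubmonoid.subset_closure ⟨j, rfl⟩)
    obtain ⟨k, v, n, hik, hw, hv, hvi, hvk, hk⟩ := D.exists_eq_mul_alt_of_lt hlt h1
    obtain ⟨p, q, hq0, hp0, hpq⟩ := D.act_alt_pos D.dualHom D.root D.cartan D.dualHom_r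
      D.cartan_diag D.cartan_nonpos D.cartan_zero (fun _ _ => rfl) hik n hk
    have hj : p • D.dualAct v (D.root i) + q • D.dualAct v (D.root k) = D.root j := by
      rw [← h, hw, dualAct_mul, ← dualHom_apply D (D.wordProd _), hpq]
      simp only [← dualHom_apply, map_add, map_nsmul]
    by_cases hp : p = 0
    · obtain ⟨rfl, hb1, hb2⟩ := hp0 hp
      rw [hp, zero_smul, zero_add, one_smul] at hj
      obtain ⟨e1, e2⟩ := ih _ hv hj rfl
      obtain ⟨e3, e4, e5⟩ := D.par_bond i k hb2 hb1
      exact ⟨e3.trans e1, e4.symm.trans (e5.trans e2)⟩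
    by_cases hq : q = 0
    · rw [hq0 hq, hq, zero_smul, add_zero, one_smul] at hj
      exact ih _ hv hj rfl
    exfalso
    have c1 := nsmul_mem (D.root_pos hvi) p
    have c2 := nsmul_mem (D.root_pos hvk) q
    obtain ⟨a, ha⟩ := eq_nsmul_of_add_eq_smul D.root_linearIndependent c1 c2 (j := j) (c := 1)
      (by rw [hj, one_smul])
    obtain ⟨b, hb⟩ := eq_nsmul_of_add_eq_smul D.root_linearIndependent c2 c1 (j := j) (c := 1)
      (by rw [add_comm, hj, one_smul])
    -- both `v α_i` and `v α_k` would be multiples of `α_j`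
    have h2 : D.dualAct v ((b * p) • D.root i) = D.dualAct v ((a * q) • D.root k) := by
      simp only [← dualHom_apply, map_nsmul]
      simp only [dualHom_apply, mul_smul]
      rw [ha, hb, smul_comm]
    have h3 : (b * p) • D.root i = (a * q) • D.root k := by
      have h4 := congrArg (D.dualAct v⁻¹) h2
      rwa [← dualAct_mul, ← dualAct_mul, inv_mul_cancel, dualAct_one, dualAct_one] at h4
    have h5 : Finsupp.linearCombination ℝ D.root (Finsupp.single i ((b * p : ℕ) : ℝ))
        = Finsupp.linearCombination ℝ D.root (Finsupp.single k ((a * q : ℕ) : ℝ)) := by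
      rw [Finsupp.linearCombination_single, Finsupp.linearCombination_single,
        Nat.cast_smul_eq_nsmul, Nat.cast_smul_eq_nsmul, h3]
    have h6 : b * p = 0 := by
      classical
      have := DFunLike.congr_fun (D.root_linearIndependent h5) i
      rw [Finsupp.single_eq_same, Finsupp.single_apply, if_neg hik.symm] at this
      exact_mod_cast this
    have h7 : b = 0 := by
      rcases Nat.mul_eq_zero.1 h6 with h | h
      · exact h
      · exact absurd h hp
    rw [h7, zero_smul, smul_eq_zero] at hb
    exact hb.elim hq (D.root_ne_zero v k)

/-- The real root `w α_i`. -/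
def mkRoot (w : D.W) (i : I) : D.roots := ⟨D.dualAct w (D.root i), w, i, rfl⟩

omit [FiniteDimensional ℝ V] in
theorem eq_mkRoot_rootRep (a : D.roots) : a = D.mkRoot (D.rootRep a).1 (D.rootRep a).2 :=
  Subtype.ext (D.exists_simple a).choose_spec.symm

theorem coroot_eq_of_mkRoot_eq {w w' : D.W} {i j : I} (h : D.mkRoot w i = D.mkRoot w' j) :
    w • D.simpleCoroot i = w' • D.simpleCoroot j ∧ D.par i = D.par j ∧ D.par' i = D.par' j := by
  have h1 : D.dualAct w (D.root i) = D.dualAct w' (D.root j) := congrArg Subtype.val h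
  have h2 : D.dualAct (w'⁻¹ * w) (D.root i) = D.root j := by
    rw [dualAct_mul, h1, ← dualAct_mul, inv_mul_cancel, dualAct_one]
  refine ⟨?_, D.par_eq_of_root_eq h2⟩
  have h3 : (w'⁻¹ * w) • D.simpleCoroot i = D.simpleCoroot j :=
    Subtype.ext (D.coroot_eq_of_root_eq h2)
  rw [← h3, ← mul_smul, mul_inv_cancel_left]

theorem corootOf_mkRoot (w : D.W) (i : I) :
    D.corootOf (D.mkRoot w i) = w • D.simpleCoroot i :=
  (D.coroot_eq_of_mkRoot_eq (D.eq_mkRoot_rootRep (D.mkRoot w i))).1.symm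

theorem sigRoot_mkRoot (w : D.W) (i : I) : D.sigRoot (D.mkRoot w i) = D.sig i :=
  congrArg indet (D.coroot_eq_of_mkRoot_eq (D.eq_mkRoot_rootRep (D.mkRoot w i))).2.1.symm

theorem sigRoot'_mkRoot (w : D.W) (i : I) : D.sigRoot' (D.mkRoot w i) = D.sig' i :=
  congrArg indet (D.coroot_eq_of_mkRoot_eq (D.eq_mkRoot_rootRep (D.mkRoot w i))).2.2.symm

theorem corootOf_injective : Function.Injective D.corootOf := by
  intro a b h
  rw [D.eq_mkRoot_rootRep a, D.eq_mkRoot_rootRep b] at h ⊢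
  set w := (D.rootRep a).1
  set i := (D.rootRep a).2
  set w' := (D.rootRep b).1
  set j := (D.rootRep b).2
  rw [corootOf_mkRoot, corootOf_mkRoot] at h
  have h2 : (w'⁻¹ * w) • D.simpleCoroot i = D.simpleCoroot j := by
    rw [mul_smul, h, inv_smul_smul]
  have h3 := D.root_eq_of_coroot_eq (u := w'⁻¹ * w) (congrArg Subtype.val h2)
  refine Subtype.ext ?_
  change D.dualAct w (D.root i) = D.dualAct w' (D.root j)
  rw [← h3, ← dualAct_mul, mul_inv_cancel_left]

/-- In every direction, a real coroot is positive or negative. -/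
theorem corootOf_pos_or_neg (u : D.W) (a : D.roots) :
    ((u⁻¹ • D.corootOf a : D.Y) : V) ∈ D.Qpos ∨ -((u⁻¹ • D.corootOf a : D.Y) : V) ∈ D.Qpos := by
  rw [D.eq_mkRoot_rootRep a, corootOf_mkRoot, ← mul_smul]
  set w := u⁻¹ * (D.rootRep a).1
  rcases D.length_mul_r w (D.rootRep a).2 with h | h
  · exact Or.inl (D.coroot_pos (by omega))
  · exact Or.inr (D.coroot_neg (by omega))

theorem corootOf_posToRoot_mem (a : D.posRoots) : (D.corootOf (D.posToRoot a) : V) ∈ D.Qpos := by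
  have h := D.eq_mkRoot_rootRep (D.posToRoot a)
  rw [h, corootOf_mkRoot]
  refine D.coroot_pos (D.lt_of_root_pos ?_)
  have h' : D.dualAct (D.rootRep (D.posToRoot a)).1 (D.root (D.rootRep (D.posToRoot a)).2)
    = a.1 := (congrArg Subtype.val h).symm
  rw [h']
  exact a.2.2

/-- The positive real root `w α_i`, when `ℓ(w) < ℓ(w r_i)`. -/
def mkPosRoot (w : D.W) (i : I) (h : D.length w < D.length (w * D.r i)) : D.posRoots :=
  ⟨D.dualAct w (D.root i), ⟨w, i, rfl⟩, D.root_pos h⟩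

omit [FiniteDimensional ℝ V] in
theorem length_lt_length_one_mul_r [FiniteDimensional ℝ V] (i : I) :
    D.length (1 : D.W) < D.length (1 * D.r i) := by
  rcases D.length_mul_r 1 i with h | h
  · omega
  · rw [length_one] at h; omega

/-- The simple root `α_i` as a positive real root. -/
def simplePosRoot (i : I) : D.posRoots := D.mkPosRoot 1 i (D.length_lt_length_one_mul_r i)

theorem exists_mkPosRoot (a : D.posRoots) : ∃ w i h, a = D.mkPosRoot w i h := by
  obtain ⟨w, i, hw⟩ := a.2.1
  refine ⟨w, i, D.lt_of_root_pos (by rw [hw]; exact a.2.2), Subtype.ext hw.symm⟩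

/-- The simple reflection `r_i` permutes the positive real roots other than `α_i`. -/
theorem exists_r_smul_posRoot (i : I) (a : D.posRoots) (ha : a ≠ D.simplePosRoot i) :
    ∃ b : D.posRoots, b ≠ D.simplePosRoot i ∧ b.1 = D.dualAct (D.r i) a.1 := by
  obtain ⟨w, j, h, rfl⟩ := D.exists_mkPosRoot a
  have h1 : D.length (D.r i * w) < D.length (D.r i * w * D.r j) := by
    by_contra hcon
    have h2 := D.length_mul_r_of_not_lt hcon
    refine ha (Subtype.ext ?_)
    change D.dualAct w (D.root j) = D.dualAct 1 (D.root i)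
    rw [dualAct_one]
    exact (D.eq_simple_of_r_neg h (by omega)).2
  refine ⟨D.mkPosRoot (D.r i * w) j h1, fun hb => ?_, D.dualAct_mul _ _ _⟩
  have h3 : D.dualAct (D.r i * w) (D.root j) = D.dualAct 1 (D.root i) := congrArg Subtype.val hb
  have h4 := congrArg (D.dualAct (D.r i)) h3
  rw [dualAct_mul, ← dualAct_mul D (D.r i), r_mul_self, dualAct_one, dualAct_one] at h4
  have h5 := D.root_neg_of_mul_r 1 i
  rw [one_mul, dualAct_one] at h5
  rw [h5] at h4
  have h6 := D.root_pos h
  rw [h4] at h6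
  exact D.root_linearIndependent.ne_zero i
    (D.posCone_antisymm (AddSubmonoid.subset_closure ⟨i, rfl⟩) h6)

/-- Only finitely many positive real coroots are negative in a given direction. -/
theorem inversions_finite (u : D.W) :
    {a : D.posRoots | -((u⁻¹ • D.corootOf (D.posToRoot a) : D.Y) : V) ∈ D.Qpos}.Finite := by
  obtain ⟨l, rfl⟩ := D.exists_word u
  induction l with
  | nil =>
    refine Set.Finite.subset Set.finite_empty fun a ha => ?_
    have h1 := D.corootOf_posToRoot_mem a
    rw [Set.mem_ofPred_eq, wordProd_nil, inv_one, one_smul] at ha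
    have h2 := D.Qpos_antisymm h1 ha
    rw [D.eq_mkRoot_rootRep (D.posToRoot a), corootOf_mkRoot] at h2
    exact absurd h2 (D.coroot_ne_zero _ _)
  | cons i l ih =>
    have hfin := (ih.preimage (f := fun a : {a : D.posRoots // a ≠ D.simplePosRoot i} =>
      (D.exists_r_smul_posRoot i a.1 a.2).choose) ?_).image Subtype.val
    · refine (hfin.insert (D.simplePosRoot i)).subset fun a ha => ?_
      by_cases h : a = D.simplePosRoot i
      · exact Or.inl h
      · refine Or.inr ⟨⟨a, h⟩, ?_, rfl⟩
        have hb := (D.exists_r_smul_posRoot i a h).choose_spec.2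
        set b := (D.exists_r_smul_posRoot i a h).choose with hbdef
        change -(((D.wordProd l)⁻¹ • D.corootOf (D.posToRoot b) : D.Y) : V) ∈ D.Qpos
        have e : D.corootOf (D.posToRoot b) = D.r i • D.corootOf (D.posToRoot a) := by
          obtain ⟨w, j, h', rfl⟩ := D.exists_mkPosRoot a
          have e1 : D.posToRoot b = D.mkRoot (D.r i * w) j := by
            refine Subtype.ext ?_
            change b.1 = _
            rw [hb]
            exact (D.dualAct_mul _ _ _).symm
          have e2 : D.posToRoot (D.mkPosRoot w j h') = D.mkRoot w j := rfl
          rw [e1, e2, corootOf_mkRoot, corootOf_mkRoot, mul_smul]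
        rw [e, ← mul_smul]
        simpa only [Set.mem_ofPred_eq, wordProd_cons, mul_inv_rev, r_inv] using ha
    · intro a _ b _ hab
      have h1 := (D.exists_r_smul_posRoot i a.1 a.2).choose_spec.2
      have h2 := (D.exists_r_smul_posRoot i b.1 b.2).choose_spec.2
      rw [show (D.exists_r_smul_posRoot i a.1 a.2).choose
        = (D.exists_r_smul_posRoot i b.1 b.2).choose from hab, h2] at h1
      have h3 := congrArg (D.dualAct (D.r i)) h1
      rw [← dualAct_mul, ← dualAct_mul, r_mul_self, dualAct_one, dualAct_one] at h3
      exact Subtype.ext (Subtype.ext h3.symm)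

end FiniteDim

/-! ### Heights -/

theorem exists_height : ∃ f : V →ₗ[ℝ] ℝ, ∀ i, f (D.coroot i) = 1 := by
  obtain ⟨g, hg⟩ := LinearMap.exists_leftInverse_of_injective
    (Finsupp.linearCombination ℝ D.coroot) (LinearMap.ker_eq_bot.2 D.coroot_linearIndependent)
  refine ⟨Finsupp.linearCombination ℝ (fun _ : I => (1 : ℝ)) ∘ₗ g, fun i => ?_⟩
  have h := LinearMap.congr_fun hg (Finsupp.single i 1)
  rw [LinearMap.comp_apply, Finsupp.linearCombination_single, one_smul] at h
  rw [LinearMap.comp_apply, h]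
  simp

/-- A linear form taking the value `1` at every simple coroot. -/
def height : V →ₗ[ℝ] ℝ := D.exists_height.choose

theorem height_coroot (i : I) : D.height (D.coroot i) = 1 := D.exists_height.choose_spec i

theorem exists_nat_height {q : V} (hq : q ∈ D.Qpos) :
    ∃ n : ℕ, D.height q = n ∧ (n = 0 → q = 0) := by
  induction hq using AddSubmonoid.closure_induction with
  | mem x hx => obtain ⟨i, rfl⟩ := hx; exact ⟨1, by rw [height_coroot, Nat.cast_one], by simp⟩
  | zero => exact ⟨0, by simp, fun _ => rfl⟩
  | add x y _ _ hx hy =>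
    obtain ⟨n, hn, hn'⟩ := hx
    obtain ⟨m, hm, hm'⟩ := hy
    refine ⟨n + m, by rw [map_add, hn, hm, Nat.cast_add], fun h => ?_⟩
    rw [hn' (by omega), hm' (by omega), add_zero]

theorem finite_height_le [Finite I] (h : ℝ) : {q : V | q ∈ D.Qpos ∧ D.height q ≤ h}.Finite := by
  classical
  cases nonempty_fintype I
  have hfin : (Set.Iic (fun _ : I => ⌊h⌋₊) : Set (I → ℕ)).Finite := Set.finite_Iic _
  refine (hfin.image fun f => ∑ i, f i • D.coroot i).subset ?_
  rintro q ⟨hq, hle⟩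
  obtain ⟨f, rfl⟩ := AddSubmonoid.mem_closure_range_iff_of_fintype.1 hq
  refine ⟨f, fun i => ?_, rfl⟩
  rw [map_sum] at hle
  simp only [map_nsmul, height_coroot, nsmul_eq_mul, mul_one] at hle
  refine Nat.le_floor (le_trans ?_ hle)
  exact Finset.single_le_sum (f := fun i => (f i : ℝ)) (fun i _ => Nat.cast_nonneg _)
    (Finset.mem_univ i)

theorem one_le_height {q : V} (hq : q ∈ D.Qpos) (h0 : q ≠ 0) : 1 ≤ D.height q := by
  obtain ⟨n, hn, hn'⟩ := D.exists_nat_height hq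
  rw [hn]
  exact_mod_cast Nat.one_le_iff_ne_zero.2 fun h => h0 (hn' h)

section Filtration

/-! ### Formal series filtered by height -/

/-- `-u Q^∨_{≥ n}`, where `Q^∨_{≥ n} ⊆ Q^∨_+` consists of the elements of height at least `n`. -/
def deep (u : D.W) (n : ℕ) : Set (D.Dir u) :=
  {y | ∃ q ∈ D.Qpos, ((show D.Y from y) : V) = -((u : V ≃ₗ[ℝ] V) q) ∧ (n : ℝ) ≤ D.height q}

theorem zero_mem_deep (u : D.W) : (0 : D.Dir u) ∈ D.deep u 0 := by
  refine ⟨0, D.Qpos.zero_mem, ?_, by simp⟩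
  rw [map_zero, neg_zero]; rfl

theorem deep_mono (u : D.W) {m n : ℕ} (h : m ≤ n) : D.deep u n ⊆ D.deep u m := by
  rintro y ⟨q, hq, hy, hn⟩
  exact ⟨q, hq, hy, le_trans (by exact_mod_cast h) hn⟩

theorem deep_add (u : D.W) {m n : ℕ} {x y : D.Dir u} (hx : x ∈ D.deep u m) (hy : y ∈ D.deep u n) :
    x + y ∈ D.deep u (m + n) := by
  obtain ⟨p, hp, hx, hm⟩ := hx
  obtain ⟨q, hq, hy, hn⟩ := hy
  refine ⟨p + q, D.Qpos.add_mem hp hq, ?_, ?_⟩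
  · rw [map_add, neg_add, ← hx, ← hy]; rfl
  · rw [map_add, Nat.cast_add]; exact add_le_add hm hn

theorem exists_notMem_deep (u : D.W) (y : D.Dir u) : ∃ n, y ∉ D.deep u n := by
  obtain ⟨n, hn⟩ := exists_nat_gt (D.height (-((u⁻¹ : D.W) : V ≃ₗ[ℝ] V) (show D.Y from y)))
  refine ⟨n, ?_⟩
  rintro ⟨q, -, hy, hq⟩
  have : -((u⁻¹ : D.W) : V ≃ₗ[ℝ] V) ((show D.Y from y) : V) = q := by
    rw [hy, map_neg, neg_neg]
    exact (u : V ≃ₗ[ℝ] V).symm_apply_apply q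
  rw [this] at hn
  exact absurd hq (not_le.2 hn)

theorem deep_subset_cones (u : D.W) (n : ℕ) :
    D.deep u n ⊆ D.cones u {(0 : D.Dir u)} := by
  rintro y ⟨q, hq, hy, -⟩
  refine ⟨0, rfl, q, hq, ?_⟩
  change ((0 : D.Y) : V) - ((show D.Y from y) : V) = _
  rw [show ((show D.Y from y) : V) = _ from hy]
  simp

theorem smul_mem_deep (v u : D.W) {n : ℕ} {y : D.Y} :
    (show D.Dir u from y) ∈ D.deep u n ↔
      (show D.Dir (v⁻¹ * u) from (v⁻¹ • y : D.Y)) ∈ D.deep (v⁻¹ * u) n := by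
  refine exists_congr fun q => and_congr_right fun _ => and_congr_left fun _ => ?_
  change (y : V) = _ ↔ ((v⁻¹ : D.W) : V ≃ₗ[ℝ] V) (y : V) = _
  rw [coe_mul_apply, ← map_neg ((v⁻¹ : D.W) : V ≃ₗ[ℝ] V)]
  exact ((v⁻¹ : D.W) : V ≃ₗ[ℝ] V).injective.eq_iff.symm

/-- The additive group of the series in direction `u` with support in `-u Q^∨_{≥ n}`. -/
def cone (u : D.W) (n : ℕ) : AddSubgroup (D.Series u) where
  carrier := {F | ∀ y, F.coeff y ≠ 0 → y ∈ D.deep u n}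
  zero_mem' y hy := absurd rfl hy
  add_mem' {F G} hF hG y hy := by
    by_contra hn
    have h1 : F.coeff y = 0 := by by_contra h; exact hn (hF y h)
    have h2 : G.coeff y = 0 := by by_contra h; exact hn (hG y h)
    exact hy (by rw [HahnSeries.coeff_add, h1, h2, add_zero])
  neg_mem' {F} hF y hy := hF y fun h => hy (by
    rw [HahnSeries.coeff_neg, h, neg_zero])

theorem cone_mono (u : D.W) {m n : ℕ} (h : m ≤ n) : D.cone u n ≤ D.cone u m :=
  fun _ hF y hy => D.deep_mono u h (hF y hy)

theorem cone_le_zero {u : D.W} {n : ℕ} {F : D.Series u} (h : F ∈ D.cone u n) : F ∈ D.cone u 0 :=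
  D.cone_mono u (Nat.zero_le n) h

theorem mul_mem_cone {u : D.W} {m n : ℕ} {F G : D.Series u} (hF : F ∈ D.cone u m)
    (hG : G ∈ D.cone u n) : F * G ∈ D.cone u (m + n) := by
  intro y hy
  obtain ⟨a, ha, b, hb, hab⟩ := HahnSeries.support_mul_subset hy
  have h := D.deep_add u (hF a ha) (hG b hb)
  subst hab
  exact h

theorem mul_mem_cone_left {u : D.W} {n : ℕ} {F G : D.Series u} (hF : F ∈ D.cone u n)
    (hG : G ∈ D.cone u 0) : F * G ∈ D.cone u n := by
  have h := D.mul_mem_cone hF hG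
  rwa [add_zero] at h

theorem mul_mem_cone_right {u : D.W} {n : ℕ} {F G : D.Series u} (hF : F ∈ D.cone u 0)
    (hG : G ∈ D.cone u n) : F * G ∈ D.cone u n := by
  have h := D.mul_mem_cone hF hG
  rwa [zero_add] at h

theorem single_mem_cone {u : D.W} {n : ℕ} {y : D.Dir u} (hy : y ∈ D.deep u n) (c : Coef T) :
    (HahnSeries.single y c : D.Series u) ∈ D.cone u n := by
  intro z hz
  rw [show z = y from HahnSeries.eq_of_mem_support_single hz]
  exact hy

theorem one_mem_cone (u : D.W) : (1 : D.Series u) ∈ D.cone u 0 :=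
  D.single_mem_cone (D.zero_mem_deep u) 1

theorem prod_mem_cone {u : D.W} {ι : Type*} (s : Finset ι) (F : ι → D.Series u)
    (h : ∀ i ∈ s, F i ∈ D.cone u 0) : ∏ i ∈ s, F i ∈ D.cone u 0 :=
  Finset.prod_induction F (· ∈ D.cone u 0) (fun _ _ ha hb => D.mul_mem_cone_left ha hb)
    (D.one_mem_cone u) h

theorem pow_mem_cone {u : D.W} {F : D.Series u} (h : F ∈ D.cone u 1) (k : ℕ) :
    F ^ k ∈ D.cone u k := by
  induction k with
  | zero => exact D.one_mem_cone u
  | succ k ih =>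
    have := D.mul_mem_cone ih h
    rwa [← pow_succ] at this

theorem eq_zero_of_forall_mem_cone {u : D.W} {F : D.Series u} (h : ∀ n, F ∈ D.cone u n) :
    F = 0 := by
  refine HahnSeries.ext (funext fun y => ?_)
  obtain ⟨n, hn⟩ := D.exists_notMem_deep u y
  by_contra hy
  exact hn (h n y hy)

/-- The expansion in the direction `-uQ^∨_+`. -/
def expand (u : D.W) : D.Ambient →+* D.Series u where
  toFun F := F u
  map_one' := rfl
  map_zero' := rfl
  map_mul' _ _ := rfl
  map_add' _ _ := rfl

theorem expand_algebraMap (u : D.W) (c : Coef T) :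
    D.expand u (algebraMap (Coef T) D.Ambient c) = HahnSeries.single (0 : D.Dir u) c := rfl

theorem algebraMap_mem_cone (u : D.W) (c : Coef T) :
    D.expand u (algebraMap (Coef T) D.Ambient c) ∈ D.cone u 0 :=
  D.single_mem_cone (D.zero_mem_deep u) c

theorem smul_mem_cone {u v : D.W} {n : ℕ} {F : D.Ambient}
    (h : D.expand (v⁻¹ * u) F ∈ D.cone (v⁻¹ * u) n) : D.expand u (v • F) ∈ D.cone u n := by
  intro y hy
  exact (D.smul_mem_deep v u).2 (h _ (D.smul_coeff v u F y ▸ hy))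

/-- Convergence for the topologies which the filtrations `cone u` define on the series supported
in the cones `-uQ^∨_+`. -/
def ConeLim {ι : Type*} (l : Filter ι) (F : ι → D.Ambient) (G : D.Ambient) : Prop :=
  ∀ u, D.expand u G ∈ D.cone u 0 ∧ ∀ n, ∀ᶠ i in l, D.expand u (F i - G) ∈ D.cone u n

variable {ι : Type*} {l : Filter ι}

theorem ConeLim.expand_mem {F : ι → D.Ambient} {G : D.Ambient} (h : D.ConeLim l F G) (u : D.W) :
    ∀ᶠ i in l, D.expand u (F i) ∈ D.cone u 0 := by
  filter_upwards [(h u).2 0] with i hi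
  have := (D.cone u 0).add_mem hi (h u).1
  rwa [← map_add, sub_add_cancel] at this

theorem ConeLim.converges {F : ι → D.Ambient} {G : D.Ambient} (h : D.ConeLim l F G) :
    D.Converges l F G := by
  intro u
  refine ⟨⟨{0}, Set.finite_singleton _, ?_⟩, fun y => ?_⟩
  · filter_upwards [ConeLim.expand_mem D h u] with i hi
    exact fun y hy => D.deep_subset_cones u 0 (hi y hy)
  · obtain ⟨n, hn⟩ := D.exists_notMem_deep u y
    filter_upwards [(h u).2 n] with i hi
    by_contra hne
    refine hn (hi y fun h0 => hne ?_)
    rw [map_sub, HahnSeries.coeff_sub, sub_eq_zero] at h0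
    exact h0

theorem ConeLim.add {F F' : ι → D.Ambient} {G G' : D.Ambient} (h : D.ConeLim l F G)
    (h' : D.ConeLim l F' G') : D.ConeLim l (fun i => F i + F' i) (G + G') := by
  refine fun u => ⟨by rw [map_add]; exact (D.cone u 0).add_mem (h u).1 (h' u).1, fun n => ?_⟩
  filter_upwards [(h u).2 n, (h' u).2 n] with i hi hi'
  have := (D.cone u n).add_mem hi hi'
  rwa [← map_add, sub_add_sub_comm] at this

theorem ConeLim.mul {F F' : ι → D.Ambient} {G G' : D.Ambient} (h : D.ConeLim l F G)
    (h' : D.ConeLim l F' G') : D.ConeLim l (fun i => F i * F' i) (G * G') := by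
  refine fun u => ⟨by rw [map_mul]; exact D.mul_mem_cone_left (h u).1 (h' u).1, fun n => ?_⟩
  filter_upwards [(h u).2 n, (h' u).2 n, ConeLim.expand_mem D h' u] with i hi hi' h1
  have := (D.cone u n).add_mem (D.mul_mem_cone_left hi h1) (D.mul_mem_cone_right (h u).1 hi')
  rw [← map_mul, ← map_mul, ← map_add] at this
  have e : F i * F' i - G * G' = (F i - G) * F' i + G * (F' i - G') := by ring
  rwa [e]

theorem coneLim_const {G : D.Ambient} (h : ∀ u, D.expand u G ∈ D.cone u 0) :
    D.ConeLim l (fun _ => G) G :=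
  fun u => ⟨h u, fun n => Eventually.of_forall fun _ => by
    rw [sub_self, map_zero]; exact (D.cone u n).zero_mem⟩

theorem ConeLim.smul {F : ι → D.Ambient} {G : D.Ambient} (h : D.ConeLim l F G) (v : D.W) :
    D.ConeLim l (fun i => v • F i) (v • G) := by
  refine fun u => ⟨D.smul_mem_cone (h _).1, fun n => ?_⟩
  filter_upwards [(h (v⁻¹ * u)).2 n] with i hi
  rw [← smul_sub]
  exact D.smul_mem_cone hi

theorem ambient_eq_of_forall {G G' : D.Ambient}
    (h : ∀ u n, D.expand u (G - G') ∈ D.cone u n) : G = G' := by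
  rw [← sub_eq_zero]
  funext u
  exact D.eq_zero_of_forall_mem_cone (h u)

theorem ConeLim.unique [l.NeBot] {F : ι → D.Ambient} {G G' : D.Ambient} (h : D.ConeLim l F G)
    (h' : D.ConeLim l F G') : G = G' := by
  refine D.ambient_eq_of_forall fun u n => ?_
  obtain ⟨i, hi, hi'⟩ := (((h u).2 n).and ((h' u).2 n)).exists
  have := (D.cone u n).sub_mem hi' hi
  rwa [← map_sub, sub_sub_sub_cancel_left] at this

theorem ConeLim.congr {F F' : ι → D.Ambient} {G : D.Ambient} (h : D.ConeLim l F G)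
    (hF : ∀ᶠ i in l, F i = F' i) : D.ConeLim l F' G := by
  refine fun u => ⟨(h u).1, fun n => ?_⟩
  filter_upwards [(h u).2 n, hF] with i hi hi'
  rwa [← hi']

/-- The series supported in the cones `-uQ^∨_+` are complete. -/
theorem exists_coneLim [Finite I] [l.NeBot] {F : ι → D.Ambient}
    (h0 : ∀ u, ∀ᶠ i in l, D.expand u (F i) ∈ D.cone u 0)
    (h : ∀ u n, ∃ s ∈ l, ∀ i ∈ s, ∀ j ∈ s, D.expand u (F i - F j) ∈ D.cone u n) :
    ∃ G, D.ConeLim l F G := by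
  have hev : ∀ u (y : D.Dir u), ∃ a : Coef T, ∀ᶠ i in l, (D.expand u (F i)).coeff y = a := by
    intro u y
    obtain ⟨n, hn⟩ := D.exists_notMem_deep u y
    obtain ⟨s, hs, hF⟩ := h u n
    obtain ⟨j, hj⟩ := l.nonempty_of_mem hs
    refine ⟨(D.expand u (F j)).coeff y, ?_⟩
    filter_upwards [hs] with i hi
    by_contra hne
    refine hn (hF i hi j hj y fun h0 => hne ?_)
    rw [map_sub, HahnSeries.coeff_sub, sub_eq_zero] at h0
    exact h0
  choose a ha using hev
  have hsupp : ∀ u (y : D.Dir u), a u y ≠ 0 → y ∈ D.deep u 0 := by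
    intro u y hy
    obtain ⟨i, hi, hi'⟩ := ((h0 u).and (ha u y)).exists
    exact hi y (by rw [hi']; exact hy)
  let G : D.Ambient := fun u =>
    { coeff := fun y => a u y
      isPWO_support' := (D.cones_isPWO u (Set.finite_singleton 0)).mono fun y hy =>
        D.deep_subset_cones u 0 (hsupp u y hy) }
  have hG : ∀ u (y : D.Dir u), (D.expand u G).coeff y = a u y := fun _ _ => rfl
  refine ⟨G, fun u => ⟨fun y hy => hsupp u y hy, fun n => ?_⟩⟩
  obtain ⟨s, hs, hF⟩ := h u n
  filter_upwards [hs] with i hi y hy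
  obtain ⟨j, hj, hj'⟩ := ((eventually_mem_set.2 hs).and (ha u y)).exists
  refine hF i hi j hj y ?_
  rw [map_sub, HahnSeries.coeff_sub] at hy ⊢
  rwa [hj', ← hG]

/-- `∑ F^k` converges if the terms of `F` have positive height. -/
theorem exists_geom_coneLim [Finite I] {F : D.Ambient} (h : ∀ u, D.expand u F ∈ D.cone u 1) :
    ∃ G, D.ConeLim atTop (fun N : ℕ => ∑ k ∈ Finset.range N, F ^ k) G ∧ (1 - F) * G = 1 := by
  have hpow : ∀ u k, D.expand u (F ^ k) ∈ D.cone u k := fun u k => by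
    rw [map_pow]; exact D.pow_mem_cone (h u) k
  obtain ⟨G, hG⟩ := D.exists_coneLim (l := atTop)
      (F := fun N : ℕ => ∑ k ∈ Finset.range N, F ^ k) (fun u => Eventually.of_forall fun N => by
        rw [map_sum]
        exact sum_mem fun k _ => D.cone_le_zero (hpow u k)) (fun u n => by
      refine ⟨Set.Ici n, mem_atTop n, ?_⟩
      have key : ∀ i, n ≤ i → D.expand u (∑ k ∈ Finset.range i, F ^ k -
          ∑ k ∈ Finset.range n, F ^ k) ∈ D.cone u n := by
        intro i hi
        rw [← Finset.sum_sdiff (Finset.range_mono hi), add_sub_cancel_right, map_sum]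
        refine sum_mem fun k hk => D.cone_mono u ?_ (hpow u k)
        simp only [Finset.mem_sdiff, Finset.mem_range, not_lt] at hk
        exact hk.2
      intro i hi j hj
      have := (D.cone u n).sub_mem (key i hi) (key j hj)
      rwa [← map_sub, sub_sub_sub_cancel_right] at this)
  refine ⟨G, hG, ?_⟩
  have h1 : ∀ u, D.expand u (1 - F) ∈ D.cone u 0 := fun u => by
    rw [map_sub, map_one]
    exact (D.cone u 0).sub_mem (D.one_mem_cone u) (D.cone_le_zero (h u))
  refine ConeLim.unique D (ConeLim.mul D (D.coneLim_const h1) hG) ?_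
  refine fun u => ⟨by rw [map_one]; exact D.one_mem_cone u, fun n => ?_⟩
  filter_upwards [eventually_ge_atTop n] with N hN
  rw [mul_neg_geom_sum, sub_sub_cancel_left, map_neg]
  exact (D.cone u n).neg_mem (D.cone_mono u hN (hpow u N))

/-- `1 - F` is invertible if the terms of `F` have positive height. -/
theorem exists_mul_eq_one [Finite I] {u : D.W} {F : D.Series u} (h : F ∈ D.cone u 1) :
    ∃ G ∈ D.cone u 0, (1 - F) * G = 1 := by
  classical
  let F' : D.Ambient := Pi.single (M := fun u => D.Series u) u F
  have hu : D.expand u F' = F := Pi.single_eq_same (M := fun u => D.Series u) u F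
  obtain ⟨G, hG, h1⟩ := D.exists_geom_coneLim (F := F') (by
    intro v
    by_cases hv : v = u
    · subst hv; rw [hu]; exact h
    · have : D.expand v F' = 0 := Pi.single_eq_of_ne (M := fun u => D.Series u) hv F
      rw [this]; exact (D.cone v 1).zero_mem)
  refine ⟨D.expand u G, (hG u).1, ?_⟩
  have := congrArg (D.expand u) h1
  rwa [map_mul, map_sub, map_one, hu] at this

end Filtration

section Functions

/-! ### The functions `b` and `c` -/

/-- In every direction, `e^y` or `e^{-y}` has positive height. -/
def Regular (y : D.Y) : Prop :=
  ∀ u, (show D.Dir u from y) ∈ D.deep u 1 ∨ (show D.Dir u from -y) ∈ D.deep u 1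

variable {D}

theorem Regular.neg {y : D.Y} (h : D.Regular y) : D.Regular (-y) := fun u => by
  rw [neg_neg]; exact (h u).symm

theorem Regular.smul {y : D.Y} (h : D.Regular y) (v : D.W) : D.Regular (v • y) := fun u => by
  rw [D.smul_mem_deep v u, D.smul_mem_deep v u, ← smul_neg, inv_smul_smul, inv_smul_smul]
  exact h _

variable (D)

theorem mem_deep_of_neg {u : D.W} {n : ℕ} {y : D.Y}
    (h : -((u⁻¹ • y : D.Y) : V) ∈ D.Qpos) (hn : (n : ℝ) ≤ D.height (-((u⁻¹ • y : D.Y) : V))) :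
    (show D.Dir u from y) ∈ D.deep u n := by
  refine ⟨_, h, ?_, hn⟩
  rw [map_neg, neg_neg, ← coe_smul_Y, smul_inv_smul]

theorem regular_corootOf [FiniteDimensional ℝ V] (a : D.roots) : D.Regular (D.corootOf a) := by
  have h0 : ∀ u : D.W, ((u⁻¹ • D.corootOf a : D.Y) : V) ≠ 0 := by
    intro u
    rw [corootOf, ← mul_smul]
    exact D.coroot_ne_zero _ _
  intro u
  rcases D.corootOf_pos_or_neg u a with h | h
  · right
    have h1 : -((u⁻¹ • (-D.corootOf a) : D.Y) : V) = ((u⁻¹ • D.corootOf a : D.Y) : V) := by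
      rw [smul_neg, AddSubgroup.coe_neg, neg_neg]
    refine D.mem_deep_of_neg (by rwa [h1]) ?_
    rw [h1, Nat.cast_one]
    exact D.one_le_height h (h0 u)
  · left
    refine D.mem_deep_of_neg h ?_
    rw [Nat.cast_one]
    exact D.one_le_height h (neg_ne_zero.2 (h0 u))

theorem regular_simpleCoroot [FiniteDimensional ℝ V] (i : I) : D.Regular (D.simpleCoroot i) := by
  have h := D.regular_corootOf (D.mkRoot 1 i)
  rwa [corootOf_mkRoot, one_smul] at h

theorem expand_mono (u : D.W) (y : D.Y) :
    D.expand u (D.mono y) = HahnSeries.single (show D.Dir u from y) 1 := rfl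

theorem expand_mono_mem {u : D.W} {y : D.Y} {n : ℕ} (h : (show D.Dir u from y) ∈ D.deep u n) :
    D.expand u (D.mono y) ∈ D.cone u n := D.single_mem_cone h 1

theorem mono_zero : D.mono 0 = 1 := rfl

theorem mono_add (x y : D.Y) : D.mono (x + y) = D.mono x * D.mono y := by
  funext u
  exact (HahnSeries.single_mul_single.trans (by rw [mul_one]; rfl)).symm

theorem mono_two_smul (y : D.Y) : D.mono (2 • y) = D.mono y ^ 2 := by
  rw [two_nsmul, mono_add, sq]

theorem mono_mul_neg (y : D.Y) : D.mono y * D.mono (-y) = 1 := by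
  rw [← mono_add, add_neg_cancel, mono_zero]

theorem smul_mono (v : D.W) (y : D.Y) : v • D.mono y = D.mono (v • y) := by
  funext u
  refine (HahnSeries.embDomain_single (f := ⟨⟨D.moveDir v u, D.moveDir_injective v u⟩,
    D.moveDir_le v u _ _⟩)).trans rfl

theorem smul_algebraMap' (v : D.W) (c : Coef T) :
    v • algebraMap (Coef T) D.Ambient c = algebraMap (Coef T) D.Ambient c := by
  rw [Algebra.algebraMap_eq_smul_one, smul_comm, smul_one]

theorem isUnit_of_expand {F : D.Ambient} (h : ∀ u, ∃ G, D.expand u F * G = 1) : IsUnit F := by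
  choose G hG using h
  exact IsUnit.of_mul_eq_one (show D.Ambient from G) (funext hG)

theorem expand_inverse {F : D.Ambient} (hF : IsUnit F) {u : D.W} {G : D.Series u}
    (h : D.expand u F * G = 1) : D.expand u (Ring.inverse F) = G := by
  have h1 : D.expand u F * D.expand u (Ring.inverse F) = 1 := by
    rw [← map_mul, Ring.mul_inverse_cancel F hF, map_one]
  exact (left_inv_eq_right_inv (by rw [mul_comm]; exact h1) h)

theorem isUnit_one_sub_mono [Finite I] {y : D.Y} (h : D.Regular y) : IsUnit (1 - D.mono y) := by
  refine D.isUnit_of_expand fun u => ?_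
  rcases h u with hu | hu
  · obtain ⟨G, -, hG⟩ := D.exists_mul_eq_one (D.expand_mono_mem hu)
    exact ⟨G, by rw [map_sub, map_one]; exact hG⟩
  · obtain ⟨G, -, hG⟩ := D.exists_mul_eq_one (D.expand_mono_mem hu)
    refine ⟨-(D.expand u (D.mono (-y)) * G), ?_⟩
    have h1 := congrArg (D.expand u) (D.mono_mul_neg y)
    rw [map_mul, map_one] at h1
    rw [map_sub, map_one]
    linear_combination hG + G * h1

theorem regular_two_smul {y : D.Y} (h : D.Regular y) : D.Regular (2 • y) := fun u => by
  rw [two_nsmul, neg_add]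
  exact (h u).imp (fun h => D.deep_mono u (by norm_num) (D.deep_add u h h))
    (fun h => D.deep_mono u (by norm_num) (D.deep_add u h h))

theorem bFun_mul [Finite I] (t u : (Coef T)ˣ) {y : D.Y} (h : D.Regular y) :
    D.bFun t u y * (1 - D.mono y ^ 2) =
      algebraMap (Coef T) D.Ambient ((t : Coef T) - (t⁻¹ : (Coef T)ˣ)) +
        algebraMap (Coef T) D.Ambient ((u : Coef T) - (u⁻¹ : (Coef T)ˣ)) * D.mono y := by
  rw [bFun, mul_assoc, ← mono_two_smul,
    Ring.inverse_mul_cancel _ (D.isUnit_one_sub_mono (D.regular_two_smul h)), mul_one]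

theorem isUnit_one_sub_sq [Finite I] {y : D.Y} (h : D.Regular y) : IsUnit (1 - D.mono y ^ 2) := by
  rw [← mono_two_smul]
  exact D.isUnit_one_sub_mono (D.regular_two_smul h)

theorem bFun_add_neg [Finite I] (t u : (Coef T)ˣ) {y : D.Y} (h : D.Regular y) :
    D.bFun t u y + D.bFun t u (-y) =
      algebraMap (Coef T) D.Ambient ((t : Coef T) - (t⁻¹ : (Coef T)ˣ)) := by
  refine ((D.isUnit_one_sub_sq h).mul (D.isUnit_one_sub_sq h.neg)).mul_right_cancel ?_
  have h1 := D.bFun_mul t u h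
  have h2 := D.bFun_mul t u h.neg
  have h3 := D.mono_mul_neg y
  set k := algebraMap (Coef T) D.Ambient ((t : Coef T) - (t⁻¹ : (Coef T)ˣ))
  set k' := algebraMap (Coef T) D.Ambient ((u : Coef T) - (u⁻¹ : (Coef T)ˣ))
  set z := D.mono y
  set z' := D.mono (-y)
  linear_combination (1 - z' ^ 2) * h1 + (1 - z ^ 2) * h2 - (k * z * z' + k  + k' * z + k' * z') *
    h3

theorem smul_bFun [Finite I] (v : D.W) (t u : (Coef T)ˣ) {y : D.Y} (h : D.Regular y) :
    v • D.bFun t u y = D.bFun t u (v • y) := by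
  refine (D.isUnit_one_sub_sq (h.smul v)).mul_right_cancel ?_
  have e := congrArg (v • ·) (D.bFun_mul t u h)
  simp only [smul_mul', smul_sub, smul_one, smul_pow', smul_add, smul_algebraMap', smul_mono] at e
  rw [e, D.bFun_mul t u (h.smul v)]

theorem expand_bFun_sub_mem [Finite I] (t t' : (Coef T)ˣ) {y : D.Y} (h : D.Regular y) {u : D.W} {n :
    ℕ}
    (hn : 1 ≤ n) (hu : (show D.Dir u from y) ∈ D.deep u n) :
    D.expand u (D.bFun t t' y - algebraMap (Coef T) D.Ambient
      ((t : Coef T) - (t⁻¹ : (Coef T)ˣ))) ∈ D.cone u n := by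
  have hu1 := D.deep_mono u hn hu
  have hu2 : (show D.Dir u from (2 • y : D.Y)) ∈ D.deep u 1 := by
    have h := D.deep_mono u (show 1 ≤ 1 + 1 by norm_num) (D.deep_add u hu1 hu1)
    rw [two_nsmul y]
    exact h
  have hz := D.expand_mono_mem hu
  obtain ⟨G, hG, hG'⟩ := D.exists_mul_eq_one (D.expand_mono_mem hu2)
  have hR := D.expand_inverse (D.isUnit_one_sub_mono (D.regular_two_smul h)) (u := u) (G := G)
    (by rw [map_sub, map_one]; exact hG')
  have e : D.bFun t t' y - algebraMap (Coef T) D.Ambient ((t : Coef T) - (t⁻¹ : (Coef T)ˣ)) =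
      D.mono y * ((algebraMap (Coef T) D.Ambient ((t' : Coef T) - (t'⁻¹ : (Coef T)ˣ)) +
        algebraMap (Coef T) D.Ambient ((t : Coef T) - (t⁻¹ : (Coef T)ˣ)) * D.mono y) *
        Ring.inverse (1 - D.mono (2 • y))) := by
    rw [bFun]
    have h1 := Ring.inverse_mul_cancel _ (D.isUnit_one_sub_mono (D.regular_two_smul h))
    rw [mono_two_smul] at h1 ⊢
    linear_combination algebraMap (Coef T) D.Ambient ((t : Coef T) - (t⁻¹ : (Coef T)ˣ)) * h1
  rw [e, map_mul]
  refine D.mul_mem_cone_left hz ?_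
  rw [map_mul, hR]
  refine D.mul_mem_cone_left ?_ hG
  rw [map_add, map_mul]
  exact (D.cone u 0).add_mem (D.algebraMap_mem_cone u _)
    (D.mul_mem_cone_left (D.algebraMap_mem_cone u _) (D.cone_le_zero hz))

theorem expand_bFun_mem [Finite I] (t t' : (Coef T)ˣ) {y : D.Y} (h : D.Regular y) {u : D.W} {n : ℕ}
    (hn : 1 ≤ n) (hu : (show D.Dir u from -y) ∈ D.deep u n) :
    D.expand u (D.bFun t t' y) ∈ D.cone u n := by
  have h1 := D.expand_bFun_sub_mem t t' h.neg hn hu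
  rw [← D.bFun_add_neg t t' h, sub_add_cancel_right, map_neg] at h1
  exact (D.cone u n).neg_mem_iff.1 h1

theorem expand_bFun_mem_zero [Finite I] (t t' : (Coef T)ˣ) {y : D.Y} (h : D.Regular y) (u : D.W) :
    D.expand u (D.bFun t t' y) ∈ D.cone u 0 := by
  rcases h u with hu | hu
  · have h1 := (D.cone u 0).add_mem (D.cone_le_zero (D.expand_bFun_sub_mem t t' h le_rfl hu))
      (D.algebraMap_mem_cone u ((t : Coef T) - (t⁻¹ : (Coef T)ˣ)))
    rwa [← map_add, sub_add_cancel] at h1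
  · exact D.cone_le_zero (D.expand_bFun_mem t t' h le_rfl hu)

theorem smul_cFun [Finite I] (v : D.W) (t u : (Coef T)ˣ) {y : D.Y} (h : D.Regular y) :
    v • D.cFun t u y = D.cFun t u (v • y) := by
  rw [cFun, cFun, smul_sub, smul_algebraMap', D.smul_bFun v t u h]

theorem cFun_neg [Finite I] (t u : (Coef T)ˣ) {y : D.Y} (h : D.Regular y) :
    D.cFun t u (-y) = algebraMap (Coef T) D.Ambient (t⁻¹ : (Coef T)ˣ) + D.bFun t u y := by
  have h1 := D.bFun_add_neg t u h
  rw [map_sub] at h1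
  rw [cFun]
  linear_combination -h1

theorem cFun_add_neg [Finite I] (t u : (Coef T)ˣ) {y : D.Y} (h : D.Regular y) :
    D.cFun t u y + D.cFun t u (-y) =
      algebraMap (Coef T) D.Ambient ((t : Coef T) + (t⁻¹ : (Coef T)ˣ)) := by
  rw [D.cFun_neg t u h, cFun, map_add]; ring

theorem expand_cFun_mem_zero [Finite I] (t t' : (Coef T)ˣ) {y : D.Y} (h : D.Regular y) (u : D.W) :
    D.expand u (D.cFun t t' y) ∈ D.cone u 0 := by
  rw [cFun, map_sub]
  exact (D.cone u 0).sub_mem (D.algebraMap_mem_cone u _) (D.expand_bFun_mem_zero t t' h u)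

theorem expand_cFun_sub_mem [Finite I] (t t' : (Coef T)ˣ) {y : D.Y} (h : D.Regular y) {u : D.W} {n :
    ℕ}
    (hn : 1 ≤ n) (hu : (show D.Dir u from y) ∈ D.deep u n) :
    D.expand u (D.cFun t t' y - algebraMap (Coef T) D.Ambient (t⁻¹ : (Coef T)ˣ)) ∈ D.cone u n := by
  have h1 := (D.cone u n).neg_mem (D.expand_bFun_sub_mem t t' h hn hu)
  rw [← map_neg] at h1
  have e : D.cFun t t' y - algebraMap (Coef T) D.Ambient (t⁻¹ : (Coef T)ˣ) = -(D.bFun t t' y -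
    algebraMap (Coef T) D.Ambient ((t : Coef T) - (t⁻¹ : (Coef T)ˣ))) := by
    rw [cFun, map_sub]; ring
  rwa [e]

theorem expand_cFun_sub_mem' [Finite I] (t t' : (Coef T)ˣ) {y : D.Y} (h : D.Regular y) {u : D.W} {n
    : ℕ}
    (hn : 1 ≤ n) (hu : (show D.Dir u from -y) ∈ D.deep u n) :
    D.expand u (D.cFun t t' y - algebraMap (Coef T) D.Ambient t) ∈ D.cone u n := by
  rw [cFun, sub_sub_cancel_left, map_neg]
  exact (D.cone u n).neg_mem (D.expand_bFun_mem t t' h hn hu)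

end Functions

section Operators

/-! ### The operators `T_i` -/

/-- The image `c(α_i^∨) [r_i] + b(α_i^∨)` of `H_i`. -/
def opT (i : I) : D.Twisted :=
  SkewMonoidAlgebra.single (D.r i) (D.cSimple i) + SkewMonoidAlgebra.single 1 (D.bSimple i)

theorem single_one_mul_smul (v : D.W) (f : D.Ambient) (x : D.Twisted) :
    SkewMonoidAlgebra.single v (1 : D.Ambient) * (f • x) =
      MulSemiringAction.toRingHom D.W D.Ambient v f • (SkewMonoidAlgebra.single v 1 * x) := by
  ext a
  rw [SkewMonoidAlgebra.coeff_single_mul, SkewMonoidAlgebra.coeff_smul,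
    SkewMonoidAlgebra.coeff_smul, Finsupp.smul_apply, Finsupp.smul_apply,
    SkewMonoidAlgebra.coeff_single_mul, one_mul, one_mul, smul_eq_mul, smul_eq_mul, smul_mul']
  rfl

theorem single_r_mul_self (i : I) (x : D.Twisted) :
    SkewMonoidAlgebra.single (D.r i) (1 : D.Ambient) * (SkewMonoidAlgebra.single (D.r i) 1 * x)
      = x := by
  rw [← mul_assoc, SkewMonoidAlgebra.single_mul_single, r_mul_self, smul_one, one_mul]
  exact one_mul x

variable [Finite I] [FiniteDimensional ℝ V]

/-- `T_i + σ_i⁻¹ = c(-α_i^∨) + c(α_i^∨) [r_i]` -/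
theorem opT_add (i : I) : D.opT i + ((D.sig i)⁻¹ : (Coef T)ˣ).1 • (1 : D.Twisted) =
    D.cFun (D.sig i) (D.sig' i) (-D.simpleCoroot i) • (1 : D.Twisted) +
      (algebraMap (Coef T) D.Ambient ((D.sig i : Coef T) + ((D.sig i)⁻¹ : (Coef T)ˣ)) -
        D.cFun (D.sig i) (D.sig' i) (-D.simpleCoroot i)) •
        SkewMonoidAlgebra.single (D.r i) (1 : D.Ambient) := by
  have h := D.regular_simpleCoroot i
  rw [← D.cFun_add_neg _ _ h, add_sub_cancel_right, D.cFun_neg _ _ h, ← algebraMap_smul D.Ambient,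
    opT, SkewMonoidAlgebra.one_def, SkewMonoidAlgebra.smul_single, SkewMonoidAlgebra.smul_single,
    SkewMonoidAlgebra.smul_single, smul_eq_mul, smul_eq_mul, smul_eq_mul, mul_one, mul_one, mul_one,
    SkewMonoidAlgebra.single_add, add_comm (SkewMonoidAlgebra.single 1 _), add_assoc, add_comm,
    add_assoc, cSimple, bSimple, add_comm]
  abel

omit [Finite I] [FiniteDimensional ℝ V] in
theorem r_smul_neg_self (i : I) : D.r i • (-D.simpleCoroot i) = D.simpleCoroot i := by
  apply Subtype.ext
  rw [coe_smul_Y]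
  change (D.r i : V ≃ₗ[ℝ] V) (-D.coroot i) = D.coroot i
  rw [map_neg, r_apply, root_coroot_self, two_smul]
  abel

omit [Finite I] [FiniteDimensional ℝ V] in
theorem r_smul_simpleCoroot (i j : I) :
    D.r i • (-D.simpleCoroot j) = -D.simpleCoroot j + D.cartan j i • D.simpleCoroot i := by
  apply Subtype.ext
  rw [coe_smul_Y]
  change (D.r i : V ≃ₗ[ℝ] V) (-D.coroot j) = -D.coroot j + D.cartan j i • D.coroot i
  rw [map_neg, r_apply, root_coroot, Int.cast_smul_eq_zsmul]
  abel

omit [Finite I] [FiniteDimensional ℝ V] in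
/-- If an entry `α_i(α_j^∨)` of the Cartan matrix is odd, then `α_i(Y) = ℤ`, so that
`σ_i = σ'_i`. -/
theorem par_eq_of_odd {i j : I} (n : ℤ) (h : D.cartan j i = 2 * n + 1) : D.par i = D.par' i := by
  refine D.par_odd i fun m => ⟨m • (D.coroot j - n • D.coroot i), ?_, ?_⟩
  · exact D.Y.zsmul_mem (D.Y.sub_mem (D.coroot_mem j) (D.Y.zsmul_mem (D.coroot_mem i) n)) m
  · rw [map_zsmul, map_sub, map_zsmul, root_coroot, root_coroot_self, h]
    push_cast [zsmul_eq_mul]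
    ring

omit [FiniteDimensional ℝ V] in
/-- For equal parameters, `c(t, t; z) = t - (t - t⁻¹) / (1 - z)`. -/
theorem exists_cFun_same (t : (Coef T)ˣ) {y : D.Y} (h : D.Regular y) :
    ∃ v, v * (1 - D.mono y) = 1 ∧ D.cFun t t y = algebraMap (Coef T) D.Ambient t -
      algebraMap (Coef T) D.Ambient ((t : Coef T) - (t⁻¹ : (Coef T)ˣ)) * v := by
  refine ⟨(1 + D.mono y) * Ring.inverse (1 - D.mono (2 • y)), ?_, ?_⟩
  · have h1 := Ring.inverse_mul_cancel _ (D.isUnit_one_sub_mono (D.regular_two_smul h))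
    rw [mono_two_smul] at h1 ⊢
    linear_combination h1
  · rw [cFun, bFun]
    ring

theorem opT_braid_of_zero {i j : I} (hij : i ≠ j) (h : D.cartan i j = 0) :
    D.opT i * D.opT j = D.opT j * D.opT i := by
  have h' := D.cartan_zero _ _ h
  have hb : D.bondOrder i j = 2 := by simp [bondOrder, h, h']
  have hw := D.wordProd_alt_bondOrder hij
  rw [hb] at hw
  simp only [alt, List.nil_append, List.cons_append, wordProd_cons, wordProd_nil, mul_one] at hw
  refine operator_braid_two (K := Coef T) (R := D.Ambient) (S := MulSemiringAction.toRingHom D.W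
    D.Ambient (D.r i))
    (T := MulSemiringAction.toRingHom D.W D.Ambient (D.r j)) (s := SkewMonoidAlgebra.single (D.r i)
      1)
    (t := SkewMonoidAlgebra.single (D.r j) 1) (D.single_one_mul_smul _) (D.single_one_mul_smul _)
    ?_ (D.smul_algebraMap' _) (D.smul_algebraMap' _) ?_ ?_ (D.opT_add i) (D.opT_add j)
  · rw [SkewMonoidAlgebra.single_mul_single, SkewMonoidAlgebra.single_mul_single, hw, smul_one,
    smul_one]
  · refine (D.smul_cFun _ _ _ (D.regular_simpleCoroot j).neg).trans ?_
    rw [r_smul_simpleCoroot, h', zero_smul, add_zero]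
  · refine (D.smul_cFun _ _ _ (D.regular_simpleCoroot i).neg).trans ?_
    rw [r_smul_simpleCoroot, h, zero_smul, add_zero]

omit [FiniteDimensional ℝ V] in
theorem smul_cFun_eq (v : D.W) (t u : (Coef T)ˣ) {y y' : D.Y} (h : D.Regular y)
    (hy : v • y = y') :
    MulSemiringAction.toRingHom D.W D.Ambient v (D.cFun t u y) = D.cFun t u y' :=
  hy ▸ D.smul_cFun v t u h

theorem opT_braid_of_neg_one {i j : I} (hij : i ≠ j) (h : D.cartan j i = -1)
    (h' : D.cartan i j = -1) :
    D.opT i * (D.opT j * D.opT i) = D.opT j * (D.opT i * D.opT j) := by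
  obtain ⟨p1, p2, p3⟩ := D.par_bond i j h h'
  have hb : D.bondOrder i j = 3 := by simp [bondOrder, h, h']
  have hw := D.wordProd_alt_bondOrder hij
  rw [hb] at hw
  simp only [alt, List.nil_append, List.cons_append, wordProd_cons, wordProd_nil, mul_one] at hw
  have e1 : D.sig' i = D.sig i := by rw [sig', sig, p2]
  have e2 : D.sig j = D.sig i := by rw [sig, sig, p1]
  have e3 : D.sig' j = D.sig i := by rw [sig', sig, p3]
  have hi := D.opT_add i
  have hj := D.opT_add j
  rw [e1] at hi
  rw [e2, e3] at hj
  have ri := D.r_smul_neg_self i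
  have rj := D.r_smul_neg_self j
  have rij := D.r_smul_simpleCoroot i j
  have rji := D.r_smul_simpleCoroot j i
  have ai := (D.regular_simpleCoroot i).neg
  have aj := (D.regular_simpleCoroot j).neg
  have ti := D.cFun_add_neg (D.sig i) (D.sig i) ai
  have tj := D.cFun_add_neg (D.sig i) (D.sig i) aj
  rw [neg_neg] at ti tj
  rw [h, neg_smul, one_smul, ← sub_eq_add_neg] at rij
  rw [h', neg_smul, one_smul, ← sub_eq_add_neg] at rji
  have aij : D.Regular (-D.simpleCoroot j - D.simpleCoroot i) := rij ▸ aj.smul (D.r i)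
  obtain ⟨u, hu, hu'⟩ := D.exists_cFun_same (D.sig i) ai
  obtain ⟨v, hv, hv'⟩ := D.exists_cFun_same (D.sig i) aj
  obtain ⟨w, hw1, hw'⟩ := D.exists_cFun_same (D.sig i) aij
  have H := inv_one_sub_mul hu hv hw1 (by rw [sub_eq_add_neg, mono_add, mul_comm])
  refine operator_braid_three (K := Coef T) (R := D.Ambient)
    (S := MulSemiringAction.toRingHom D.W D.Ambient (D.r i))
    (T := MulSemiringAction.toRingHom D.W D.Ambient (D.r j))
    (s := SkewMonoidAlgebra.single (D.r i) 1) (t := SkewMonoidAlgebra.single (D.r j) 1)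
    (e := D.cFun (D.sig i) (D.sig i) (-D.simpleCoroot j - D.simpleCoroot i))
    (D.single_one_mul_smul _) (D.single_one_mul_smul _) (D.single_r_mul_self i)
    (D.single_r_mul_self j) ?_ (D.smul_algebraMap' _) (D.smul_algebraMap' _)
    ((D.smul_cFun_eq _ _ _ ai ri).trans (eq_sub_of_add_eq' ti)) (D.smul_cFun_eq _ _ _ aj rij)
    (D.smul_cFun_eq _ _ _ aij ?_) ((D.smul_cFun_eq _ _ _ aj rj).trans (eq_sub_of_add_eq' tj))
    (D.smul_cFun_eq _ _ _ ai ?_) (D.smul_cFun_eq _ _ _ aij ?_) ?_ hi hj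
  · simp only [SkewMonoidAlgebra.single_mul_single, smul_one, mul_one, hw]
  · rw [← rij, smul_smul, r_mul_self, one_smul]
  · rw [rji]; abel
  · rw [show -D.simpleCoroot j - D.simpleCoroot i = -D.simpleCoroot i - D.simpleCoroot j by abel,
      ← rji, smul_smul, r_mul_self, one_smul]
  · rw [map_sub] at hu' hv' hw'
    rw [hu', hv', hw', map_add, map_mul]
    exact identity_three H

theorem opT_braid_of_neg_two {i j : I} (hij : i ≠ j) (h : D.cartan j i = -1)
    (h' : D.cartan i j = -2) :
    D.opT i * (D.opT j * (D.opT i * D.opT j)) = D.opT j * (D.opT i * (D.opT j * D.opT i)) := by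
  have p1 := D.par_eq_of_odd (-1) (show D.cartan j i = _ by rw [h]; rfl)
  have hb : D.bondOrder i j = 4 := by simp [bondOrder, h, h']
  have hw := D.wordProd_alt_bondOrder hij
  rw [hb] at hw
  simp only [alt, List.nil_append, List.cons_append, wordProd_cons, wordProd_nil, mul_one] at hw
  have e1 : D.sig' i = D.sig i := by rw [sig', sig, p1]
  have hi := D.opT_add i
  have hj := D.opT_add j
  rw [e1] at hi
  have ri := D.r_smul_neg_self i
  have rj := D.r_smul_neg_self j
  have rij := D.r_smul_simpleCoroot i j
  have rji := D.r_smul_simpleCoroot j i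
  have ai := (D.regular_simpleCoroot i).neg
  have aj := (D.regular_simpleCoroot j).neg
  have ti := D.cFun_add_neg (D.sig i) (D.sig i) ai
  have tj := D.cFun_add_neg (D.sig j) (D.sig' j) aj
  rw [neg_neg] at ti tj
  rw [h, neg_smul, one_smul] at rij
  rw [h', neg_smul, two_smul] at rji
  set a : D.Y := -D.simpleCoroot i with ha
  set b : D.Y := -D.simpleCoroot j with hb'
  rw [show b + a = a + b from add_comm _ _] at rij
  have rji' : D.r j • a = a + b + b := by rw [rji]; simp only [hb']; abel
  have aij : D.Regular (a + b) := rij ▸ aj.smul (D.r i)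
  have aji : D.Regular (a + b + b) := rji' ▸ ai.smul (D.r j)
  obtain ⟨u, hu, hu'⟩ := D.exists_cFun_same (D.sig i) ai
  obtain ⟨v, hv, hv'⟩ := D.exists_cFun_same (D.sig i) aji
  have H := identity_four (g₁ := algebraMap (Coef T) D.Ambient ((D.sig i)⁻¹ : (Coef T)ˣ))
    (h₁ := algebraMap (Coef T) D.Ambient (D.sig i))
    (g₂ := algebraMap (Coef T) D.Ambient ((D.sig j)⁻¹ : (Coef T)ˣ))
    (h₂ := algebraMap (Coef T) D.Ambient (D.sig j))
    (k := algebraMap (Coef T) D.Ambient ((D.sig' j : Coef T) - ((D.sig' j)⁻¹ : (Coef T)ˣ)))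
    (d₁ := D.cFun (D.sig i) (D.sig i) a) (d₂ := D.cFun (D.sig j) (D.sig' j) b)
    (e₁ := D.cFun (D.sig i) (D.sig i) (a + b + b)) (e₂ := D.cFun (D.sig j) (D.sig' j) (a + b))
    (x := D.mono a) (y := D.mono b) hu
    (by rw [mono_add, mono_add, mul_assoc, ← sq] at hv; exact hv)
    (by rw [← mono_two_smul]
        exact Ring.inverse_mul_cancel _ (D.isUnit_one_sub_mono (D.regular_two_smul aj)))
    (by rw [← mul_pow, ← mono_add, ← mono_two_smul]
        exact Ring.inverse_mul_cancel _ (D.isUnit_one_sub_mono (D.regular_two_smul aij)))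
    (by rw [hu', map_sub]) (by rw [hv', map_sub]) (by rw [cFun, bFun, map_sub, mono_two_smul])
    (by rw [cFun, bFun, map_sub, mono_two_smul, mono_add, mul_pow])
  refine operator_braid_four (K := Coef T) (R := D.Ambient)
    (S := MulSemiringAction.toRingHom D.W D.Ambient (D.r i))
    (T := MulSemiringAction.toRingHom D.W D.Ambient (D.r j))
    (s := SkewMonoidAlgebra.single (D.r i) 1) (t := SkewMonoidAlgebra.single (D.r j) 1)
    (e₁ := D.cFun (D.sig i) (D.sig i) (a + b + b)) (e₂ := D.cFun (D.sig j) (D.sig' j) (a + b))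
    (D.single_one_mul_smul _) (D.single_one_mul_smul _) (D.single_r_mul_self i)
    (D.single_r_mul_self j) ?_ (D.smul_algebraMap' _) (D.smul_algebraMap' _)
    ((D.smul_cFun_eq _ _ _ ai ri).trans (eq_sub_of_add_eq' ti)) (D.smul_cFun_eq _ _ _ aj rij)
    (D.smul_cFun_eq _ _ _ aji ?_) (D.smul_cFun_eq _ _ _ aij ?_)
    ((D.smul_cFun_eq _ _ _ aj rj).trans (eq_sub_of_add_eq' tj))
    (D.smul_cFun_eq _ _ _ ai rji') (D.smul_cFun_eq _ _ _ aij ?_) (D.smul_cFun_eq _ _ _ aji ?_)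
    ?_ hi hj
  · simp only [SkewMonoidAlgebra.single_mul_single, smul_one, mul_one, hw]
  · rw [smul_add, smul_add, ri, rij, ha]; abel
  · rw [smul_add, ri, rij, ha]; abel
  · rw [smul_add, rj, rji', hb']; abel
  · rw [smul_add, smul_add, rj, rji', hb']; abel
  · simp only [map_add, map_mul]
    exact H

theorem opT_braid_of_neg_three {i j : I} (hij : i ≠ j) (h : D.cartan j i = -1)
    (h' : D.cartan i j = -3) :
    D.opT i * (D.opT j * (D.opT i * (D.opT j * (D.opT i * D.opT j)))) =
      D.opT j * (D.opT i * (D.opT j * (D.opT i * (D.opT j * D.opT i)))) := by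
  have p1 := D.par_eq_of_odd (-1) (show D.cartan j i = _ by rw [h]; rfl)
  have p2 := D.par_eq_of_odd (-2) (show D.cartan i j = _ by rw [h']; rfl)
  have hb : D.bondOrder i j = 6 := by simp [bondOrder, h, h']
  have hw := D.wordProd_alt_bondOrder hij
  rw [hb] at hw
  simp only [alt, List.nil_append, List.cons_append, wordProd_cons, wordProd_nil, mul_one] at hw
  have e1 : D.sig' i = D.sig i := by rw [sig', sig, p1]
  have e2 : D.sig' j = D.sig j := by rw [sig', sig, p2]
  have hi := D.opT_add i
  have hj := D.opT_add j
  rw [e1] at hi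
  rw [e2] at hj
  have ri := D.r_smul_neg_self i
  have rj := D.r_smul_neg_self j
  have rij := D.r_smul_simpleCoroot i j
  have rji := D.r_smul_simpleCoroot j i
  have ai := (D.regular_simpleCoroot i).neg
  have aj := (D.regular_simpleCoroot j).neg
  have ti := D.cFun_add_neg (D.sig i) (D.sig i) ai
  have tj := D.cFun_add_neg (D.sig j) (D.sig j) aj
  rw [neg_neg] at ti tj
  rw [h, neg_smul, one_smul] at rij
  rw [h', neg_smul, show (3 : ℤ) = 1 + 1 + 1 by norm_num, add_smul, add_smul, one_smul] at rji
  set a : D.Y := -D.simpleCoroot i with ha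
  set b : D.Y := -D.simpleCoroot j with hb'
  rw [show b + a = a + b from add_comm _ _] at rij
  have rji' : D.r j • a = a + b + b + b := by rw [rji]; simp only [hb']; abel
  have r3 : D.r i • (a + b + b + b) = a + a + b + b + b := by
    rw [smul_add, smul_add, smul_add, ri, rij, ha]; abel
  have r4 : D.r j • (a + b) = a + b + b := by rw [smul_add, rj, rji', hb']; abel
  have af2 : D.Regular (a + b) := rij ▸ aj.smul (D.r i)
  have af1 : D.Regular (a + b + b + b) := rji' ▸ ai.smul (D.r j)
  have aj1 : D.Regular (a + a + b + b + b) := r3 ▸ af1.smul (D.r i)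
  have aj2 : D.Regular (a + b + b) := r4 ▸ af2.smul (D.r j)
  obtain ⟨a₁, ha₁, ha₁'⟩ := D.exists_cFun_same (D.sig i) ai
  obtain ⟨b₁, hb₁, hb₁'⟩ := D.exists_cFun_same (D.sig i) af1
  obtain ⟨c₁, hc₁, hc₁'⟩ := D.exists_cFun_same (D.sig i) aj1
  obtain ⟨a₂, ha₂, ha₂'⟩ := D.exists_cFun_same (D.sig j) aj
  obtain ⟨b₂, hb₂, hb₂'⟩ := D.exists_cFun_same (D.sig j) af2
  obtain ⟨c₂, hc₂, hc₂'⟩ := D.exists_cFun_same (D.sig j) aj2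
  refine operator_braid_six (K := Coef T) (R := D.Ambient)
    (S := MulSemiringAction.toRingHom D.W D.Ambient (D.r i))
    (T := MulSemiringAction.toRingHom D.W D.Ambient (D.r j))
    (s := SkewMonoidAlgebra.single (D.r i) 1) (t := SkewMonoidAlgebra.single (D.r j) 1)
    (f₁ := D.cFun (D.sig i) (D.sig i) (a + b + b + b))
    (f₂ := D.cFun (D.sig j) (D.sig j) (a + b))
    (j₁ := D.cFun (D.sig i) (D.sig i) (a + a + b + b + b))
    (j₂ := D.cFun (D.sig j) (D.sig j) (a + b + b))
    (D.single_one_mul_smul _) (D.single_one_mul_smul _) (D.single_r_mul_self i)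
    (D.single_r_mul_self j) ?_ (D.smul_algebraMap' _) (D.smul_algebraMap' _) rfl rfl
    rfl rfl rfl rfl rfl rfl
    ((D.smul_cFun_eq _ _ _ ai ri).trans (eq_sub_of_add_eq' ti)) (D.smul_cFun_eq _ _ _ aj rij)
    (D.smul_cFun_eq _ _ _ af2 ?_) (D.smul_cFun_eq _ _ _ af1 r3) (D.smul_cFun_eq _ _ _ aj1 ?_)
    (D.smul_cFun_eq _ _ _ aj2 ?_)
    ((D.smul_cFun_eq _ _ _ aj rj).trans (eq_sub_of_add_eq' tj))
    (D.smul_cFun_eq _ _ _ ai rji') (D.smul_cFun_eq _ _ _ af1 ?_) (D.smul_cFun_eq _ _ _ af2 r4)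
    (D.smul_cFun_eq _ _ _ aj2 ?_) (D.smul_cFun_eq _ _ _ aj1 ?_) ?_ hi hj
  · simp only [SkewMonoidAlgebra.single_mul_single, smul_one, mul_one, hw]
  · rw [smul_add, ri, rij, ha]; abel
  · rw [smul_add, smul_add, smul_add, smul_add, ri, rij, ha]; abel
  · rw [smul_add, smul_add, ri, rij, ha]; abel
  · rw [smul_add, smul_add, smul_add, rj, rji', hb']; abel
  · rw [smul_add, smul_add, rj, rji', hb']; abel
  · rw [smul_add, smul_add, smul_add, smul_add, rj, rji', hb']; abel
  · have H := identity_six (g₁ := algebraMap (Coef T) D.Ambient ((D.sig i)⁻¹ : (Coef T)ˣ))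
      (g₂ := algebraMap (Coef T) D.Ambient ((D.sig j)⁻¹ : (Coef T)ˣ))
      (inv_one_sub_mul ha₂ hc₂ hb₁ (by simp only [mono_add]; ring))
      (inv_one_sub_mul ha₂ hb₂ hc₂ (by simp only [mono_add]; ring))
      (inv_one_sub_mul hb₂ hc₂ hc₁ (by simp only [mono_add]; ring))
      (inv_one_sub_mul ha₁ ha₂ hb₂ (by simp only [mono_add]))
      (inv_one_sub_mul ha₁ hb₁ hc₁ (by simp only [mono_add]; ring))
      (h₁ := algebraMap (Coef T) D.Ambient (D.sig i))
      (h₂ := algebraMap (Coef T) D.Ambient (D.sig j))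
      (by rw [map_sub, add_sub_cancel]) (by rw [map_sub, add_sub_cancel]) ha₁' hb₁' hc₁' ha₂' hb₂'
      hc₂' rfl rfl rfl rfl rfl rfl rfl
    simp only [map_add, map_mul, map_sub, map_pow]
    exact H

/-- The braid relations of the `T_i`. -/
theorem opT_braid {i j : I} (hij : i ≠ j) :
    ((alt i j (D.bondOrder i j)).map D.opT).prod = ((alt j i (D.bondOrder i j)).map D.opT).prod :=
      by
  rcases D.cartan_pairs hij with ⟨h, h'⟩ | ⟨h, h'⟩ | ⟨h, h'⟩ | ⟨h, h'⟩ | ⟨h, h'⟩ | ⟨h, h'⟩ |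
    ⟨h1, h2, h3⟩
  · have hb : D.bondOrder i j = 2 := by simp [bondOrder, h]
    simpa [hb, alt] using D.opT_braid_of_zero hij h
  · have hb : D.bondOrder i j = 3 := by simp [bondOrder, h, h']
    simpa [hb, alt] using (D.opT_braid_of_neg_one hij h' h).symm
  · have hb : D.bondOrder i j = 4 := by simp [bondOrder, h, h']
    simpa [hb, alt] using (D.opT_braid_of_neg_two hij.symm h h').symm
  · have hb : D.bondOrder i j = 4 := by simp [bondOrder, h, h']
    simpa [hb, alt] using D.opT_braid_of_neg_two hij h' h
  · have hb : D.bondOrder i j = 6 := by simp [bondOrder, h, h']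
    simpa [hb, alt] using (D.opT_braid_of_neg_three hij.symm h h').symm
  · have hb : D.bondOrder i j = 6 := by simp [bondOrder, h, h']
    simpa [hb, alt] using D.opT_braid_of_neg_three hij h' h
  · have hb : D.bondOrder i j = 0 := by
      unfold bondOrder
      rw [if_neg (by omega), if_neg (by omega), if_neg (by omega), if_neg (by omega)]
    simp [hb, alt]

end Operators

section Representation

/-! ### The algebra of fractions -/

theorem ofPoly_single (y : D.Y) (c : Coef T) :
    D.ofPoly (AddMonoidAlgebra.single y c) = algebraMap (Coef T) D.Ambient c * D.mono y := by
  rw [← Algebra.smul_def]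
  exact AddMonoidAlgebra.lift_single _ _ _

theorem coeff_expand_ofPoly (u : D.W) (p : AddMonoidAlgebra (Coef T) D.Y) (y : D.Y) :
    (D.expand u (D.ofPoly p)).coeff (show D.Dir u from y) = p.coeff y := by
  classical
  induction p using AddMonoidAlgebra.induction_linear with
  | zero => rw [map_zero, map_zero]; rfl
  | add p q hp hq =>
    rw [map_add, map_add, HahnSeries.coeff_add, hp, hq, AddMonoidAlgebra.coeff_add]
    rfl
  | single m c =>
    rw [ofPoly_single, map_mul, expand_algebraMap, expand_mono, HahnSeries.single_mul_single,
      zero_add, mul_one, AddMonoidAlgebra.coeff_single]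
    by_cases h : y = m
    · subst h
      rw [Finsupp.single_eq_same]
      exact HahnSeries.coeff_single_same _ _
    · rw [Finsupp.single_eq_of_ne h]
      exact HahnSeries.coeff_single_of_ne h

theorem ofPoly_injective : Function.Injective D.ofPoly := by
  intro p q h
  refine AddMonoidAlgebra.coeff_injective (Finsupp.ext fun y => ?_)
  rw [← D.coeff_expand_ofPoly 1, ← D.coeff_expand_ofPoly 1, h]

theorem ofPoly_mem_fracAlg (p : AddMonoidAlgebra (Coef T) D.Y) : D.ofPoly p ∈ D.fracAlg :=
  ⟨p, 1, one_mem _, by rw [map_one, one_mul]⟩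

theorem mono_mem_fracAlg (y : D.Y) : D.mono y ∈ D.fracAlg := by
  have h := D.ofPoly_mem_fracAlg (AddMonoidAlgebra.single y 1)
  rwa [ofPoly_single, map_one, one_mul] at h

theorem inverse_mem_fracAlg {F G : D.Ambient} (hF : F ∈ D.fracAlg) (h : F * G = 1) :
    G ∈ D.fracAlg := by
  obtain ⟨f, g, hg, hfg⟩ := hF
  refine ⟨g, f, ?_, by rw [← hfg, mul_assoc, h, mul_one]⟩
  rw [mem_nonZeroDivisors_iff_right] at hg ⊢
  intro p hp
  apply hg
  apply D.ofPoly_injective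
  have h1 := congrArg D.ofPoly hp
  rw [map_mul, map_zero, ← hfg] at h1
  rw [map_mul, map_zero]
  linear_combination G * h1 - D.ofPoly p * D.ofPoly g * h

theorem smul_ofPoly (v : D.W) (p : AddMonoidAlgebra (Coef T) D.Y) :
    v • D.ofPoly p = D.ofPoly (AddMonoidAlgebra.domCongr (Coef T) (Coef T)
      (DistribMulAction.toAddEquiv D.Y v) p) := by
  induction p using AddMonoidAlgebra.induction_linear with
  | zero => rw [map_zero, map_zero, map_zero, smul_zero]
  | add p q hp hq => rw [map_add, map_add, map_add, smul_add, hp, hq]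
  | single m c =>
    rw [AddMonoidAlgebra.domCongr_single, ofPoly_single, ofPoly_single, smul_mul',
      smul_algebraMap', smul_mono]
    rfl

theorem smul_mem_fracAlg (v : D.W) {F : D.Ambient} (h : F ∈ D.fracAlg) : v • F ∈ D.fracAlg := by
  obtain ⟨f, g, hg, hfg⟩ := h
  refine ⟨AddMonoidAlgebra.domCongr (Coef T) (Coef T) (DistribMulAction.toAddEquiv D.Y v) f,
    AddMonoidAlgebra.domCongr (Coef T) (Coef T) (DistribMulAction.toAddEquiv D.Y v) g, ?_,
    by rw [← smul_ofPoly, ← smul_mul', hfg, smul_ofPoly]⟩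
  rw [mem_nonZeroDivisors_iff_right] at hg ⊢
  intro p hp
  set e := AddMonoidAlgebra.domCongr (Coef T) (Coef T) (DistribMulAction.toAddEquiv D.Y v)
  have h1 : e.symm p * g = 0 := by
    apply e.injective
    rw [map_mul, AlgEquiv.apply_symm_apply, hp, map_zero]
  have h2 := hg _ h1
  rwa [map_eq_zero_iff _ e.symm.injective] at h2

theorem bFun_mem_fracAlg [Finite I] (t u : (Coef T)ˣ) {y : D.Y} (h : D.Regular y) :
    D.bFun t u y ∈ D.fracAlg := by
  refine mul_mem (add_mem (Subalgebra.algebraMap_mem _ _) (mul_mem (Subalgebra.algebraMap_mem _ _)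
    (D.mono_mem_fracAlg y))) ?_
  exact D.inverse_mem_fracAlg (sub_mem (one_mem _) (D.mono_mem_fracAlg (2 • y)))
    (Ring.mul_inverse_cancel _ (D.isUnit_one_sub_mono (D.regular_two_smul h)))

theorem cFun_mem_fracAlg [Finite I] (t u : (Coef T)ˣ) {y : D.Y} (h : D.Regular y) :
    D.cFun t u y ∈ D.fracAlg :=
  sub_mem (Subalgebra.algebraMap_mem _ _) (D.bFun_mem_fracAlg t u h)

theorem coeff_mul_mem_fracAlg {x y : D.Twisted} (hx : ∀ w, x.coeff w ∈ D.fracAlg)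
    (hy : ∀ w, y.coeff w ∈ D.fracAlg) (w : D.W) : (x * y).coeff w ∈ D.fracAlg := by
  rw [SkewMonoidAlgebra.coeff_mul_left, SkewMonoidAlgebra.sum_def']
  exact sum_mem fun a _ => mul_mem (hx a) (D.smul_mem_fracAlg a (hy _))

theorem coeff_single_mem_fracAlg {v : D.W} {f : D.Ambient} (hf : f ∈ D.fracAlg) (w : D.W) :
    (SkewMonoidAlgebra.single v f : D.Twisted).coeff w ∈ D.fracAlg := by
  classical
  rw [SkewMonoidAlgebra.coeff_single_apply]
  split_ifs
  · exact hf
  · exact zero_mem _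

/-! ### Products along reduced words -/

section Ext
variable {M : Type*} [Monoid M] [FiniteDimensional ℝ V]

theorem ext_eq_of_reduced {f : I → M}
    (hf : ∀ i j, i ≠ j → ((alt i j (D.bondOrder i j)).map f).prod
      = ((alt j i (D.bondOrder i j)).map f).prod) {l : List I}
    (hl : D.length (D.wordProd l) = l.length) : D.ext f (D.wordProd l) = (l.map f).prod :=
  D.map_prod_eq_of_reduced f hf _ _
    (by rw [wordProd_reducedWord, reducedWord_length]) hl (D.wordProd_reducedWord _)

omit [FiniteDimensional ℝ V] in
theorem ext_one (f : I → M) : D.ext f 1 = 1 := by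
  have h : D.reducedWord 1 = [] :=
    List.length_eq_zero_iff.1 ((D.reducedWord_length 1).trans D.length_one)
  rw [ext, h, List.map_nil, List.prod_nil]

theorem ext_r_mul {f : I → M}
    (hf : ∀ i j, i ≠ j → ((alt i j (D.bondOrder i j)).map f).prod
      = ((alt j i (D.bondOrder i j)).map f).prod) {i : I} {w : D.W}
    (h : D.length w < D.length (D.r i * w)) : D.ext f (D.r i * w) = f i * D.ext f w := by
  have e : D.r i * w = D.wordProd (i :: D.reducedWord w) := by
    rw [wordProd_cons, wordProd_reducedWord]
  have hl := D.length_r_mul i w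
  rw [e, D.ext_eq_of_reduced hf (by rw [← e, List.length_cons, reducedWord_length]; omega),
    List.map_cons, List.prod_cons]
  rfl

theorem ext_mul_r {f : I → M}
    (hf : ∀ i j, i ≠ j → ((alt i j (D.bondOrder i j)).map f).prod
      = ((alt j i (D.bondOrder i j)).map f).prod) {i : I} {w : D.W}
    (h : D.length w < D.length (w * D.r i)) : D.ext f (w * D.r i) = D.ext f w * f i := by
  have e : w * D.r i = D.wordProd (D.reducedWord w ++ [i]) := by
    rw [wordProd_concat, wordProd_reducedWord]
  have hl := D.length_mul_r w i
  rw [e, D.ext_eq_of_reduced hf (by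
    rw [← e, List.length_append, reducedWord_length, List.length_singleton]; omega),
    List.map_append, List.prod_append, List.map_singleton, List.prod_singleton]
  rfl

theorem ext_r {f : I → M}
    (hf : ∀ i j, i ≠ j → ((alt i j (D.bondOrder i j)).map f).prod
      = ((alt j i (D.bondOrder i j)).map f).prod) (i : I) : D.ext f (D.r i) = f i := by
  have h := D.ext_mul_r hf (D.length_lt_length_one_mul_r i)
  rwa [one_mul, ext_one, one_mul] at h

end Ext

theorem sig_braid {i j : I} (hij : i ≠ j) :
    ((alt i j (D.bondOrder i j)).map D.sig).prod = ((alt j i (D.bondOrder i j)).map D.sig).prod :=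
      by
  unfold bondOrder
  split_ifs with h1 h2 h3 h4
  · simp [alt, mul_comm]
  · rcases D.cartan_pairs hij with ⟨h, h'⟩ | ⟨h, h'⟩ | ⟨h, h'⟩ | ⟨h, h'⟩ | ⟨h, h'⟩ | ⟨h, h'⟩ |
      ⟨-, -, h⟩
    case inr.inl =>
      have e : D.sig i = D.sig j := by rw [sig, sig, (D.par_bond i j h' h).1]
      simp [alt, e]
    all_goals first | (rw [h, h'] at h2; norm_num at h2) | omega
  · simp only [alt, List.nil_append, List.cons_append, List.map_cons, List.map_nil, List.prod_cons,
      List.prod_nil]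
    simp only [mul_left_comm]
  · simp only [alt, List.nil_append, List.cons_append, List.map_cons, List.map_nil, List.prod_cons,
      List.prod_nil]
    simp only [mul_left_comm]
  · rfl

variable [Finite I] [FiniteDimensional ℝ V]

omit [Finite I] in
theorem sigW_r_mul {i : I} {w : D.W} (h : D.length w < D.length (D.r i * w)) :
    D.sigW (D.r i * w) = D.sig i * D.sigW w :=
  D.ext_r_mul (fun _ _ => D.sig_braid) h

omit [Finite I] in
theorem sigW_mul_r {i : I} {w : D.W} (h : D.length w < D.length (w * D.r i)) :
    D.sigW (w * D.r i) = D.sigW w * D.sig i :=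
  D.ext_mul_r (fun _ _ => D.sig_braid) h

theorem opT_mul_self (i : I) : D.opT i * D.opT i =
    1 + ((D.sig i : Coef T) - ((D.sig i)⁻¹ : (Coef T)ˣ)) • D.opT i := by
  have h := D.regular_simpleCoroot i
  have h1 := operator_mul_self (K := Coef T) (R := D.Ambient)
    (S := MulSemiringAction.toRingHom D.W D.Ambient (D.r i)) (D.single_one_mul_smul _)
    (D.single_r_mul_self i) (D.smul_algebraMap' _)
    ((D.smul_cFun_eq _ _ _ h.neg (D.r_smul_neg_self i)).trans
      (eq_sub_of_add_eq (D.cFun_add_neg _ _ h))) (D.opT_add i)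
  rwa [Units.inv_mul, one_smul] at h1

/-- The image `T_w` of `H_w`, the product of the `T_i` along a reduced word of `w`. -/
def opTW (w : D.W) : D.Twisted := D.ext D.opT w

omit [Finite I] in
omit [FiniteDimensional ℝ V] in
theorem opTW_one : D.opTW 1 = 1 := D.ext_one _

theorem opTW_r (i : I) : D.opTW (D.r i) = D.opT i := D.ext_r (fun _ _ => D.opT_braid) i

theorem opTW_r_mul {i : I} {w : D.W} (h : D.length w < D.length (D.r i * w)) :
    D.opTW (D.r i * w) = D.opT i * D.opTW w := D.ext_r_mul (fun _ _ => D.opT_braid) h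

theorem opTW_mul_r {i : I} {w : D.W} (h : D.length w < D.length (w * D.r i)) :
    D.opTW (w * D.r i) = D.opTW w * D.opT i := D.ext_mul_r (fun _ _ => D.opT_braid) h

theorem opT_mul_opTW_of_gt {i : I} {w : D.W} (h : D.length (D.r i * w) < D.length w) :
    D.opT i * D.opTW w = ((D.sig i : Coef T) - ((D.sig i)⁻¹ : (Coef T)ˣ)) • D.opTW w +
      D.opTW (D.r i * w) := by
  have h1 := D.opTW_r_mul (i := i) (w := D.r i * w) (by rwa [r_mul_r_mul])
  rw [r_mul_r_mul] at h1
  rw [h1, ← mul_assoc, opT_mul_self, add_mul, one_mul, smul_mul_assoc, add_comm]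

theorem opTW_mul_opT_of_gt {i : I} {w : D.W} (h : D.length (w * D.r i) < D.length w) :
    D.opTW w * D.opT i = ((D.sig i : Coef T) - ((D.sig i)⁻¹ : (Coef T)ˣ)) • D.opTW w +
      D.opTW (w * D.r i) := by
  have h1 := D.opTW_mul_r (i := i) (w := w * D.r i) (by rwa [mul_r_mul_r])
  rw [mul_r_mul_r] at h1
  rw [h1, mul_assoc, opT_mul_self, mul_add, mul_one, mul_smul_comm, add_comm]

theorem opT_coeff_mem (i : I) (w : D.W) : (D.opT i).coeff w ∈ D.fracAlg := by
  rw [opT, SkewMonoidAlgebra.coeff_add, Finsupp.add_apply]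
  exact add_mem
    (D.coeff_single_mem_fracAlg (D.cFun_mem_fracAlg _ _ (D.regular_simpleCoroot i)) w)
    (D.coeff_single_mem_fracAlg (D.bFun_mem_fracAlg _ _ (D.regular_simpleCoroot i)) w)

theorem opTW_coeff_mem (w v : D.W) : (D.opTW w).coeff v ∈ D.fracAlg := by
  unfold opTW ext
  generalize D.reducedWord w = l
  induction l generalizing v with
  | nil => exact D.coeff_single_mem_fracAlg (one_mem _) v
  | cons i l ih =>
    rw [List.map_cons, List.prod_cons]
    exact D.coeff_mul_mem_fracAlg (D.opT_coeff_mem i) ih v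

/-! ### The representation of the Bernstein-Lusztig-Hecke algebra -/

/-- The images of the generators under `Ψ`. -/
def psiGen : D.BLGen → D.Twisted
  | BLGen.H w => D.opTW w
  | BLGen.Z y => SkewMonoidAlgebra.single 1 (D.mono (-y))

/-- `Ψ` on the free algebra. -/
def psiFree : FreeAlgebra (Coef T) D.BLGen →ₐ[Coef T] D.Twisted :=
  FreeAlgebra.lift (Coef T) D.psiGen

omit [Finite I] [FiniteDimensional ℝ V] in
theorem psiFree_H (w : D.W) : D.psiFree (D.freeH w) = D.opTW w := FreeAlgebra.lift_ι_apply _ _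

omit [Finite I] [FiniteDimensional ℝ V] in
theorem psiFree_Z (y : D.Y) :
    D.psiFree (D.freeZ y) = SkewMonoidAlgebra.single 1 (D.mono (-y)) :=
  FreeAlgebra.lift_ι_apply _ _

/-- `e^y ↦ e^{-y}` -/
def negPoly : AddMonoidAlgebra (Coef T) D.Y →ₐ[Coef T] D.Ambient :=
  D.ofPoly.comp (AddMonoidAlgebra.domCongr (Coef T) (Coef T) (AddEquiv.neg D.Y)).toAlgHom

omit [Finite I] [FiniteDimensional ℝ V] in
theorem negPoly_single (y : D.Y) (c : Coef T) :
    D.negPoly (AddMonoidAlgebra.single y c) = c • D.mono (-y) := by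
  rw [Algebra.smul_def, ← ofPoly_single]
  exact congrArg D.ofPoly (AddMonoidAlgebra.domCongr_single (R := Coef T) _ _ _)

omit [Finite I] [FiniteDimensional ℝ V] in
theorem psiFree_ZPoly (q : AddMonoidAlgebra (Coef T) D.Y) :
    D.psiFree (D.freeZPoly q) = SkewMonoidAlgebra.single 1 (D.negPoly q) := by
  classical
  rw [freeZPoly]
  induction q using AddMonoidAlgebra.induction_linear with
  | zero =>
    rw [AddMonoidAlgebra.coeff_zero, Finsupp.sum_zero_index, map_zero, map_zero,
      SkewMonoidAlgebra.single_zero]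
  | add p q hp hq =>
    rw [AddMonoidAlgebra.coeff_add, Finsupp.sum_add_index' (fun y => zero_smul _ (D.freeZ y))
      (fun y _ _ => add_smul _ _ (D.freeZ y)), map_add, hp, hq, map_add,
        SkewMonoidAlgebra.single_add]
  | single y c =>
    rw [AddMonoidAlgebra.coeff_single, Finsupp.sum_single_index (zero_smul _ (D.freeZ y)), map_smul,
      psiFree_Z, SkewMonoidAlgebra.smul_single, negPoly_single]

theorem psiFree_bernstein (i : I) (y : D.Y) (q : AddMonoidAlgebra (Coef T) D.Y)
    (h : (1 - AddMonoidAlgebra.single (-(2 • D.simpleCoroot i)) 1) * q =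
        (AddMonoidAlgebra.single 0 ((D.sig i : Coef T) - ((D.sig i)⁻¹ : (Coef T)ˣ)) +
          AddMonoidAlgebra.single (-D.simpleCoroot i)
            ((D.sig' i : Coef T) - ((D.sig' i)⁻¹ : (Coef T)ˣ))) *
        (AddMonoidAlgebra.single y 1 - AddMonoidAlgebra.single (D.r i • y) 1)) :
    D.psiFree (D.freeH (D.r i) * D.freeZ y - D.freeZ (D.r i • y) * D.freeH (D.r i)) =
      D.psiFree (D.freeZPoly q) := by
  have hr := D.regular_simpleCoroot i
  have h1 := congrArg D.negPoly h
  rw [map_mul, map_mul, map_sub, map_sub, map_one, map_add] at h1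
  simp only [negPoly_single, neg_zero, neg_neg, one_smul, mono_zero] at h1
  rw [Algebra.smul_def, Algebra.smul_def, mul_one, mono_two_smul, ← D.bFun_mul _ _ hr,
    mul_right_comm, mul_comm] at h1
  have h2 := (D.isUnit_one_sub_sq hr).mul_right_cancel h1
  rw [psiFree_ZPoly, h2, map_sub, map_mul, map_mul, psiFree_H, psiFree_Z, psiFree_Z, opTW_r, opT,
    add_mul, mul_add, SkewMonoidAlgebra.single_mul_single, SkewMonoidAlgebra.single_mul_single,
    SkewMonoidAlgebra.single_mul_single, SkewMonoidAlgebra.single_mul_single, smul_mono, one_smul,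
    one_smul, one_smul, smul_neg, mul_one, one_mul, one_mul, mul_comm (D.mono (-(D.r i • y))),
    mul_comm (D.mono (-(D.r i • y))), add_sub_add_left_eq_sub, bSimple, mul_sub, sub_eq_add_neg,
    sub_eq_add_neg, SkewMonoidAlgebra.single_add, SkewMonoidAlgebra.single_neg]

theorem psiFree_rel ⦃x y : FreeAlgebra (Coef T) D.BLGen⦄ (h : D.BLRel x y) :
    D.psiFree x = D.psiFree y := by
  cases h with
  | H_one => rw [psiFree_H, opTW_one, map_one]
  | H_mul_of_lt i w h => rw [map_mul, psiFree_H, psiFree_H, psiFree_H, opTW_r, D.opTW_r_mul h]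
  | H_mul_of_gt i w h =>
    rw [map_mul, map_add, map_smul, psiFree_H, psiFree_H, psiFree_H, opTW_r,
      D.opT_mul_opTW_of_gt h]
  | Z_zero => rw [psiFree_Z, neg_zero, mono_zero, map_one]; rfl
  | Z_mul x y =>
    rw [map_mul, psiFree_Z, psiFree_Z, psiFree_Z, SkewMonoidAlgebra.single_mul_single, one_smul,
      mul_one, neg_add, mono_add]
  | bernstein i y q h => exact D.psiFree_bernstein i y q h

/-- The representation `Ψ`. -/
def Psi : D.BLHecke →ₐ[Coef T] D.Twisted :=
  RingQuot.liftAlgHom (Coef T) ⟨D.psiFree, D.psiFree_rel⟩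

theorem Psi_mk (x : FreeAlgebra (Coef T) D.BLGen) :
    D.Psi (RingQuot.mkAlgHom (Coef T) D.BLRel x) = D.psiFree x :=
  RingQuot.liftAlgHom_mkAlgHom_apply _ _ _ _

theorem Psi_H (w : D.W) : D.Psi (D.H w) = D.opTW w := (D.Psi_mk _).trans (D.psiFree_H w)

theorem isCherednikRep_Psi : D.IsCherednikRep D.Psi where
  map_H i := (D.Psi_H _).trans (D.opTW_r i)
  map_Z y := (D.Psi_mk _).trans (D.psiFree_Z y)
  coeff_mem h w := by
    obtain ⟨x, rfl⟩ := RingQuot.mkAlgHom_surjective (Coef T) D.BLRel h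
    rw [Psi_mk]
    induction x using FreeAlgebra.induction generalizing w with
    | grade0 c =>
      rw [AlgHom.commutes, Algebra.algebraMap_eq_smul_one, SkewMonoidAlgebra.coeff_smul,
        Finsupp.smul_apply]
      exact D.fracAlg.smul_mem (D.coeff_single_mem_fracAlg (one_mem _) w) c
    | grade1 g =>
      rw [psiFree, FreeAlgebra.lift_ι_apply]
      cases g with
      | H v => exact D.opTW_coeff_mem v w
      | Z y => exact D.coeff_single_mem_fracAlg (D.mono_mem_fracAlg _) w
    | mul a b ha hb => rw [map_mul]; exact D.coeff_mul_mem_fracAlg ha hb w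
    | add a b ha hb =>
      rw [map_add, SkewMonoidAlgebra.coeff_add, Finsupp.add_apply]
      exact add_mem (ha w) (hb w)

end Representation

section Convergence

/-! ### Summable families and convergent products -/

section Summable
variable {ι κ : Type*}

theorem ConeLim.comp_tendsto {l : Filter ι} {l' : Filter κ} {F : ι → D.Ambient} {G : D.Ambient}
    (h : D.ConeLim l F G) {g : κ → ι} (hg : Tendsto g l' l) : D.ConeLim l' (fun k => F (g k)) G :=
  fun u => ⟨(h u).1, fun n => hg.eventually ((h u).2 n)⟩

/-- A family is summable if in every direction only finitely many members have terms of small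
height. -/
theorem exists_coneLim_sum [Finite I] (f : ι → D.Ambient)
    (h0 : ∀ u i, D.expand u (f i) ∈ D.cone u 0)
    (h : ∀ u n, {i | D.expand u (f i) ∉ D.cone u n}.Finite) :
    ∃ G, D.ConeLim atTop (fun s : Finset ι => ∑ i ∈ s, f i) G := by
  classical
  refine D.exists_coneLim (fun u => Eventually.of_forall fun s => ?_) fun u n => ?_
  · rw [map_sum]
    exact sum_mem fun i _ => h0 u i
  · refine ⟨Set.Ici (h u n).toFinset, mem_atTop _, ?_⟩
    have key : ∀ s, (h u n).toFinset ≤ s →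
        D.expand u (∑ i ∈ s, f i - ∑ i ∈ (h u n).toFinset, f i) ∈ D.cone u n := by
      intro s hs
      rw [← Finset.sum_sdiff hs, add_sub_cancel_right, map_sum]
      refine sum_mem fun i hi => ?_
      rw [Finset.mem_sdiff, Set.Finite.mem_toFinset, Set.mem_ofPred_eq, not_not] at hi
      exact hi.2
    intro s hs t ht
    have := (D.cone u n).sub_mem (key s hs) (key t ht)
    rwa [← map_sub, sub_sub_sub_cancel_right] at this

theorem prod_sub_one_mem_cone {u : D.W} {n : ℕ} (s : Finset ι) (f : ι → D.Ambient)
    (h : ∀ i ∈ s, D.expand u (f i - 1) ∈ D.cone u n) :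
    D.expand u (∏ i ∈ s, f i - 1) ∈ D.cone u n := by
  classical
  induction s using Finset.induction_on with
  | empty => rw [Finset.prod_empty, sub_self, map_zero]; exact (D.cone u n).zero_mem
  | insert a s ha ih =>
    have h1 := ih fun i hi => h i (Finset.mem_insert_of_mem hi)
    have h2 := h a (Finset.mem_insert_self a s)
    have h3 : D.expand u (∏ i ∈ s, f i) ∈ D.cone u 0 := by
      have := (D.cone u 0).add_mem (D.cone_le_zero h1) (D.one_mem_cone u)
      rwa [← map_one (D.expand u), ← map_add, sub_add_cancel] at this
    rw [Finset.prod_insert ha]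
    have e : f a * ∏ i ∈ s, f i - 1 = (f a - 1) * ∏ i ∈ s, f i + (∏ i ∈ s, f i - 1) := by ring
    rw [e, map_add, map_mul]
    exact (D.cone u n).add_mem (D.mul_mem_cone_left h2 h3) h1

/-- A product converges if in every direction only finitely many factors differ from `1` in terms of
small height. -/
theorem exists_coneLim_prod [Finite I] (f : ι → D.Ambient)
    (h0 : ∀ u i, D.expand u (f i) ∈ D.cone u 0)
    (h : ∀ u n, {i | D.expand u (f i - 1) ∉ D.cone u n}.Finite) :
    ∃ G, D.ConeLim atTop (fun s : Finset ι => ∏ i ∈ s, f i) G := by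
  classical
  refine D.exists_coneLim (fun u => Eventually.of_forall fun s => ?_) fun u n => ?_
  · rw [map_prod]
    exact D.prod_mem_cone s _ fun i _ => h0 u i
  · refine ⟨Set.Ici (h u n).toFinset, mem_atTop _, ?_⟩
    have key : ∀ s, (h u n).toFinset ≤ s →
        D.expand u (∏ i ∈ s, f i - ∏ i ∈ (h u n).toFinset, f i) ∈ D.cone u n := by
      intro s hs
      rw [← Finset.prod_sdiff hs, ← sub_one_mul, map_mul]
      refine D.mul_mem_cone_left (D.prod_sub_one_mem_cone _ f fun i hi => ?_) ?_
      · rw [Finset.mem_sdiff, Set.Finite.mem_toFinset, Set.mem_ofPred_eq, not_not] at hi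
        exact hi.2
      · rw [map_prod]
        exact D.prod_mem_cone _ _ fun i _ => h0 u i
    intro s hs t ht
    have := (D.cone u n).sub_mem (key s hs) (key t ht)
    rwa [← map_sub, sub_sub_sub_cancel_right] at this

end Summable

/-! ### Reflections -/

section Reflections
variable [FiniteDimensional ℝ V]

/-- A reflection is determined by its coroot. -/
theorem conj_r_eq {g g' : D.W} {i j : I}
    (hc : (g : V ≃ₗ[ℝ] V) (D.coroot i) = (g' : V ≃ₗ[ℝ] V) (D.coroot j)) :
    g * D.r i * g⁻¹ = g' * D.r j * g'⁻¹ := by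
  have hc' : ((g'⁻¹ * g : D.W) : V ≃ₗ[ℝ] V) (D.coroot i) = D.coroot j := by
    rw [coe_mul_apply, hc]
    exact (g' : V ≃ₗ[ℝ] V).symm_apply_apply _
  have hr := D.root_eq_of_coroot_eq hc'
  have h : g'⁻¹ * g * D.r i * (g'⁻¹ * g)⁻¹ = D.r j := by
    refine Subtype.ext (LinearEquiv.ext fun v => ?_)
    rw [coe_mul_apply, coe_mul_apply, r_apply, r_apply, map_sub, map_smul, hc', ← hr,
      dualAct_apply, ← coe_mul_apply, mul_inv_cancel]
    rfl
  calc g * D.r i * g⁻¹ = g' * (g'⁻¹ * g * D.r i * (g'⁻¹ * g)⁻¹) * g'⁻¹ := by group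
    _ = _ := by rw [h]

/-- The strong exchange property: a reflection `g r_i g⁻¹` shortens `x` if `x⁻¹` makes the positive
coroot `g α_i^∨` negative. -/
theorem length_conj_r_mul_lt {g x : D.W} {i : I} (h : (g : V ≃ₗ[ℝ] V) (D.coroot i) ∈ D.Qpos)
    (hx : -((x⁻¹ * g : D.W) : V ≃ₗ[ℝ] V) (D.coroot i) ∈ D.Qpos) :
    D.length (g * D.r i * g⁻¹ * x) < D.length x := by
  have key : ∀ (l : List I) (g : D.W), (g : V ≃ₗ[ℝ] V) (D.coroot i) ∈ D.Qpos →
      -(((D.wordProd l)⁻¹ * g : D.W) : V ≃ₗ[ℝ] V) (D.coroot i) ∈ D.Qpos →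
      ∃ l' : List I, l'.length < l.length ∧ D.wordProd l' = g * D.r i * g⁻¹ * D.wordProd l := by
    intro l
    induction l with
    | nil =>
      intro g h h'
      rw [wordProd_nil, inv_one, one_mul] at h'
      exact absurd (D.Qpos_antisymm h h') (D.coroot_ne_zero g i)
    | cons j l ih =>
      intro g h h'
      have e : (D.wordProd (j :: l))⁻¹ * g = (D.wordProd l)⁻¹ * (D.r j * g) := by
        rw [wordProd_cons, mul_inv_rev, inv_eq_of_mul_eq_one_right (D.r_mul_self j), mul_assoc]
      rw [e] at h'
      by_cases h2 : D.length (D.r j * g) < D.length (D.r j * g * D.r i)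
      · obtain ⟨l', hl, hl'⟩ := ih _ (D.coroot_pos h2) h'
        refine ⟨j :: l', by simpa using hl, ?_⟩
        rw [wordProd_cons, hl', wordProd_cons, mul_inv_rev,
          inv_eq_of_mul_eq_one_right (D.r_mul_self j)]
        simp only [mul_assoc, r_mul_r_mul]
      · have h3 := D.length_mul_r_of_not_lt h2
        have h4 := (D.eq_simple_of_r_neg (D.lt_of_coroot_pos h) (i := j) (by omega)).1
        have h5 := D.conj_r_eq (g := g) (g' := 1) (i := i) (j := j) h4
        refine ⟨l, by simp, ?_⟩
        rw [h5, one_mul, inv_one, mul_one, wordProd_cons, r_mul_r_mul]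
  have hl := D.wordProd_reducedWord x
  obtain ⟨l', h1, h2⟩ := key (D.reducedWord x) g h (by rwa [hl])
  rw [hl] at h2
  rw [← h2, ← D.reducedWord_length x]
  exact (D.length_wordProd_le l').trans_lt h1

/-- The reflections whose coroots have bounded height have bounded length. -/
theorem exists_length_conj_r_le [Finite I] (N : ℕ) : ∃ L : ℕ, ∀ (g : D.W) (i : I),
    (g : V ≃ₗ[ℝ] V) (D.coroot i) ∈ D.Qpos → D.height ((g : V ≃ₗ[ℝ] V) (D.coroot i)) < N →
    D.length (g * D.r i * g⁻¹) ≤ L := by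
  have h1 : ∀ q : V, ∃ L : ℕ, ∀ (g : D.W) (i : I), (g : V ≃ₗ[ℝ] V) (D.coroot i) = q →
      D.length (g * D.r i * g⁻¹) ≤ L := by
    intro q
    by_cases hq : ∃ (g : D.W) (i : I), (g : V ≃ₗ[ℝ] V) (D.coroot i) = q
    · obtain ⟨g, i, hg⟩ := hq
      exact ⟨D.length (g * D.r i * g⁻¹), fun g' j hg' => by rw [D.conj_r_eq (hg.trans hg'.symm)]⟩
    · exact ⟨0, fun g i hg => absurd ⟨g, i, hg⟩ hq⟩
  choose L hL using h1
  obtain ⟨B, hB⟩ := ((D.finite_height_le N).image L).bddAbove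
  exact ⟨B, fun g i hg hN => (hL _ g i rfl).trans (hB ⟨_, ⟨hg, hN.le⟩, rfl⟩)⟩

end Reflections

/-! ### Expansion of the coefficients of the elements `T_w` -/

theorem opT_mul_coeff (i : I) (x : D.Twisted) (v : D.W) : (D.opT i * x).coeff v =
    D.cSimple i * D.r i • x.coeff (D.r i * v) + D.bSimple i * x.coeff v := by
  rw [opT, add_mul, SkewMonoidAlgebra.coeff_add, Finsupp.add_apply,
    SkewMonoidAlgebra.coeff_single_mul, SkewMonoidAlgebra.coeff_single_one_mul,
    inv_eq_of_mul_eq_one_right (D.r_mul_self i)]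

theorem mul_opT_coeff (i : I) (x : D.Twisted) (v : D.W) : (x * D.opT i).coeff v =
    x.coeff (v * D.r i) * (v * D.r i) • D.cSimple i + x.coeff v * v • D.bSimple i := by
  rw [opT, mul_add, SkewMonoidAlgebra.coeff_add, Finsupp.add_apply,
    SkewMonoidAlgebra.coeff_mul_single, SkewMonoidAlgebra.coeff_mul_single_one,
    inv_eq_of_mul_eq_one_right (D.r_mul_self i)]

variable [Finite I] [FiniteDimensional ℝ V]

theorem expand_cSimple_mem (i : I) (u : D.W) : D.expand u (D.cSimple i) ∈ D.cone u 0 :=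
  D.expand_cFun_mem_zero _ _ (D.regular_simpleCoroot i) u

theorem expand_bSimple_mem (i : I) (u : D.W) : D.expand u (D.bSimple i) ∈ D.cone u 0 :=
  D.expand_bFun_mem_zero _ _ (D.regular_simpleCoroot i) u

omit [Finite I] [FiniteDimensional ℝ V] in
theorem expand_r_smul_mem {i : I} {u : D.W} {n : ℕ} {F : D.Ambient}
    (h : D.expand (D.r i * u) F ∈ D.cone (D.r i * u) n) :
    D.expand u (D.r i • F) ∈ D.cone u n := by
  refine D.smul_mem_cone ?_
  rwa [inv_eq_of_mul_eq_one_right (D.r_mul_self i)]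

omit [Finite I] [FiniteDimensional ℝ V] in
theorem one_coeff_of_ne {v : D.W} (h : v ≠ 1) : (1 : D.Twisted).coeff v = 0 := by
  rw [SkewMonoidAlgebra.one_def, SkewMonoidAlgebra.coeff_single, Finsupp.single_eq_of_ne h]

omit [Finite I] [FiniteDimensional ℝ V] in
theorem opTW_induction {p : D.W → Prop} (h1 : p 1)
    (h : ∀ i w, D.length w < D.length (D.r i * w) → p w → p (D.r i * w)) (w : D.W) : p w := by
  induction hn : D.length w using Nat.strong_induction_on generalizing w with
  | _ n ih =>
    by_cases hw : w = 1
    · rwa [hw]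
    · obtain ⟨l, hl, rfl⟩ := D.exists_reduced w
      cases l with
      | nil => exact absurd D.wordProd_nil hw
      | cons i l =>
        have h2 := D.length_wordProd_le l
        rw [List.length_cons] at hl
        rw [wordProd_cons] at hl hn ⊢
        refine h i _ ?_ (ih _ ?_ _ rfl) <;> omega

theorem expand_opTW_coeff_mem (w u v : D.W) : D.expand u ((D.opTW w).coeff v) ∈ D.cone u 0 := by
  induction w using D.opTW_induction generalizing u v with
  | h1 =>
    rw [opTW_one]
    by_cases hv : v = 1
    · rw [hv, SkewMonoidAlgebra.one_def, SkewMonoidAlgebra.coeff_single, Finsupp.single_eq_same,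
        map_one]
      exact D.one_mem_cone u
    · rw [D.one_coeff_of_ne hv, map_zero]; exact (D.cone u 0).zero_mem
  | h i w hw ih =>
    rw [D.opTW_r_mul hw, opT_mul_coeff, map_add, map_mul (D.expand u), map_mul (D.expand u)]
    exact (D.cone u 0).add_mem
      (D.mul_mem_cone_left (D.expand_cSimple_mem i u) (D.expand_r_smul_mem (ih _ _)))
      (D.mul_mem_cone_left (D.expand_bSimple_mem i u) (ih _ _))

/-- The terms of small height in the coefficient of `[v]` of `T_w` vanish unless `u⁻¹w` is not much
longer than `u⁻¹v`: the term `b(α_i^∨)` of `T_i` in `T_{r_i w} = T_i T_w` costs the height of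
`u⁻¹α_i^∨` if this coroot is positive, and `u⁻¹r_i w` is shorter than `u⁻¹w` if it is negative. -/
theorem expand_opTW_coeff_mem_of_lt {N L : ℕ} (hL : ∀ (g : D.W) (i : I),
      (g : V ≃ₗ[ℝ] V) (D.coroot i) ∈ D.Qpos → D.height ((g : V ≃ₗ[ℝ] V) (D.coroot i)) < N →
      D.length (g * D.r i * g⁻¹) ≤ L) (w u v : D.W) {n : ℕ} (hn : n ≤ N)
    (h : D.length (u⁻¹ * v) + n * L < D.length (u⁻¹ * w)) :
    D.expand u ((D.opTW w).coeff v) ∈ D.cone u n := by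
  induction w using D.opTW_induction generalizing u v n with
  | h1 =>
    have hv : v ≠ 1 := by
      rintro rfl
      omega
    rw [opTW_one, D.one_coeff_of_ne hv, map_zero]
    exact (D.cone u n).zero_mem
  | h i w hw ih =>
    have hri : (D.r i)⁻¹ = D.r i := inv_eq_of_mul_eq_one_right (D.r_mul_self i)
    have hreg := D.regular_simpleCoroot i
    have hco : ((u⁻¹ • D.simpleCoroot i : D.Y) : V)
        = ((u⁻¹ : D.W) : V ≃ₗ[ℝ] V) (D.coroot i) := rfl
    have hneg : -((u⁻¹ • (-D.simpleCoroot i) : D.Y) : V)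
        = ((u⁻¹ : D.W) : V ≃ₗ[ℝ] V) (D.coroot i) := by
      rw [smul_neg, AddSubgroup.coe_neg, neg_neg, hco]
    have hconj : u⁻¹ * (D.r i * w) = u⁻¹ * D.r i * (u⁻¹)⁻¹ * (u⁻¹ * w) := by group
    rw [D.opTW_r_mul hw, opT_mul_coeff, map_add, map_mul (D.expand u), map_mul (D.expand u)]
    refine (D.cone u n).add_mem (D.mul_mem_cone_right (D.expand_cSimple_mem i u)
      (D.expand_r_smul_mem (ih _ _ hn ?_))) ?_
    · rw [mul_inv_rev, hri, mul_assoc, r_mul_r_mul, mul_assoc]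
      exact h
    rcases D.corootOf_pos_or_neg u (D.mkRoot 1 i) with hp | hp
    -- The height `k ≥ 1` of the factor `b` pays for one reflection, of length at most `L`.
    · rw [corootOf_mkRoot, one_smul, hco] at hp
      obtain ⟨k, hk, hk0⟩ := D.exists_nat_height hp
      have hk1 : 1 ≤ k := Nat.one_le_iff_ne_zero.2 fun h0 => D.coroot_ne_zero u⁻¹ i (hk0 h0)
      have hb : D.expand u (D.bSimple i) ∈ D.cone u k :=
        D.expand_bFun_mem _ _ hreg hk1 (D.mem_deep_of_neg (by rwa [hneg]) (by rw [hneg, hk]))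
      by_cases hkn : n ≤ k
      · exact D.mul_mem_cone_left (D.cone_mono u hkn hb) (D.expand_opTW_coeff_mem w u v)
      · have h1 := hL u⁻¹ i hp (by rw [hk]; exact_mod_cast (by omega : k < N))
        have h2 := D.length_mul_le (u⁻¹ * D.r i * (u⁻¹)⁻¹) (u⁻¹ * w)
        rw [← hconj] at h2
        have h3 : n * L = (n - 1) * L + L := by
          rw [← Nat.succ_mul]; congr 1; omega
        have h4 := ih u v (n := n - 1) (by omega) (by omega)
        exact D.cone_mono u (by omega) (D.mul_mem_cone hb h4)
    -- By strong exchange, `ℓ(u⁻¹r_i w) < ℓ(u⁻¹w)`.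
    · rw [corootOf_mkRoot, one_smul, hco] at hp
      refine D.mul_mem_cone_right (D.expand_bSimple_mem i u) (ih u v hn (h.trans ?_))
      have hm : ((u⁻¹ * D.r i : D.W) : V ≃ₗ[ℝ] V) (D.coroot i)
          = -((u⁻¹ : D.W) : V ≃ₗ[ℝ] V) (D.coroot i) := D.coroot_neg_of_mul_r _ _
      have hw' : ((w⁻¹ : D.W) : V ≃ₗ[ℝ] V) (D.coroot i) ∈ D.Qpos := by
        refine D.coroot_pos ?_
        rw [← length_inv, inv_inv, ← length_inv D (w⁻¹ * D.r i), mul_inv_rev, inv_inv, hri]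
        exact hw
      have h5 := D.length_conj_r_mul_lt (g := u⁻¹ * D.r i) (x := u⁻¹ * w) (i := i)
        (by rwa [hm]) (by
          have e : (u⁻¹ * w)⁻¹ * (u⁻¹ * D.r i) = w⁻¹ * D.r i := by group
          rw [e, coroot_neg_of_mul_r, neg_neg]
          exact hw')
      have e : u⁻¹ * D.r i * D.r i * (u⁻¹ * D.r i)⁻¹ * (u⁻¹ * w) = u⁻¹ * (D.r i * w) := by
        rw [mul_r_mul_r, mul_inv_rev, hri, inv_inv]
        group
      rwa [e] at h5

theorem finite_opTW_coeff_notMem (u v : D.W) (n : ℕ) :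
    {w | D.expand u ((D.opTW w).coeff v) ∉ D.cone u n}.Finite := by
  obtain ⟨L, hL⟩ := D.exists_length_conj_r_le n
  refine (D.ball_finite (D.length u + (D.length (u⁻¹ * v) + n * L))).subset fun w hw => ?_
  have h1 : D.length (u⁻¹ * w) ≤ D.length (u⁻¹ * v) + n * L := by
    by_contra hcon
    exact hw (D.expand_opTW_coeff_mem_of_lt hL w u v le_rfl (not_le.1 hcon))
  have h2 := D.length_mul_le u (u⁻¹ * w)
  rw [mul_inv_cancel_left] at h2
  exact h2.trans (Nat.add_le_add_left h1 _)

theorem expand_opTW_coeff_one_mem {w : D.W} (hw : w ≠ 1) :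
    D.expand 1 ((D.opTW w).coeff 1) ∈ D.cone 1 1 := by
  refine D.expand_opTW_coeff_mem_of_lt (N := 1) (L := 0) (fun g i hg h => ?_) w 1 1 le_rfl ?_
  · exact absurd h (not_lt.2 (by exact_mod_cast D.one_le_height hg (D.coroot_ne_zero g i)))
  · rw [inv_one, one_mul, one_mul, length_one]
    exact Nat.pos_of_ne_zero fun h => hw (D.eq_one_of_length_eq_zero h)

end Convergence

section Product

/-! ### The product `Δ` -/

/-- Elements whose expansions have units of `ℤ_σ` as constant terms and otherwise terms of positive
height are invertible. -/
theorem exists_mul_eq_one_of_leading [Finite I] {F : D.Ambient}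
    (h : ∀ u, ∃ s : (Coef T)ˣ, D.expand u (F - algebraMap (Coef T) D.Ambient s) ∈ D.cone u 1) :
    ∃ G : D.Ambient, F * G = 1 ∧ ∀ u, D.expand u G ∈ D.cone u 0 := by
  choose s hs using h
  have h1 : ∀ u, -(D.expand u (algebraMap (Coef T) D.Ambient ((s u)⁻¹ : (Coef T)ˣ)) *
      D.expand u (F - algebraMap (Coef T) D.Ambient (s u))) ∈ D.cone u 1 := fun u =>
    (D.cone u 1).neg_mem (D.mul_mem_cone_right (D.algebraMap_mem_cone u _) (hs u))
  choose G hG hG' using fun u => D.exists_mul_eq_one (h1 u)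
  refine ⟨show D.Ambient from fun u =>
    D.expand u (algebraMap (Coef T) D.Ambient ((s u)⁻¹ : (Coef T)ˣ)) * G u, funext fun u => ?_,
    fun u => D.mul_mem_cone_left (D.algebraMap_mem_cone u _) (hG u)⟩
  have h2 : D.expand u (algebraMap (Coef T) D.Ambient (s u)) *
      D.expand u (algebraMap (Coef T) D.Ambient ((s u)⁻¹ : (Coef T)ˣ)) = 1 := by
    rw [← map_mul, ← map_mul, Units.mul_inv, map_one, map_one]
  have h3 := hG' u
  change D.expand u F * (D.expand u (algebraMap (Coef T) D.Ambient ((s u)⁻¹ : (Coef T)ˣ)) * G u) = 1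
  rw [map_sub] at h3
  linear_combination h3 + G u * h2

theorem exists_leading_cFun [Finite I] (t t' : (Coef T)ˣ) {y : D.Y} (h : D.Regular y) (u : D.W) :
    ∃ s : (Coef T)ˣ, D.expand u (D.cFun t t' y - algebraMap (Coef T) D.Ambient s) ∈ D.cone u 1 := by
  rcases h u with hu | hu
  · exact ⟨_, D.expand_cFun_sub_mem t t' h le_rfl hu⟩
  · exact ⟨_, D.expand_cFun_sub_mem' t t' h le_rfl hu⟩

theorem isUnit_cFun [Finite I] (t t' : (Coef T)ˣ) {y : D.Y} (h : D.Regular y) :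
    IsUnit (D.cFun t t' y) := by
  obtain ⟨G, hG, -⟩ := D.exists_mul_eq_one_of_leading (D.exists_leading_cFun t t' h)
  exact IsUnit.of_mul_eq_one G hG

variable [Finite I] [FiniteDimensional ℝ V]

omit [Finite I] in
theorem regular_neg_corootOf (a : D.posRoots) : D.Regular (-D.corootOf (D.posToRoot a)) :=
  (D.regular_corootOf _).neg

theorem deltaFactor_mem_fracAlg (a : D.posRoots) : D.deltaFactor a ∈ D.fracAlg :=
  mul_mem (Subalgebra.algebraMap_mem _ _) (D.cFun_mem_fracAlg _ _ (D.regular_neg_corootOf a))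

theorem expand_deltaFactor_mem (u : D.W) (a : D.posRoots) :
    D.expand u (D.deltaFactor a) ∈ D.cone u 0 := by
  rw [deltaFactor, map_mul]
  exact D.mul_mem_cone_left (D.algebraMap_mem_cone u _)
    (D.expand_cFun_mem_zero _ _ (D.regular_neg_corootOf a) u)

theorem exists_deltaFactor_mul_eq_one (a : D.posRoots) :
    ∃ G ∈ D.fracAlg, D.deltaFactor a * G = 1 ∧ ∀ u, D.expand u G ∈ D.cone u 0 := by
  have h := D.regular_neg_corootOf a
  obtain ⟨G, hG, hG'⟩ := D.exists_mul_eq_one_of_leading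
    (D.exists_leading_cFun (D.sigRoot (D.posToRoot a)) (D.sigRoot' (D.posToRoot a)) h)
  have h1 : D.deltaFactor a * (algebraMap (Coef T) D.Ambient
      ((D.sigRoot (D.posToRoot a))⁻¹ : (Coef T)ˣ) * G) = 1 := by
    have h2 : algebraMap (Coef T) D.Ambient (D.sigRoot (D.posToRoot a)) *
        algebraMap (Coef T) D.Ambient ((D.sigRoot (D.posToRoot a))⁻¹ : (Coef T)ˣ) = 1 := by
      rw [← map_mul, Units.mul_inv, map_one]
    rw [deltaFactor, mul_mul_mul_comm, h2, hG, one_mul]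
  refine ⟨_, D.inverse_mem_fracAlg (D.deltaFactor_mem_fracAlg a) h1, h1, fun u => ?_⟩
  rw [map_mul]
  exact D.mul_mem_cone_left (D.algebraMap_mem_cone u _) (hG' u)

theorem expand_deltaFactor_sub_one_mem {u : D.W} {n : ℕ} (hn : 1 ≤ n) {a : D.posRoots}
    (h : (show D.Dir u from (-D.corootOf (D.posToRoot a) : D.Y)) ∈ D.deep u n) :
    D.expand u (D.deltaFactor a - 1) ∈ D.cone u n := by
  have h1 := D.expand_cFun_sub_mem (D.sigRoot (D.posToRoot a)) (D.sigRoot' (D.posToRoot a))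
    (D.regular_neg_corootOf a) hn h
  have e : D.deltaFactor a - 1 = algebraMap (Coef T) D.Ambient (D.sigRoot (D.posToRoot a)) *
      (D.cFun (D.sigRoot (D.posToRoot a)) (D.sigRoot' (D.posToRoot a))
        (-D.corootOf (D.posToRoot a)) -
      algebraMap (Coef T) D.Ambient ((D.sigRoot (D.posToRoot a))⁻¹ : (Coef T)ˣ)) := by
    rw [mul_sub, ← map_mul, Units.mul_inv, map_one, deltaFactor]
  rw [e, map_mul]
  exact D.mul_mem_cone_right (D.algebraMap_mem_cone u _) h1

omit [Finite I] [FiniteDimensional ℝ V] in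
theorem neg_smul_neg_corootOf (u : D.W) (a : D.roots) :
    -((u⁻¹ • (-D.corootOf a) : D.Y) : V) = ((u⁻¹ • D.corootOf a : D.Y) : V) := by
  rw [smul_neg, AddSubgroup.coe_neg, neg_neg]

theorem expand_one_deltaFactor_sub_one_mem (a : D.posRoots) :
    D.expand 1 (D.deltaFactor a - 1) ∈ D.cone 1 1 := by
  have h := D.corootOf_posToRoot_mem a
  have e := D.neg_smul_neg_corootOf 1 (D.posToRoot a)
  have h0 : ((D.corootOf (D.posToRoot a) : D.Y) : V) ≠ 0 := D.coroot_ne_zero _ _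
  rw [inv_one, one_smul, one_smul] at e
  refine D.expand_deltaFactor_sub_one_mem le_rfl (D.mem_deep_of_neg ?_ ?_)
  · rwa [inv_one, one_smul, e]
  · rw [inv_one, one_smul, e, Nat.cast_one]
    exact D.one_le_height h h0

omit [Finite I] [FiniteDimensional ℝ V] in
theorem posToRoot_injective : Function.Injective D.posToRoot :=
  fun a b h => by
    have h1 : a.1 = b.1 := congrArg (fun c : D.roots => c.1) h
    exact Subtype.ext h1

/-- In every direction, only finitely many factors of `Δ` have a term of small height besides the
constant term `1`. -/
theorem finite_deltaFactor_notMem (u : D.W) (n : ℕ) :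
    {a | D.expand u (D.deltaFactor a - 1) ∉ D.cone u n}.Finite := by
  have hinj : Function.Injective fun a : D.posRoots =>
      ((u⁻¹ • D.corootOf (D.posToRoot a) : D.Y) : V) :=
    Subtype.val_injective.comp ((MulAction.injective (β := D.Y) u⁻¹).comp
      (D.corootOf_injective.comp D.posToRoot_injective))
  refine ((D.inversions_finite u).union
    ((D.finite_height_le n).preimage hinj.injOn)).subset fun a ha => ?_
  rcases D.corootOf_pos_or_neg u (D.posToRoot a) with h | h
  · right
    refine ⟨h, ?_⟩
    by_contra hcon
    have h0 : ((u⁻¹ • D.corootOf (D.posToRoot a) : D.Y) : V) ≠ 0 := by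
      rw [corootOf, ← mul_smul]
      exact D.coroot_ne_zero _ _
    have h1 := D.one_le_height h h0
    refine ha (D.cone_mono u (le_max_left n 1)
      (D.expand_deltaFactor_sub_one_mem (le_max_right n 1) (D.mem_deep_of_neg ?_ ?_)))
    · rwa [neg_smul_neg_corootOf]
    · rw [neg_smul_neg_corootOf, Nat.cast_max, Nat.cast_one]
      exact max_le (not_le.1 hcon).le h1
  · exact Or.inl h

/-- `Δ` and its inverse are limits of finite products of the factors of `Δ` and of their
inverses. -/
theorem exists_delta : ∃ (Delta Delta' : D.Ambient) (f' : D.posRoots → D.Ambient),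
    D.ConeLim atTop (fun s : Finset D.posRoots => ∏ a ∈ s, D.deltaFactor a) Delta ∧
    (∀ a, f' a ∈ D.fracAlg) ∧
    D.ConeLim atTop (fun s : Finset D.posRoots => ∏ a ∈ s, f' a) Delta' ∧ Delta * Delta' = 1 := by
  choose f' hf hf1 hf0 using D.exists_deltaFactor_mul_eq_one
  obtain ⟨Delta, h⟩ := D.exists_coneLim_prod D.deltaFactor D.expand_deltaFactor_mem
    D.finite_deltaFactor_notMem
  obtain ⟨Delta', h'⟩ := D.exists_coneLim_prod f' (fun u a => hf0 a u) fun u n => by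
    refine (D.finite_deltaFactor_notMem u n).subset fun a ha ha' => ha ?_
    have e : f' a - 1 = -((D.deltaFactor a - 1) * f' a) := by linear_combination hf1 a
    rw [e, map_neg, map_mul]
    exact (D.cone u n).neg_mem (D.mul_mem_cone_left ha' (hf0 a u))
  refine ⟨Delta, Delta', f', h, hf, h', ?_⟩
  refine ConeLim.unique D ((ConeLim.mul D h h').congr D (Eventually.of_forall fun s => ?_))
    (D.coneLim_const (l := atTop) (G := 1) fun u => by rw [map_one]; exact D.one_mem_cone u)
  rw [← Finset.prod_mul_distrib]
  exact Finset.prod_eq_one fun a _ => hf1 a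

omit [Finite I] in
/-- `σ_i c(-α_i^∨)` -/
theorem deltaFactor_simplePosRoot (i : I) : D.deltaFactor (D.simplePosRoot i) =
    algebraMap (Coef T) D.Ambient (D.sig i) * D.cFun (D.sig i) (D.sig' i) (-D.simpleCoroot i) := by
  have h : D.posToRoot (D.simplePosRoot i) = D.mkRoot 1 i := rfl
  rw [deltaFactor, h, sigRoot_mkRoot, sigRoot'_mkRoot, corootOf_mkRoot, one_smul]

theorem r_smul_deltaFactor {i : I} {a b : D.posRoots} (h : b.1 = D.dualAct (D.r i) a.1) :
    D.r i • D.deltaFactor a = D.deltaFactor b := by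
  obtain ⟨w, j, hw, rfl⟩ := D.exists_mkPosRoot a
  have ha : D.posToRoot (D.mkPosRoot w j hw) = D.mkRoot w j := rfl
  have hb : D.posToRoot b = D.mkRoot (D.r i * w) j :=
    Subtype.ext (h.trans (D.dualAct_mul _ _ _).symm)
  have hreg := D.regular_neg_corootOf (D.mkPosRoot w j hw)
  rw [deltaFactor, smul_mul', smul_algebraMap', D.smul_cFun _ _ _ hreg, deltaFactor, hb, ha,
    sigRoot_mkRoot, sigRoot'_mkRoot, corootOf_mkRoot, sigRoot_mkRoot, sigRoot'_mkRoot,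
    corootOf_mkRoot, smul_neg, mul_smul]

/-- As `r_i` permutes the positive roots other than `α_i`, it changes only one factor of `Δ`. -/
theorem r_smul_delta {Delta : D.Ambient}
    (h : D.ConeLim atTop (fun s : Finset D.posRoots => ∏ a ∈ s, D.deltaFactor a) Delta) (i : I) :
    D.r i • Delta * D.cFun (D.sig i) (D.sig' i) (-D.simpleCoroot i) = Delta * D.cSimple i := by
  classical
  have hreg := D.regular_simpleCoroot i
  choose! p hp hp' using D.exists_r_smul_posRoot i
  have hpp : ∀ a, a ≠ D.simplePosRoot i → p (p a) = a := fun a ha => by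
    refine Subtype.ext ?_
    rw [hp' _ (hp a ha), hp' a ha, ← dualAct_mul, r_mul_self, dualAct_one]
  let S : Finset D.posRoots → Finset D.posRoots := fun s =>
    insert (D.simplePosRoot i) (s ∪ (s.erase (D.simplePosRoot i)).image p)
  have hS : Tendsto S atTop atTop :=
    tendsto_atTop_mono (fun s => (Finset.subset_union_left.trans (Finset.subset_insert _ _) :
      s ⊆ S s)) tendsto_id
  have hmem : ∀ s, ∀ a ∈ (S s).erase (D.simplePosRoot i),
      p a ∈ (S s).erase (D.simplePosRoot i) := by
    intro s a ha
    rw [Finset.mem_erase] at ha ⊢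
    refine ⟨hp a ha.1, ?_⟩
    rcases Finset.mem_insert.1 ha.2 with h1 | h1
    · exact absurd h1 ha.1
    refine Finset.mem_insert_of_mem ?_
    rcases Finset.mem_union.1 h1 with h1 | h1
    · exact Finset.mem_union_right _
        (Finset.mem_image_of_mem p (Finset.mem_erase.2 ⟨ha.1, h1⟩))
    · obtain ⟨b, hb, rfl⟩ := Finset.mem_image.1 h1
      rw [hpp b (Finset.ne_of_mem_erase hb)]
      exact Finset.mem_union_left _ (Finset.mem_of_mem_erase hb)
  have key : ∀ s, D.r i • (∏ a ∈ S s, D.deltaFactor a) *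
      D.cFun (D.sig i) (D.sig' i) (-D.simpleCoroot i) =
      (∏ a ∈ S s, D.deltaFactor a) * D.cSimple i := by
    intro s
    have hsi : D.simplePosRoot i ∈ S s := Finset.mem_insert_self _ _
    have h1 : D.r i • ∏ a ∈ (S s).erase (D.simplePosRoot i), D.deltaFactor a =
        ∏ a ∈ (S s).erase (D.simplePosRoot i), D.deltaFactor a := by
      rw [Finset.smul_prod']
      refine Finset.prod_bij' (fun a _ => p a) (fun a _ => p a) (hmem s) (hmem s)
        (fun a ha => hpp a (Finset.ne_of_mem_erase ha))
        (fun a ha => hpp a (Finset.ne_of_mem_erase ha)) fun a ha => ?_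
      exact D.r_smul_deltaFactor (hp' a (Finset.ne_of_mem_erase ha))
    have h2 : D.r i • D.deltaFactor (D.simplePosRoot i) =
        algebraMap (Coef T) D.Ambient (D.sig i) * D.cSimple i := by
      rw [deltaFactor_simplePosRoot, smul_mul', smul_algebraMap', D.smul_cFun _ _ _ hreg.neg,
        r_smul_neg_self, cSimple]
    rw [← Finset.mul_prod_erase _ _ hsi, smul_mul', h1, h2, deltaFactor_simplePosRoot]
    ring
  have h1 := ConeLim.comp_tendsto D h hS
  refine ConeLim.unique D (ConeLim.mul D (ConeLim.smul D h1 (D.r i)) (D.coneLim_const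
    (G := D.cFun (D.sig i) (D.sig' i) (-D.simpleCoroot i))
    (D.expand_cFun_mem_zero _ _ hreg.neg))) ?_
  exact (ConeLim.mul D h1 (D.coneLim_const (D.expand_cSimple_mem i))).congr D
    (Eventually.of_forall fun s => (key s).symm)

/-! ### The sum `P_σ` -/

/-- `∑_{w ∈ s} σ_w T_w` -/
def partialSum (s : Finset D.W) : D.Twisted := ∑ w ∈ s, (D.sigW w : Coef T) • D.opTW w

omit [Finite I] [FiniteDimensional ℝ V] in
theorem twisted_sum_coeff {ι : Type*} (s : Finset ι) (x : ι → D.Twisted) (v : D.W) :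
    (∑ i ∈ s, x i).coeff v = ∑ i ∈ s, (x i).coeff v := by
  have h := map_sum (SkewMonoidAlgebra.coeffAddEquiv (k := D.Ambient) (G := D.W)) x s
  exact (DFunLike.congr_fun h v).trans (Finsupp.finsetSum_apply _ _ _)

omit [Finite I] [FiniteDimensional ℝ V] in
theorem partialSum_coeff (s : Finset D.W) (v : D.W) :
    (D.partialSum s).coeff v = ∑ w ∈ s, (D.sigW w : Coef T) • (D.opTW w).coeff v := by
  rw [partialSum, twisted_sum_coeff]
  refine Finset.sum_congr rfl fun w _ => ?_
  rw [SkewMonoidAlgebra.coeff_smul, Finsupp.smul_apply]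

omit [Finite I] [FiniteDimensional ℝ V] in
theorem expand_smul_mem {u : D.W} {n : ℕ} {F : D.Ambient} (c : Coef T)
    (h : D.expand u F ∈ D.cone u n) : D.expand u (c • F) ∈ D.cone u n := by
  rw [Algebra.smul_def, map_mul]
  exact D.mul_mem_cone_right (D.algebraMap_mem_cone u c) h

theorem exists_partialSum_coneLim (v : D.W) :
    ∃ G, D.ConeLim atTop (fun s => (D.partialSum s).coeff v) G := by
  obtain ⟨G, hG⟩ := D.exists_coneLim_sum
    (fun w => (D.sigW w : Coef T) • (D.opTW w).coeff v)
    (fun u w => D.expand_smul_mem _ (D.expand_opTW_coeff_mem w u v))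
    (fun u n => (D.finite_opTW_coeff_notMem u v n).subset
      fun w hw hw' => hw (D.expand_smul_mem _ hw'))
  exact ⟨G, hG.congr D (Eventually.of_forall fun s => (D.partialSum_coeff s v).symm)⟩

/-- The coefficient `C_v` of `[v]` in `P_σ`. -/
def symCoeff (v : D.W) : D.Ambient := (D.exists_partialSum_coneLim v).choose

theorem coneLim_symCoeff (v : D.W) :
    D.ConeLim atTop (fun s => (D.partialSum s).coeff v) (D.symCoeff v) :=
  (D.exists_partialSum_coneLim v).choose_spec

theorem partialSum_coeff_mem (s : Finset D.W) (v : D.W) :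
    (D.partialSum s).coeff v ∈ D.fracAlg := by
  rw [partialSum_coeff]
  exact sum_mem fun w _ => D.fracAlg.smul_mem (D.opTW_coeff_mem w v) _

/-- `σ_w T_w + σ_{r_i w} T_{r_i w}` is multiplied by `σ_i` under `T_i`. -/
theorem opT_mul_pair {i : I} {w : D.W} (h : D.length w < D.length (D.r i * w)) :
    D.opT i * ((D.sigW w : Coef T) • D.opTW w + (D.sigW (D.r i * w) : Coef T) • D.opTW (D.r i * w))
      =
    (D.sig i : Coef T) •
      ((D.sigW w : Coef T) • D.opTW w + (D.sigW (D.r i * w) : Coef T) • D.opTW (D.r i * w)) := by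
  have h1 := D.opT_mul_opTW_of_gt (i := i) (w := D.r i * w) (by rwa [r_mul_r_mul])
  rw [r_mul_r_mul] at h1
  rw [mul_add, mul_smul_comm, mul_smul_comm, h1, D.sigW_r_mul h, ← D.opTW_r_mul h, Units.val_mul]
  have e : (D.sig i : Coef T) * ((D.sig i)⁻¹ : (Coef T)ˣ) = 1 := Units.mul_inv _
  match_scalars
  · linear_combination -(D.sigW w : Coef T) * e
  · ring

theorem pair_mul_opT {i : I} {w : D.W} (h : D.length w < D.length (w * D.r i)) :
    ((D.sigW w : Coef T) • D.opTW w + (D.sigW (w * D.r i) : Coef T) • D.opTW (w * D.r i)) * D.opT i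
      =
    (D.sig i : Coef T) •
      ((D.sigW w : Coef T) • D.opTW w + (D.sigW (w * D.r i) : Coef T) • D.opTW (w * D.r i)) := by
  have h1 := D.opTW_mul_opT_of_gt (i := i) (w := w * D.r i) (by rwa [mul_r_mul_r])
  rw [mul_r_mul_r] at h1
  rw [add_mul, smul_mul_assoc, smul_mul_assoc, h1, D.sigW_mul_r h, ← D.opTW_mul_r h, Units.val_mul]
  have e : (D.sig i : Coef T) * ((D.sig i)⁻¹ : (Coef T)ˣ) = 1 := Units.mul_inv _
  match_scalars
  · linear_combination -(D.sigW w : Coef T) * e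
  · ring

end Product

section Eigenvector

variable [Finite I] [FiniteDimensional ℝ V]

theorem opT_mul_partialSum (i : I) {s : Finset D.W} (hs : ∀ w ∈ s, D.r i * w ∈ s) :
    D.opT i * D.partialSum s = (D.sig i : Coef T) • D.partialSum s := by
  rw [← sub_eq_zero, partialSum, Finset.mul_sum, Finset.smul_sum, ← Finset.sum_sub_distrib]
  refine Finset.sum_involution (fun w _ => D.r i * w) (fun w _ => ?_) (fun w _ _ h => ?_) hs
    fun w _ => D.r_mul_r_mul i w
  · have key : ∀ w, D.length w < D.length (D.r i * w) →
        D.opT i * (D.sigW w : Coef T) • D.opTW w -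
          (D.sig i : Coef T) • (D.sigW w : Coef T) • D.opTW w +
        (D.opT i * (D.sigW (D.r i * w) : Coef T) • D.opTW (D.r i * w) -
          (D.sig i : Coef T) • (D.sigW (D.r i * w) : Coef T) • D.opTW (D.r i * w)) = 0 := by
      intro w h
      rw [sub_add_sub_comm, ← mul_add, ← smul_add, D.opT_mul_pair h, sub_self]
    rcases D.length_r_mul i w with h | h
    · exact key w (by omega)
    · have h1 := key (D.r i * w) (by rw [r_mul_r_mul]; omega)
      rwa [r_mul_r_mul, add_comm] at h1
  · have h1 := D.length_r_mul i w
    rw [h] at h1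
    omega

theorem partialSum_mul_opT (i : I) {s : Finset D.W} (hs : ∀ w ∈ s, w * D.r i ∈ s) :
    D.partialSum s * D.opT i = (D.sig i : Coef T) • D.partialSum s := by
  rw [← sub_eq_zero, partialSum, Finset.sum_mul, Finset.smul_sum, ← Finset.sum_sub_distrib]
  refine Finset.sum_involution (fun w _ => w * D.r i) (fun w _ => ?_) (fun w _ _ h => ?_) hs
    fun w _ => D.mul_r_mul_r i w
  · have key : ∀ w, D.length w < D.length (w * D.r i) →
        (D.sigW w : Coef T) • D.opTW w * D.opT i -
          (D.sig i : Coef T) • (D.sigW w : Coef T) • D.opTW w +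
        ((D.sigW (w * D.r i) : Coef T) • D.opTW (w * D.r i) * D.opT i -
          (D.sig i : Coef T) • (D.sigW (w * D.r i) : Coef T) • D.opTW (w * D.r i)) = 0 := by
      intro w h
      rw [sub_add_sub_comm, ← add_mul, ← smul_add, D.pair_mul_opT h, sub_self]
    rcases D.length_mul_r w i with h | h
    · exact key w (by omega)
    · have h1 := key (w * D.r i) (by rw [mul_r_mul_r]; omega)
      rwa [mul_r_mul_r, add_comm] at h1
  · have h1 := D.length_mul_r w i
    rw [h] at h1
    omega

omit [Finite I] [FiniteDimensional ℝ V] in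
/-- Finite subsets of `W^v` stable under an involution are cofinal. -/
theorem exists_stable_tendsto (f : D.W → D.W) (hf : ∀ w, f (f w) = w) :
    ∃ S : Finset D.W → Finset D.W, Tendsto S atTop atTop ∧ ∀ s, ∀ w ∈ S s, f w ∈ S s := by
  classical
  refine ⟨fun s => s ∪ s.image f, tendsto_atTop_mono (fun _ => Finset.subset_union_left) tendsto_id,
    fun s w hw => ?_⟩
  rcases Finset.mem_union.1 hw with h | h
  · exact Finset.mem_union_right _ (Finset.mem_image_of_mem f h)
  · obtain ⟨x, hx, rfl⟩ := Finset.mem_image.1 h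
    rw [hf]
    exact Finset.mem_union_left _ hx

omit [Finite I] [FiniteDimensional ℝ V] in
theorem ConeLim.coef_smul {ι : Type*} {l : Filter ι} {F : ι → D.Ambient} {G : D.Ambient}
    (h : D.ConeLim l F G) (c : Coef T) : D.ConeLim l (fun i => c • F i) (c • G) := by
  simp only [Algebra.smul_def]
  exact ConeLim.mul D (D.coneLim_const fun u => D.algebraMap_mem_cone u c) h

omit [Finite I] [FiniteDimensional ℝ V] in
theorem cSimple_eq (i : I) : D.cSimple i =
    algebraMap (Coef T) D.Ambient (D.sig i) - D.bSimple i := rfl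

/-- `T_i P_σ = σ_i P_σ` -/
theorem r_smul_symCoeff (i : I) (v : D.W) :
    D.r i • D.symCoeff (D.r i * v) = D.symCoeff v := by
  obtain ⟨S, hS, hs⟩ := D.exists_stable_tendsto (D.r i * ·) (D.r_mul_r_mul i)
  have hv := ConeLim.comp_tendsto D (D.coneLim_symCoeff v) hS
  have hr := ConeLim.comp_tendsto D (D.coneLim_symCoeff (D.r i * v)) hS
  have h1 := ConeLim.add D
    (ConeLim.mul D (D.coneLim_const (D.expand_cSimple_mem i)) (ConeLim.smul D hr (D.r i)))
    (ConeLim.mul D (D.coneLim_const (D.expand_bSimple_mem i)) hv)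
  have h2 := ConeLim.unique D (h1.congr D (Eventually.of_forall fun s => by
    rw [← opT_mul_coeff, D.opT_mul_partialSum i (hs s), SkewMonoidAlgebra.coeff_smul,
      Finsupp.smul_apply])) (ConeLim.coef_smul D hv (D.sig i : Coef T))
  refine (D.isUnit_cFun (D.sig i) (D.sig' i) (D.regular_simpleCoroot i)).mul_left_cancel ?_
  change D.cSimple i * _ = D.cSimple i * _
  rw [Algebra.smul_def] at h2
  have h3 := D.cSimple_eq i
  linear_combination h2 - D.symCoeff v * h3

/-- `P_σ T_i = σ_i P_σ` -/
theorem symCoeff_mul_r (i : I) (v : D.W) :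
    D.symCoeff (v * D.r i) * (v * D.r i) • D.cSimple i = D.symCoeff v * v • D.cSimple i := by
  obtain ⟨S, hS, hs⟩ := D.exists_stable_tendsto (· * D.r i) (D.mul_r_mul_r i)
  have hv := ConeLim.comp_tendsto D (D.coneLim_symCoeff v) hS
  have hr := ConeLim.comp_tendsto D (D.coneLim_symCoeff (v * D.r i)) hS
  have h1 := ConeLim.add D
    (ConeLim.mul D hr (ConeLim.smul D (D.coneLim_const (D.expand_cSimple_mem i)) (v * D.r i)))
    (ConeLim.mul D hv (ConeLim.smul D (D.coneLim_const (D.expand_bSimple_mem i)) v))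
  have h2 := ConeLim.unique D (h1.congr D (Eventually.of_forall fun s => by
    rw [← mul_opT_coeff, D.partialSum_mul_opT i (hs s), SkewMonoidAlgebra.coeff_smul,
      Finsupp.smul_apply])) (ConeLim.coef_smul D hv (D.sig i : Coef T))
  rw [Algebra.smul_def] at h2
  rw [cSimple_eq D i, smul_sub v, smul_algebraMap', ← cSimple_eq]
  linear_combination h2

theorem smul_symCoeff_one (v : D.W) : v • D.symCoeff 1 = D.symCoeff v := by
  induction v using D.opTW_induction with
  | h1 => rw [one_smul]
  | h i w _ ih =>
    have h := D.r_smul_symCoeff i (D.r i * w)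
    rw [r_mul_r_mul] at h
    rw [mul_smul, ih, h]

theorem r_smul_symCoeff_one (i : I) :
    D.r i • D.symCoeff 1 * D.cFun (D.sig i) (D.sig' i) (-D.simpleCoroot i) =
      D.symCoeff 1 * D.cSimple i := by
  have h := D.symCoeff_mul_r i 1
  have h1 : D.r i • D.simpleCoroot i = -D.simpleCoroot i := by
    rw [← neg_neg (D.r i • D.simpleCoroot i), ← smul_neg, r_smul_neg_self]
  rw [one_mul, one_smul, ← smul_symCoeff_one, cSimple,
    D.smul_cFun _ _ _ (D.regular_simpleCoroot i), h1] at h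
  exact h

theorem expand_one_symCoeff_sub_one_mem : D.expand 1 (D.symCoeff 1 - 1) ∈ D.cone 1 1 := by
  classical
  obtain ⟨s, hs, h1⟩ := ((((D.coneLim_symCoeff 1) 1).2 1).and
    (eventually_ge_atTop ({1} : Finset D.W))).exists
  have h2 : (1 : D.W) ∈ s := h1 (Finset.mem_singleton_self 1)
  have h3 : D.expand 1 ((D.partialSum s).coeff 1 - 1) ∈ D.cone 1 1 := by
    have e : D.sigW 1 = 1 := D.ext_one D.sig
    rw [partialSum_coeff, ← Finset.add_sum_erase _ _ h2, e, opTW_one, SkewMonoidAlgebra.one_def,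
      SkewMonoidAlgebra.coeff_single, Finsupp.single_eq_same, Units.val_one, one_smul,
      add_sub_cancel_left, map_sum]
    exact sum_mem fun w hw =>
      D.expand_smul_mem _ (D.expand_opTW_coeff_one_mem (Finset.ne_of_mem_erase hw))
  have h4 := (D.cone 1 1).sub_mem h3 hs
  rwa [← map_sub, sub_sub_sub_cancel_left] at h4

end Eigenvector

section Limits

variable [Finite I] [FiniteDimensional ℝ V]

/-! ### Limits in the completion -/

omit [FiniteDimensional ℝ V] in
theorem mem_completion {F : ℕ → D.Ambient} {G : D.Ambient} (hF : ∀ n, F n ∈ D.fracAlg)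
    (h : D.ConeLim atTop F G) : G ∈ D.completion := ⟨F, hF, h.converges D⟩

omit [FiniteDimensional ℝ V] in
theorem tendsto_ball : Tendsto (fun N => (D.ball_finite N).toFinset) atTop atTop := by
  refine tendsto_atTop_finset_of_monotone (fun M N h w hw => ?_) fun w => ⟨D.length w, ?_⟩
  · rw [Set.Finite.mem_toFinset, Set.mem_ofPred_eq] at hw ⊢
    exact hw.trans h
  · rw [Set.Finite.mem_toFinset, Set.mem_ofPred_eq]

theorem Psi_PN (N : ℕ) : D.Psi (D.PN N) = D.partialSum (D.ball_finite N).toFinset := by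
  rw [PN, map_sum, partialSum]
  exact Finset.sum_congr rfl fun w _ => by rw [map_smul, Psi_H]

theorem coneLim_ball (v : D.W) :
    D.ConeLim atTop (fun N => (D.partialSum (D.ball_finite N).toFinset).coeff v) (D.symCoeff v) :=
  ConeLim.comp_tendsto D (D.coneLim_symCoeff v) D.tendsto_ball

theorem symCoeff_mem_completion (v : D.W) : D.symCoeff v ∈ D.completion :=
  D.mem_completion (fun _ => D.partialSum_coeff_mem _ v) (D.coneLim_ball v)

omit [FiniteDimensional ℝ V] in
theorem countable_posRoots : Countable D.posRoots := by
  have hW : Countable D.W := by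
    have : Function.Surjective D.wordProd := fun w => D.exists_word w
    exact this.countable
  have h : D.roots ⊆ Set.range fun p : D.W × I => D.dualAct p.1 (D.root p.2) := by
    rintro a ⟨w, i, rfl⟩
    exact ⟨(w, i), rfl⟩
  exact ((Set.countable_range _).mono (Set.inter_subset_left.trans h)).to_subtype

omit [FiniteDimensional ℝ V] in
/-- If the constant terms of the limit `G` of elements of `ℤ_σ(Y)` are `1` in all directions, then
`G⁻¹` is the limit of partial sums of geometric series, with the terms replaced by approximations
in `ℤ_σ(Y)`. -/
theorem exists_inverse_coneLim {F : ℕ → D.Ambient} {G : D.Ambient} (hF : ∀ n, F n ∈ D.fracAlg)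
    (h : D.ConeLim atTop F G) (h1 : ∀ u, D.expand u (G - 1) ∈ D.cone u 1) :
    ∃ G' ∈ D.completion, G * G' = 1 := by
  obtain ⟨G', hG', hGG'⟩ := D.exists_geom_coneLim (F := 1 - G) fun u => by
    rw [← neg_sub, map_neg]; exact (D.cone u 1).neg_mem (h1 u)
  rw [sub_sub_cancel] at hGG'
  refine ⟨G', D.mem_completion (F := fun N => ∑ k ∈ Finset.range N, (1 - F N) ^ k)
    (fun N => sum_mem fun k _ => pow_mem (sub_mem (one_mem _) (hF N)) k) fun u => ⟨(hG' u).1,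
    fun n => ?_⟩, hGG'⟩
  filter_upwards [(h u).2 1, (h u).2 n, eventually_ge_atTop n] with N hN1 hNn hN
  have hx : D.expand u (1 - F N) ∈ D.cone u 1 := by
    have h2 := (D.cone u 1).neg_mem ((D.cone u 1).add_mem hN1 (h1 u))
    rw [← map_add, ← map_neg, sub_add_sub_cancel, neg_sub] at h2
    exact h2
  have hpow : ∀ k, D.expand u ((1 - F N) ^ k) ∈ D.cone u k := fun k => by
    rw [map_pow]; exact D.pow_mem_cone hx k
  have hsum : D.expand u (∑ k ∈ Finset.range N, (1 - F N) ^ k) ∈ D.cone u 0 := by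
    rw [map_sum]
    exact sum_mem fun k _ => D.cone_le_zero (hpow k)
  have e : ∑ k ∈ Finset.range N, (1 - F N) ^ k - G' =
      -(G' * ((F N - G) * ∑ k ∈ Finset.range N, (1 - F N) ^ k + (1 - F N) ^ N)) := by
    have h3 := mul_neg_geom_sum (1 - F N) N
    rw [sub_sub_cancel] at h3
    linear_combination -(∑ k ∈ Finset.range N, (1 - F N) ^ k) * hGG' + G' * h3
  rw [e, map_neg, map_mul, map_add, map_mul]
  exact (D.cone u n).neg_mem (D.mul_mem_cone_right (hG' u).1 ((D.cone u n).add_mem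
    (D.mul_mem_cone_left hNn hsum) (D.cone_mono u hN (hpow N))))

omit [Finite I] [FiniteDimensional ℝ V] in
theorem smul_eq_self_of_r {F : D.Ambient} (h : ∀ i, D.r i • F = F) (v : D.W) : v • F = F := by
  induction v using D.opTW_induction with
  | h1 => rw [one_smul]
  | h i w _ ih => rw [mul_smul, ih, h]

omit [Finite I] [FiniteDimensional ℝ V] in
/-- An invariant element with constant term `1` in one direction has constant term `1` in all
directions. -/
theorem expand_sub_one_mem_of_invariant {F : D.Ambient} (h : ∀ v : D.W, v • F = F)
    (h1 : D.expand 1 (F - 1) ∈ D.cone 1 1) (u : D.W) : D.expand u (F - 1) ∈ D.cone u 1 := by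
  have h2 : ∀ w : D.W, w = 1 → D.expand w (F - 1) ∈ D.cone w 1 := by
    rintro _ rfl
    exact h1
  have h3 := D.smul_mem_cone (h2 (u⁻¹ * u) (inv_mul_cancel u))
  rwa [smul_sub, h, smul_one] at h3

end Limits

end HeckeDatum

theorem proposition5p6p9 {I T V : Type*} [Finite I] [NormedAddCommGroup V] [NormedSpace ℝ V]
    [FiniteDimensional ℝ V] (D : HeckeDatum I T V) :
    -- the denominators of the functions `b(α^∨)` and `c(α^∨)` can be inverted in every direction
    (∀ a : D.roots, IsUnit (1 - D.mono (2 • D.corootOf a))) ∧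
    -- the Bernstein-Lusztig-Hecke algebra is mapped to `ℤ_σ(Y)[W^v]`
    ∃ Psi : D.BLHecke →ₐ[HeckeDatum.Coef T] D.Twisted, D.IsCherednikRep Psi ∧
    -- `P_σ = ∑ C_v [v]` is well defined in `ℤ_σ((Y))[[W^v]]`
    ∃ C : D.W → D.completion, D.IsTSymmetrizer Psi (fun v => (C v : D.Ambient)) ∧
    -- `Δ` is well defined and invertible in `ℤ_σ((Y))`, and `J_σ` lies in `ℤ_σ((Y))[[W^v]]`
    ∃ Delta : (D.completion)ˣ, D.IsDelta ((Delta : D.completion) : D.Ambient) ∧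
      (∀ v : D.W, v • ((Delta : D.completion) : D.Ambient) ∈ D.completion) ∧
    -- the multiplier `m_σ = Γ Δ⁻¹`, where `Γ = C_e`
    ∃ m : D.completion, m = C 1 * ((Delta⁻¹ : (D.completion)ˣ) : D.completion) ∧
      IsUnit m ∧ (∀ v : D.W, v • (m : D.Ambient) = m) ∧
      -- `P_σ = m_σ J_σ`
      ∀ v : D.W, (C v : D.Ambient) = m * v • ((Delta : D.completion) : D.Ambient) := by
  obtain ⟨Delta, Delta', f', h, hf', h', hDelta⟩ := D.exists_delta
  have hc := D.countable_posRoots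
  obtain ⟨s, hs⟩ := exists_seq_tendsto (atTop : Filter (Finset D.posRoots))
  have hseq := HeckeDatum.ConeLim.comp_tendsto D h hs
  have hseq' := HeckeDatum.ConeLim.comp_tendsto D h' hs
  have hfrac : ∀ n, ∏ a ∈ s n, D.deltaFactor a ∈ D.fracAlg := fun n =>
    prod_mem fun a _ => D.deltaFactor_mem_fracAlg a
  have hfrac' : ∀ n, ∏ a ∈ s n, f' a ∈ D.fracAlg := fun n => prod_mem fun a _ => hf' a
  have hmem := D.mem_completion hfrac hseq
  have hmem' := D.mem_completion hfrac' hseq'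
  have hm := HeckeDatum.ConeLim.mul D (D.coneLim_ball 1) hseq'
  -- both `Γ` and `Δ` are multiplied by `c(α_i^∨) / c(-α_i^∨)` under `r_i`
  have hinv : ∀ v : D.W, v • (D.symCoeff 1 * Delta') = D.symCoeff 1 * Delta' := by
    refine D.smul_eq_self_of_r fun i => ?_
    have h1 := D.r_smul_symCoeff_one i
    have h2 := D.r_smul_delta h i
    have h3 : D.r i • Delta * D.r i • Delta' = 1 := by rw [← smul_mul', hDelta, smul_one]
    refine (D.isUnit_cFun (D.sig i) (D.sig' i)
      (D.regular_simpleCoroot i).neg).mul_left_cancel ?_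
    rw [smul_mul']
    linear_combination D.r i • Delta' * h1 - D.symCoeff 1 * Delta' * D.r i • Delta' * h2 +
      D.symCoeff 1 * Delta' * D.cFun (D.sig i) (D.sig' i) (-D.simpleCoroot i) * h3 -
      D.symCoeff 1 * D.cSimple i * D.r i • Delta' * hDelta
  have hone : D.expand 1 (D.symCoeff 1 * Delta' - 1) ∈ D.cone 1 1 := by
    obtain ⟨t, ht⟩ := ((h 1).2 1).exists
    have h1 := (D.cone 1 1).sub_mem
      (D.prod_sub_one_mem_cone t D.deltaFactor fun a _ => D.expand_one_deltaFactor_sub_one_mem a) ht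
    rw [← map_sub, sub_sub_sub_cancel_left] at h1
    have h2 := (D.cone 1 1).sub_mem D.expand_one_symCoeff_sub_one_mem h1
    rw [← map_sub, sub_sub_sub_cancel_right] at h2
    have e : D.symCoeff 1 * Delta' - 1 = (D.symCoeff 1 - Delta) * Delta' := by
      linear_combination hDelta
    rw [e, map_mul]
    exact D.mul_mem_cone_left h2 (h' 1).1
  obtain ⟨G, hG, hGm⟩ := D.exists_inverse_coneLim
    (fun n => mul_mem (D.partialSum_coeff_mem _ 1) (hfrac' n)) hm
    (D.expand_sub_one_mem_of_invariant hinv hone)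
  refine ⟨fun a => D.isUnit_one_sub_mono (D.regular_two_smul (D.regular_corootOf a)), D.Psi,
    D.isCherednikRep_Psi, fun v => ⟨D.symCoeff v, D.symCoeff_mem_completion v⟩, fun v => ?_,
    ⟨⟨Delta, hmem⟩, ⟨Delta', hmem'⟩, Subtype.ext hDelta,
      Subtype.ext ((mul_comm _ _).trans hDelta)⟩, h.converges D, fun v => ?_,
    ⟨D.symCoeff 1 * Delta', mul_mem (D.symCoeff_mem_completion 1) hmem'⟩, rfl,
    IsUnit.of_mul_eq_one ⟨G, hG⟩ (Subtype.ext hGm), hinv, fun v => ?_⟩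
  · simp only [HeckeDatum.Psi_PN]
    exact (D.coneLim_ball v).converges D
  · exact D.mem_completion (fun n => D.smul_mem_fracAlg v (hfrac n))
      (HeckeDatum.ConeLim.smul D hseq v)
  · change D.symCoeff v = D.symCoeff 1 * Delta' * v • Delta
    rw [← hinv v, ← smul_mul', mul_assoc, mul_comm Delta', hDelta, mul_one, D.smul_symCoeff_one]
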